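/- All graphs are finite and simple. $P_k$ is the path on $k$ vertices, $K_k$ the complete graph and $\overline K_k$ the edgeless graph on $k$ vertices, and $M_k$ is a maximum matching on $k$ vertices, i.e. $\lfloor k/2\rfloor$ disjoint edges together with one isolated vertex if $k$ is odd. $G\cup H$ denotes the disjoint union of $G$ and $H$, and $G+H$ the join, obtained from $G\cup H$ by adding all edges between $G$ and $H$. $ex(n,H)$ is the maximum number of edges of a graph on $n$ vertices that does not contain $H$ as a (not necessarily induced) subgraph; the graphs attaining this maximum are the extremal graphs for $H$ on $n$ vertices. For $m\ge l\ge 3$ and $n\ge m-1$ write $n=(m-1)+t(l-1)+r$ with integers $t\ge 0$ and $0\le r<l-1$, and put $$[n,m,l]=\binom{m-1}{2}+t\binom{l-1}{2}+\binom r2 .$$ For $n\ge m\ge 3$ put $$[n,m]=\binom{\lfloor m/2\rfloor-1}{2}+\Big\lfloor\frac{m-2}{2}\Big\rfloor\Big(n-\Big\lfloor\frac m2\Big\rfloor+1\Big);$$ in particular $[n,2l+2]=\binom l2+l(n-l)$. **Theorem 1.8.** Let $l\ge 2$ and $n\ge 2l+4$ be integers. Then $$ex(n,P_{2l+1}\cup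 P_3)=\max\{[n,2l+1,2l+1],\ [n,2l+4,3],\ [n,2l+2]+1\}.$$ Moreover, a graph $G$ on $n$ vertices is extremal for $P_{2l+1}\cup P_3$ if and only if (at least) one of the following holds: 1. $[n,2l+1,2l+1]$ equals the above maximum and $G$ is an extremal graph for $P_{2l+1}$ on $n$ vertices; 2. $[n,2l+4,3]$ equals the above maximum and $G$ is isomorphic to $K_{2l+3}\cup M_{n-2l-3}$; 3. $[n,2l+2]+1$ equals the above maximum and $G$ is isomorphic to $K_l+(K_2\cup\overline K_{n-l-2})$. -/

import Mathlib

namespace DisjointPaths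

/-- The number `[n, m, l]`: writing `n = (m - 1) + t (l - 1) + r` with `0 ≤ r < l - 1`, it is
`C(m - 1, 2) + t C(l - 1, 2) + C(r, 2)`, the number of edges of `K_{m-1} ∪ t · K_{l-1} ∪ K_r`;
for `n ≤ m - 1` it is `C(n, 2)`. It is meant for `m ≥ l ≥ 3`. -/
def bracket₃ (n m l : ℕ) : ℕ :=
  if n ≤ m - 1 then n.choose 2
  else (m - 1).choose 2 + (n - (m - 1)) / (l - 1) * (l - 1).choose 2
    + ((n - (m - 1)) % (l - 1)).choose 2

/-- The number `[n, m] = C(⌊m/2⌋ - 1, 2) + ⌊(m - 2)/2⌋ (n - ⌊m/2⌋ + 1)`, the number of edges of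
the join of `K_{⌊m/2⌋-1}` with an independent set of `n - ⌊m/2⌋ + 1` vertices.
It is meant for `n ≥ m ≥ 3`. -/
def bracket₂ (n m : ℕ) : ℕ :=
  (m / 2 - 1).choose 2 + (m - 2) / 2 * (n - m / 2 + 1)

/-- The join `G + H`: the disjoint union of `G` and `H` together with all edges between them. -/
def join {V W : Type*} (G : SimpleGraph V) (H : SimpleGraph W) : SimpleGraph (V ⊕ W) :=
  SimpleGraph.sum G H ⊔ completeBipartiteGraph V W

/-- `M_k`: a maximum matching on `k` vertices, i.e. `⌊k/2⌋` disjoint edges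
`{0, 1}, {2, 3}, …` and one isolated vertex if `k` is odd. -/
def matching (k : ℕ) : SimpleGraph (Fin k) where
  Adj i j := i ≠ j ∧ (i : ℕ) / 2 = (j : ℕ) / 2
  symm := ⟨fun _ _ h => ⟨h.1.symm, h.2.symm⟩⟩
  loopless := ⟨fun _ h => h.1 rfl⟩

/-- `P_{2l+1} ∪ P_3`, where `P_k` is the path on `k` vertices. -/
abbrev twoPaths (l : ℕ) : SimpleGraph (Fin (2 * l + 1) ⊕ Fin 3) :=
  SimpleGraph.sum (SimpleGraph.pathGraph (2 * l + 1)) (SimpleGraph.pathGraph 3)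

/-- `K_{2l+3} ∪ M_{n-2l-3}`. -/
abbrev cliqueWithMatching (n l : ℕ) :
    SimpleGraph (Fin (2 * l + 3) ⊕ Fin (n - (2 * l + 3))) :=
  SimpleGraph.sum (⊤ : SimpleGraph (Fin (2 * l + 3))) (matching (n - (2 * l + 3)))

/-- `K_l + (K_2 ∪ \bar K_{n-l-2})`. -/
abbrev joinWithEdge (n l : ℕ) :
    SimpleGraph (Fin l ⊕ (Fin 2 ⊕ Fin (n - (l + 2)))) :=
  join (⊤ : SimpleGraph (Fin l))
    (SimpleGraph.sum (⊤ : SimpleGraph (Fin 2)) (⊥ : SimpleGraph (Fin (n - (l + 2)))))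

/-- `max {[n, 2l+1, 2l+1], [n, 2l+4, 3], [n, 2l+2] + 1}`. -/
def maxBracket (n l : ℕ) : ℕ :=
  max (max (bracket₃ n (2 * l + 1) (2 * l + 1)) (bracket₃ n (2 * l + 4) 3))
    (bracket₂ n (2 * l + 2) + 1)

end DisjointPaths

/-! All edge counts are doubled: `pairs` is twice the number of edges, so every bound is an integer
polynomial plus matching terms.

A graph without `P_{2l+1}` satisfies the Faudree–Schelp bound `pairs_le_cliquesPairs`, which is the
first term of the maximum. Suppose instead that `G` contains `P_{2l+1}` but not `P_{2l+1} ∪ P_3`,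
and let `C` be the component of such a path. Outside `C` there is no `P_3`, hence only a matching
(`exists_path_component`). If `C` has at most `2l+3` vertices, comparison with a clique gives the
second term, with equality only for `K_{2l+3} ∪ M`. If `C` is larger, it remains to bound a
connected graph on at least `2l+4` vertices: vertices of the matching contribute less than vertices
joined to `K_l`, so equality in the third term forces `C` to be everything.

The main tool is Kopylov's theorem (`exists_degenOver`). A connected graph on more than `p` vertices
without a path on `p+1` vertices can be peeled down to a set of at most `p-t` vertices, each removal
costing at most `t` edges, for some `t` with `1 ≤ t` and `2t+1 ≤ p`. The resulting bound is convex
in `t`, so only its ends matter. For the proof, make the graph edge-maximal. Two nonadjacent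
vertices then start disjoint paths with more than `p` vertices in total, and Pósa's lemma
(`degIn_add_degIn_lt`) bounds the sum of their degrees into these paths. If both vertices come from
sets of large inner minimum degree, one path can always be extended while its new end stays
nonadjacent to the other end, which is absurd in a finite graph (`adj_of_le_degIn`). Large cores
therefore become cliques, and comparing two of them gives a contradiction.

For connected `C` without a path on `2l+3` vertices, Kopylov with `p = 2l+2` leaves `t = l`, whose
bound is exactly the third term; `exists_isJoinEdge` settles equality, by peeling down to `2l+3`
vertices and adding the vertices back. If `C` does contain a path on `2l+3` vertices, the inequality
is strict (`pairs_univ_lt_max`). Vertices off the path attach to it in very few ways. Either they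
send so few edges that the graph stays below `K_{2l+3}`, or a `P_3` touching few edges can be
deleted. After the deletion, either the rest of the path lies in one component, which has no
`P_{2l+1}` and obeys Kopylov with `p = 2l`, or the path splits at one vertex and falls apart into
two small blocks. -/

namespace DisjointPaths

open Finset
open scoped Classical

/-! ### Doubled edge counts and peeling off vertices of small degree. -/

section Counting

variable {V : Type*} (G : SimpleGraph V)

/-- The number of neighbours of `v` inside `s`. -/
noncomputable def degIn (s : Finset V) (v : V) : ℕ := #{y ∈ s | G.Adj v y}

/-- The number of ordered adjacent pairs inside `s`, i.e. twice the number of edges of `G[s]`. -/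
noncomputable def pairs (s : Finset V) : ℕ := ∑ v ∈ s, degIn G s v

/-- Every set of vertices not contained in `Q` has a vertex outside `Q` with at most `t`
neighbours in the set. -/
def DegenOver (t : ℕ) (Q : Finset V) : Prop :=
  ∀ T : Finset V, ¬ T ⊆ Q → ∃ v ∈ T, v ∉ Q ∧ degIn G T v ≤ t

variable {G}

lemma degIn_mono {s t : Finset V} (h : s ⊆ t) (v : V) : degIn G s v ≤ degIn G t v :=
  card_le_card (filter_subset_filter _ h)

lemma degIn_mono_graph {G' : SimpleGraph V} (h : G ≤ G') (s : Finset V) (v : V) :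
    degIn G s v ≤ degIn G' s v :=
  card_le_card fun y hy => by
    simp only [mem_filter] at hy ⊢
    exact ⟨hy.1, h hy.2⟩

lemma degIn_lt_card {s : Finset V} {v : V} (hv : v ∈ s) : degIn G s v < #s :=
  card_lt_card <| by
    refine ⟨filter_subset _ _, fun h => ?_⟩
    simpa using h hv

lemma degIn_add_card_le {s N : Finset V} {v : V} (hN : N ⊆ s) (h : ∀ y ∈ N, ¬ G.Adj v y) :
    degIn G s v + #N ≤ #s := by
  have : degIn G s v ≤ #(s \ N) := card_le_card fun y hy => by
    simp only [mem_filter, mem_sdiff] at hy ⊢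
    exact ⟨hy.1, fun hN => h y hN hy.2⟩
  rw [card_sdiff_of_subset hN] at this
  have := card_le_card hN
  omega

lemma degIn_union {s t : Finset V} (h : Disjoint s t) (v : V) :
    degIn G (s ∪ t) v = degIn G s v + degIn G t v := by
  unfold degIn
  rw [filter_union, card_union_of_disjoint (disjoint_filter_filter h)]

lemma degIn_insert_self (s : Finset V) (v : V) : degIn G (insert v s) v = degIn G s v := by
  unfold degIn
  rw [filter_insert, if_neg (G.irrefl)]

lemma degIn_erase_self (s : Finset V) (v : V) : degIn G (s.erase v) v = degIn G s v := by
  by_cases h : v ∈ s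
  · conv_rhs => rw [← insert_erase h, degIn_insert_self]
  · rw [erase_eq_of_notMem h]

lemma degIn_insert {s : Finset V} {v : V} (hv : v ∉ s) (x : V) :
    degIn G (insert v s) x = degIn G s x + if G.Adj x v then 1 else 0 := by
  unfold degIn
  rw [filter_insert]
  split_ifs with h
  · rw [card_insert_of_notMem (by simp [hv])]
  · simp

lemma sum_adj_eq_degIn (s : Finset V) (v : V) :
    ∑ x ∈ s, (if G.Adj x v then 1 else 0) = degIn G s v := by
  unfold degIn
  rw [card_filter]
  exact sum_congr rfl fun x _ => by simp only [G.adj_comm]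

lemma pairs_insert {s : Finset V} {v : V} (hv : v ∉ s) :
    pairs G (insert v s) = pairs G s + 2 * degIn G s v := by
  unfold pairs
  rw [sum_insert hv, degIn_insert_self, sum_congr rfl fun x _ => degIn_insert hv x,
    sum_add_distrib, sum_adj_eq_degIn]
  ring

lemma pairs_erase {s : Finset V} {v : V} (hv : v ∈ s) :
    pairs G s = pairs G (s.erase v) + 2 * degIn G s v := by
  conv_lhs => rw [← insert_erase hv]
  rw [pairs_insert (notMem_erase _ _), degIn_erase_self]

@[simp] lemma pairs_empty : pairs G ∅ = 0 := by simp [pairs]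

lemma pairs_le_clique (s : Finset V) : pairs G s ≤ #s * (#s - 1) := by
  refine (sum_le_card_nsmul _ _ (#s - 1) fun v hv => ?_).trans (by simp)
  have := degIn_lt_card (G := G) hv
  omega

lemma pairs_mono_graph {G' : SimpleGraph V} (h : G ≤ G') (s : Finset V) :
    pairs G s ≤ pairs G' s := sum_le_sum fun v _ => degIn_mono_graph h s v

lemma pairs_union_of_forall_not_adj {s t : Finset V} (hd : Disjoint s t)
    (h : ∀ x ∈ s, ∀ y ∈ t, ¬ G.Adj x y) : pairs G (s ∪ t) = pairs G s + pairs G t := by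
  unfold pairs
  rw [sum_union hd]
  congr 1
  · refine sum_congr rfl fun x hx => ?_
    rw [degIn_union hd, Nat.add_eq_left, degIn, card_eq_zero, filter_eq_empty_iff]
    exact fun y hy => h x hx y hy
  · refine sum_congr rfl fun y hy => ?_
    rw [degIn_union hd, Nat.add_eq_right, degIn, card_eq_zero, filter_eq_empty_iff]
    exact fun x hx hxy => h x hx y hy hxy.symm

/-- Removing the vertices of `t` one at a time, each of degree at most `d`. -/
lemma pairs_union_le {s t : Finset V} {d : ℕ} (hd : Disjoint s t)
    (h : ∀ x ∈ t, degIn G (s ∪ t) x ≤ d) : pairs G (s ∪ t) ≤ pairs G s + 2 * d * #t := by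
  induction t using Finset.induction_on with
  | empty => simp
  | insert a t ha ih =>
    rw [disjoint_insert_right] at hd
    have has : a ∉ s ∪ t := by simp [hd.1, ha]
    rw [union_insert, pairs_insert has, card_insert_of_notMem ha]
    have h1 := ih hd.2 fun x hx => (degIn_mono (by
      rw [union_insert]; exact subset_insert _ _) x).trans (h x (mem_insert_of_mem hx))
    have h2 : degIn G (s ∪ t) a ≤ d := (degIn_mono (by
      rw [union_insert]; exact subset_insert _ _) a).trans (h a (mem_insert_self _ _))
    nlinarith

/-- A set with more than `k ≥ #Q` vertices is not contained in `Q`, so a vertex of degree at most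
`t` can be removed until exactly `k` vertices are left. Keeping `pairs G Q'` in the bound, instead
of its clique estimate, is what the equality case needs. -/
lemma DegenOver.exists_pairs_le {t k : ℕ} {Q T : Finset V} (h : DegenOver G t Q) (hQ : #Q ≤ k)
    (hT : k ≤ #T) : ∃ Q' ⊆ T, #Q' = k ∧ pairs G T ≤ pairs G Q' + 2 * t * (#T - k) := by
  induction hm : #T - k generalizing T with
  | zero => exact ⟨T, Subset.rfl, by omega, by simp⟩
  | succ m ih =>
    obtain ⟨v, hv, -, hd⟩ := h T fun hs => by
      have := card_le_card hs
      omega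
    have hc := card_erase_of_mem hv
    obtain ⟨Q', hQ', hk, hp⟩ := ih (T := T.erase v) (by omega) (by omega)
    refine ⟨Q', hQ'.trans (erase_subset _ _), hk, ?_⟩
    rw [pairs_erase hv]
    calc _ ≤ pairs G Q' + 2 * t * m + 2 * t := by omega
      _ = _ := by ring

lemma DegenOver.pairs_le {t k : ℕ} {Q T : Finset V} (h : DegenOver G t Q) (hQ : #Q ≤ k)
    (hT : k ≤ #T) : pairs G T ≤ k * (k - 1) + 2 * t * (#T - k) := by
  obtain ⟨Q', -, hk, hp⟩ := h.exists_pairs_le hQ hT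
  have := pairs_le_clique (G := G) Q'
  rw [hk] at this
  omega

lemma DegenOver.anti_graph {G' : SimpleGraph V} {t : ℕ} {Q : Finset V} (h : G ≤ G')
    (hd : DegenOver G' t Q) : DegenOver G t Q := fun T hT => by
  obtain ⟨v, hv, hvQ, hvd⟩ := hd T hT
  exact ⟨v, hv, hvQ, (degIn_mono_graph h T v).trans hvd⟩

lemma pairs_map {W : Type*} {G' : SimpleGraph W} (f : G ↪g G') (s : Finset V) :
    pairs G' (s.map f.toEmbedding) = pairs G s := by
  unfold pairs
  rw [sum_map]
  refine sum_congr rfl fun x _ => ?_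
  unfold degIn
  rw [filter_map, card_map]
  congr 1
  ext y
  simp

lemma pairs_induce (s : Finset V) :
    pairs (G.induce (s : Set V)) (univ : Finset (s : Set V)) = pairs G s := by
  rw [← pairs_map (SimpleGraph.Embedding.induce (s : Set V))]
  congr 1
  ext x
  simp [SimpleGraph.Embedding.induce]

lemma pairs_iso {W : Type*} [Fintype V] [Fintype W] {G' : SimpleGraph W} (f : G ≃g G') :
    pairs G' univ = pairs G univ := by
  rw [← pairs_map f.toEmbedding]
  congr 1
  ext x
  simp

lemma two_mul_card_edgeFinset [Fintype V] [Fintype G.edgeSet] :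
    2 * #G.edgeFinset = pairs G univ := by
  have := G.sum_degrees_eq_twice_card_edges
  unfold pairs
  convert this.symm using 2
  · congr!
  · rename_i v _
    rw [← SimpleGraph.card_neighborFinset_eq_degree]
    unfold degIn
    congr 1
    ext y
    simp

lemma pairs_eq_of_le_of_pairs_le [Fintype V] {G' : SimpleGraph V} (h : G ≤ G')
    (hp : pairs G' univ ≤ pairs G univ) : G = G' := by
  rw [← two_mul_card_edgeFinset, ← two_mul_card_edgeFinset] at hp
  have h1 := SimpleGraph.edgeFinset_subset_edgeFinset.2 h
  exact SimpleGraph.edgeFinset_inj.1 (eq_of_subset_of_card_le h1 (by omega))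

end Counting


/-! ### Vertex lists of paths: crossings and rotations. -/

section Paths

variable {V : Type*} {G : SimpleGraph V}

/-- The vertex lists of paths. -/
def IsPathList (G : SimpleGraph V) (L : List V) : Prop := L.IsChain G.Adj ∧ L.Nodup

/-- `G` contains a path on at least `k` vertices. -/
def HasPath (G : SimpleGraph V) (k : ℕ) : Prop := ∃ L, IsPathList G L ∧ k ≤ L.length

lemma isChain_adj_reverse {L : List V} (h : L.IsChain G.Adj) : L.reverse.IsChain G.Adj := by
  rw [List.isChain_reverse]
  exact h.imp fun _ _ h => h.symm

lemma IsPathList.reverse {L : List V} (h : IsPathList G L) : IsPathList G L.reverse :=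
  ⟨isChain_adj_reverse h.1, List.nodup_reverse.2 h.2⟩

lemma IsPathList.infix {L L' : List V} (h : IsPathList G L) (hL : L' <:+: L) : IsPathList G L' :=
  ⟨h.1.infix hL, h.2.sublist hL.sublist⟩

lemma IsPathList.take {L : List V} (h : IsPathList G L) (k : ℕ) : IsPathList G (L.take k) :=
  h.infix (List.take_prefix _ _).isInfix

lemma IsPathList.drop {L : List V} (h : IsPathList G L) (k : ℕ) : IsPathList G (L.drop k) :=
  h.infix (List.drop_suffix _ _).isInfix

lemma IsPathList.append {L L' : List V} (h : IsPathList G L) (h' : IsPathList G L')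
    (hd : L.Disjoint L') (hj : ∀ x ∈ L.getLast?, ∀ y ∈ L'.head?, G.Adj x y) :
    IsPathList G (L ++ L') :=
  ⟨List.isChain_append.2 ⟨h.1, h'.1, hj⟩, List.nodup_append'.2 ⟨h.2, h'.2, hd⟩⟩

lemma IsPathList.cons {L : List V} {v : V} (h : IsPathList G L) (hv : v ∉ L)
    (hj : ∀ y ∈ L.head?, G.Adj v y) : IsPathList G (v :: L) :=
  ⟨List.isChain_cons.2 ⟨hj, h.1⟩, List.nodup_cons.2 ⟨hv, h.2⟩⟩

lemma HasPath.map {W : Type*} {G' : SimpleGraph W} {k : ℕ} (h : HasPath G k) (f : G →g G')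
    (hf : Function.Injective f) : HasPath G' k := by
  obtain ⟨L, hL, hl⟩ := h
  refine ⟨L.map f, ⟨?_, hL.2.map hf⟩, by simpa⟩
  rw [List.isChain_map]
  exact hL.1.imp fun _ _ h => f.map_adj h

lemma not_hasPath_length {p : ℕ} (hp : ¬ HasPath G (p + 1)) {L : List V} (hL : IsPathList G L) :
    L.length ≤ p := by
  by_contra h
  exact hp ⟨L, hL, by omega⟩

/-- The number of indices in a gap between a crossing pair is bounded. -/
lemma card_add_card_add_gap_le {s g : ℕ} {U W : Finset ℕ} (hU : U ⊆ range s) (hW : W ⊆ range s)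
    (h0 : 0 ∉ U) (hne : W.Nonempty) (hg : 1 ≤ g)
    (hgap : ∀ k ∈ W, ∀ k', k < k' → k' ∈ insert s U → k + g < k') : #U + #W + g ≤ s := by
  -- `k₀` is the last position in `W` and `k₁` the first position of `U ∪ {s}` after it. The set
  -- `W`, the set `U ∪ {s}` shifted down by one, and the positions strictly between `k₀` and `k₁ -
  -- 1` are disjoint parts of `range s`.
  set k₀ := W.max' hne
  have hk₀ : k₀ ∈ W := W.max'_mem hne
  have hk₀s : k₀ < s := mem_range.1 (hW hk₀)
  have hne' : ((insert s U).filter (k₀ < ·)).Nonempty := ⟨s, by simp [hk₀s]⟩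
  set k₁ := ((insert s U).filter (k₀ < ·)).min' hne' with hk₁def
  have hk₁ := min'_mem _ hne'
  rw [← hk₁def, mem_filter] at hk₁
  have hgap₀ := hgap k₀ hk₀ k₁ hk₁.2 hk₁.1
  have hk₁s : k₁ ≤ s := by
    rcases mem_insert.1 hk₁.1 with h | h
    · exact h.le
    · exact (mem_range.1 (hU h)).le
  have hpos : ∀ k ∈ insert s U, 0 < k := fun k hk => by
    rcases mem_insert.1 hk with h | h
    · omega
    · exact Nat.pos_of_ne_zero fun h' => h0 (h' ▸ h)
  have hc1 : #((insert s U).image (· - 1)) = #U + 1 := by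
    rw [card_image_of_injOn, card_insert_of_notMem fun h => by simpa using hU h]
    intro a ha b hb hab
    have := hpos a ha
    have := hpos b hb
    simp only at hab
    omega
  have hd1 : Disjoint W ((insert s U).image (· - 1)) := by
    rw [disjoint_left]
    intro a ha ha'
    obtain ⟨k, hk, rfl⟩ := mem_image.1 ha'
    have := hpos k hk
    have := hgap _ ha k (by omega) hk
    omega
  have hd2 : Disjoint (W ∪ (insert s U).image (· - 1)) (Ico (k₀ + 1) (k₁ - 1)) := by
    rw [disjoint_left]
    intro a ha ha'
    rw [mem_Ico] at ha'
    rcases mem_union.1 ha with h | h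
    · have := W.le_max' a h
      omega
    · obtain ⟨k, hk, rfl⟩ := mem_image.1 h
      have : k₁ ≤ k := min'_le _ _ (by simp only [mem_filter]; exact ⟨hk, by omega⟩)
      omega
  have hsub : W ∪ (insert s U).image (· - 1) ∪ Ico (k₀ + 1) (k₁ - 1) ⊆ range s := by
    intro a ha
    rcases mem_union.1 ha with h | h
    · rcases mem_union.1 h with h | h
      · exact hW h
      · obtain ⟨k, hk, rfl⟩ := mem_image.1 h
        have := hpos k hk
        rcases mem_insert.1 hk with h | h
        · simp; omega
        · have := mem_range.1 (hU h)
          simp; omega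
    · rw [mem_Ico] at h
      simp; omega
  have := card_le_card hsub
  rw [card_union_of_disjoint hd2, card_union_of_disjoint hd1, hc1, Nat.card_Ico, card_range] at this
  omega

/-- The positions in `A` of the neighbours of `u`. -/
noncomputable def nbrIdx (G : SimpleGraph V) (A : List V) (u : V) : Finset ℕ :=
  {k ∈ range A.length | ∃ x, A[k]? = some x ∧ G.Adj u x}

lemma card_nbrIdx {A : List V} (hA : A.Nodup) (u : V) :
    #(nbrIdx G A u) = degIn G A.toFinset u := by
  unfold degIn nbrIdx
  refine card_bij' (fun k _ => A.getD k u) (fun x _ => A.idxOf x) ?_ ?_ ?_ ?_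
  · intro k hk
    simp only [mem_filter, mem_range] at hk
    obtain ⟨hk, x, hx, hux⟩ := hk
    rw [List.getElem?_eq_some_iff] at hx
    obtain ⟨h, rfl⟩ := hx
    simp [hk, hux]
  · intro x hx
    simp only [mem_filter, List.mem_toFinset] at hx
    simp only [mem_filter, mem_range, List.idxOf_lt_length_iff]
    exact ⟨hx.1, x, by simp [hx.1], hx.2⟩
  · intro k hk
    simp only [mem_filter, mem_range] at hk
    simp [hk.1, hA.idxOf_getElem]
  · intro x hx
    simp only [mem_filter, List.mem_toFinset] at hx
    simp [hx.1]

lemma mem_nbrIdx {A : List V} {u : V} {k : ℕ} :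
    k ∈ nbrIdx G A u ↔ ∃ x, A[k]? = some x ∧ G.Adj u x := by
  unfold nbrIdx
  simp only [mem_filter, mem_range, and_iff_right_iff_imp, forall_exists_index, and_imp]
  intro x hx _
  exact (List.getElem?_eq_some_iff.1 hx).1

/-- Rerouting two disjoint paths starting at `u` and `v` at a crossing pair of neighbours. -/
lemma crossing_length_le {p : ℕ} (hp : ¬ HasPath G (p + 1)) {A B : List V} {u v : V}
    (hA : IsPathList G A) (hB : IsPathList G B) (hd : A.Disjoint B) (hu : A.head? = some u)
    (hv : B.head? = some v) {k k' : ℕ} (hk : k ∈ nbrIdx G A v) (hkk' : k < k')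
    (hk' : k' ∈ insert A.length (nbrIdx G A u)) :
    A.length + B.length + k + 1 ≤ p + k' := by
  have hk's : k' ≤ A.length := by
    rcases mem_insert.1 hk' with h | h
    · exact h.le
    · exact (mem_range.1 (mem_filter.1 h).1).le
  have h1 : IsPathList G (A.take (k + 1) ++ B) := by
    refine (hA.take _).append hB (fun x hx => hd (List.take_subset _ _ hx)) ?_
    intro x hx y hy
    rw [hv, Option.mem_some_iff] at hy
    subst hy
    obtain ⟨z, hz, hvz⟩ := mem_nbrIdx.1 hk
    have : (A.take (k + 1)).getLast? = some z := by
      rw [List.getLast?_take]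
      simp [hz]
    rw [this, Option.mem_some_iff] at hx
    exact hx ▸ hvz.symm
  -- From the end of `A` back to position `k'`, across to `u`, forward to position `k`, across to
  -- `v`, then along `B`: only the positions strictly between `k` and `k'` are lost. The value `k' =
  -- A.length` stands for an empty first piece.
  have h2 : IsPathList G ((A.drop k').reverse ++ (A.take (k + 1) ++ B)) := by
    refine (hA.drop _).reverse.append h1 ?_ ?_
    · intro x hx hx'
      rw [List.mem_reverse] at hx
      rcases List.mem_append.1 hx' with h | h
      · exact List.disjoint_take_drop hA.2 (by omega : k + 1 ≤ k') h hx
      · exact hd (List.drop_subset _ _ hx) h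
    · intro x hx y hy
      rw [List.getLast?_reverse, List.head?_drop] at hx
      have hy' : y = u := by
        have : (A.take (k + 1) ++ B).head? = some u := by
          rw [List.head?_append, List.head?_take]
          simp [hu]
        rw [this] at hy
        simpa using hy.symm
      subst hy'
      rcases mem_insert.1 hk' with h | h
      · rw [h] at hx
        simp at hx
      · obtain ⟨z, hz, huz⟩ := mem_nbrIdx.1 h
        rw [hz] at hx
        simp only [Option.mem_some_iff] at hx
        exact hx ▸ huz.symm
  have := not_hasPath_length hp h2
  simp only [List.length_append, List.length_reverse, List.length_drop, List.length_take] at this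
  omega

/-- Rotating a path so that it ends at a prescribed vertex `x` of `A` while still covering all
neighbours of its first vertex. -/
lemma exists_rotation {A : List V} {u x : V} (hA : IsPathList G A) (hu : A.head? = some u)
    (hx : x ∈ A) : ∃ A', IsPathList G A' ∧ A' ⊆ A ∧ A'.getLast? = some x ∧
      degIn G A.toFinset u + 1 ≤ A'.length := by
  rw [← card_nbrIdx hA.2]
  obtain ⟨j, hj, rfl⟩ := List.getElem_of_mem hx
  have h0 : 0 ∉ nbrIdx G A u := fun h => by
    obtain ⟨z, hz, huz⟩ := mem_nbrIdx.1 h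
    rw [List.head?_eq_getElem?, hz] at hu
    simp only [Option.some.injEq] at hu
    exact G.irrefl (hu ▸ huz)
  -- A neighbour of `u` at a position `i > j` closes the first `i + 1` vertices into a cycle, which
  -- is cut just after `j`. If no such `i` is large enough, the initial segment ending at `j` is
  -- already long enough.
  by_cases hbig : ∃ i ∈ nbrIdx G A u, #(nbrIdx G A u) ≤ i ∧ j < i
  · obtain ⟨i, hi, hci, hji⟩ := hbig
    obtain ⟨z, hz, huz⟩ := mem_nbrIdx.1 hi
    have hil := (List.getElem?_eq_some_iff.1 hz).1
    refine ⟨(A.take (i + 1)).drop (j + 1) ++ A.take (j + 1), ?_, ?_, ?_, ?_⟩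
    · refine ((hA.take _).drop _).append (hA.take _) ?_ ?_
      · intro y hy hy'
        refine List.disjoint_take_drop hA.2 le_rfl hy' ?_
        rw [List.drop_take] at hy
        exact List.take_subset _ _ hy
      · intro a ha b hb
        have h1 : ((A.take (i + 1)).drop (j + 1)).getLast? = some z := by
          rw [List.getLast?_drop, if_neg (by simp; omega), List.getLast?_take]
          simp [hz]
        have h2 : (A.take (j + 1)).head? = some u := by simp [List.head?_take, hu]
        rw [h1] at ha
        rw [h2] at hb
        simp only [Option.mem_some_iff] at ha hb
        exact ha ▸ hb ▸ huz.symm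
    · rw [List.append_subset]
      exact ⟨fun x hx => List.take_subset _ _ (List.drop_subset _ _ hx), List.take_subset _ _⟩
    · rw [List.getLast?_append, List.getLast?_take]
      simp [hj]
    · simp only [List.length_append, List.length_drop, List.length_take]
      omega
  · push Not at hbig
    refine ⟨A.take (j + 1), hA.take _, List.take_subset _ _, ?_, ?_⟩
    · rw [List.getLast?_take]
      simp [hj]
    · have : #(nbrIdx G A u) ≤ j := by
        by_contra hcon
        push Not at hcon
        have hne : (nbrIdx G A u).Nonempty := card_pos.1 (by omega)
        set i := (nbrIdx G A u).max' hne
        have hi : i ∈ nbrIdx G A u := max'_mem _ _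
        have hsub : nbrIdx G A u ⊆ Ioc 0 i := fun k hk => by
          rw [mem_Ioc]
          exact ⟨Nat.pos_of_ne_zero fun h => h0 (h ▸ hk), le_max' _ _ hk⟩
        have := card_le_card hsub
        rw [Nat.card_Ioc] at this
        have := hbig i hi (by omega)
        omega
      simp only [List.length_take]
      omega

end Paths


/-! ### Pósa's lemma and Kopylov's extension argument. -/

section Posa

variable {V : Type*} {G : SimpleGraph V}

/-- In a connected graph any two disjoint nonempty sets are joined by a path meeting each of them
only in an end vertex. -/
lemma exists_link (hG : G.Connected) {X Y : Set V} (hX : X.Nonempty) (hY : Y.Nonempty)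
    (hXY : Disjoint X Y) : ∃ a ∈ X, ∃ b ∈ Y, ∃ R : List V, IsPathList G (a :: (R ++ [b])) ∧
      ∀ z ∈ R, z ∉ X ∧ z ∉ Y := by
  have hex : ∃ n, ∃ a ∈ X, ∃ b ∈ Y, G.dist a b = n :=
    let ⟨a, ha⟩ := hX
    let ⟨b, hb⟩ := hY
    ⟨_, a, ha, b, hb, rfl⟩
  obtain ⟨a, ha, b, hb, hab⟩ := Nat.find_spec hex
  obtain ⟨w, hw, hwl⟩ := hG.exists_path_of_dist a b
  have hne : a ≠ b := fun h => Set.disjoint_left.1 hXY ha (h ▸ hb)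
  have hnil : w.support.tail ≠ [] := by
    intro h
    have h1 := congrArg List.length h
    simp only [List.length_tail, SimpleGraph.Walk.length_support, List.length_nil] at h1
    exact hne (SimpleGraph.Walk.eq_of_length_eq_zero (by omega : w.length = 0))
  have hlast : w.support.tail.getLast hnil = b := by
    rw [List.getLast_tail, SimpleGraph.Walk.getLast_support]
  have hsup : w.support = a :: (w.support.tail.dropLast ++ [b]) := by
    have h := List.dropLast_append_getLast hnil
    rw [hlast] at h
    rw [h, SimpleGraph.Walk.cons_tail_support]
  have hpath : IsPathList G (a :: (w.support.tail.dropLast ++ [b])) := by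
    rw [← hsup]
    exact ⟨w.isChain_adj_support, hw.support_nodup⟩
  refine ⟨a, ha, b, hb, w.support.tail.dropLast, hpath, fun z hz => ?_⟩
  have hzs : z ∈ w.support := by
    rw [hsup]
    simp [hz]
  have hza : z ≠ a := by
    rintro rfl
    have := (List.nodup_cons.1 hpath.2).1
    exact this (List.mem_append_left _ hz)
  have hzb : z ≠ b := by
    rintro rfl
    have := List.nodup_append'.1 (List.nodup_cons.1 hpath.2).2
    exact this.2.2 hz (by simp)
  constructor
  · intro hzX
    have h1 := Nat.find_min' hex ⟨z, hzX, b, hb, rfl⟩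
    have h2 := SimpleGraph.dist_le (w.dropUntil z hzs)
    have h3 := w.length_dropUntil_lt_length hzs hza
    omega
  · intro hzY
    have h1 := Nat.find_min' hex ⟨a, ha, z, hzY, rfl⟩
    have h2 := SimpleGraph.dist_le (w.takeUntil z hzs)
    have h3 := w.length_takeUntil_lt_length hzs hzb
    omega

/-- The gap count with `g = |A| + |B| - p`: rerouting at a crossing pair loses only the positions
strictly between its members, so at least `g` of these must exist. -/
lemma card_nbrIdx_add_le {p : ℕ} (hp : ¬ HasPath G (p + 1)) {A B : List V} {u v : V}
    (hA : IsPathList G A) (hB : IsPathList G B) (hd : A.Disjoint B) (hu : A.head? = some u)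
    (hv : B.head? = some v) (hlen : p + 1 ≤ A.length + B.length)
    (hne : (nbrIdx G A v).Nonempty) :
    #(nbrIdx G A u) + #(nbrIdx G A v) + B.length ≤ p := by
  have h := card_add_card_add_gap_le (s := A.length) (g := A.length + B.length - p)
    (U := nbrIdx G A u) (W := nbrIdx G A v) (filter_subset _ _) (filter_subset _ _) ?_ hne
    (by omega) ?_
  · omega
  · intro h
    obtain ⟨z, hz, huz⟩ := mem_nbrIdx.1 h
    rw [List.head?_eq_getElem?, hz] at hu
    simp only [Option.some.injEq] at hu
    exact G.irrefl (hu ▸ huz)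
  · intro k hk k' hkk' hk'
    have := crossing_length_le hp hA hB hd hu hv hk hkk' hk'
    omega

/-- Connectedness supplies a path between `A` and `B` with interior off both. Each path is rotated
to end where this link attaches while keeping at least one more vertex than the degree of its first
vertex, and the three pieces are glued. -/
lemma length_add_one_le_of_noncrossing (hG : G.Connected) {p : ℕ} (hp : ¬ HasPath G (p + 1))
    {A B : List V} {u v : V} (hA : IsPathList G A) (hB : IsPathList G B) (hd : A.Disjoint B)
    (hu : A.head? = some u) (hv : B.head? = some v) :
    degIn G A.toFinset u + degIn G B.toFinset v + 2 ≤ p := by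
  have huA : u ∈ A := List.mem_of_head? hu
  have hvB : v ∈ B := List.mem_of_head? hv
  obtain ⟨a, ha, b, hb, R, hR, hRd⟩ := exists_link hG (X := {x | x ∈ A}) (Y := {x | x ∈ B})
    ⟨u, huA⟩ ⟨v, hvB⟩ (Set.disjoint_left.2 fun x hx hx' => hd hx hx')
  obtain ⟨A', hA', hAA', hlA, hcA⟩ := exists_rotation hA hu ha
  obtain ⟨B', hB', hBB', hlB, hcB⟩ := exists_rotation hB hv hb
  have hB'r : ∃ T, B'.reverse = b :: T := by
    rw [← List.head?_eq_some_iff, List.head?_reverse, hlB]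
  obtain ⟨T, hT⟩ := hB'r
  have hTB : ∀ x ∈ b :: T, x ∈ B := fun x hx => hBB' (by rwa [← hT, List.mem_reverse] at hx)
  have hpT : IsPathList G (b :: T) := hT ▸ hB'.reverse
  have hR' := hR.1
  have h1 : IsPathList G (R ++ (b :: T)) := by
    refine ⟨List.isChain_split.2 ⟨?_, hpT.1⟩, List.nodup_append'.2 ⟨?_, hpT.2, ?_⟩⟩
    · exact (List.isChain_cons.1 hR.1).2
    · exact (List.nodup_append'.1 (List.nodup_cons.1 hR.2).2).1
    · exact fun x hx hx' => (hRd x hx).2 (hTB x hx')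
  have h2 : IsPathList G (A' ++ (R ++ (b :: T))) := by
    refine hA'.append h1 ?_ ?_
    · intro x hx hx'
      rcases List.mem_append.1 hx' with h | h
      · exact (hRd x h).1 (hAA' hx)
      · exact hd (hAA' hx) (hTB x h)
    · intro x hx y hy
      rw [hlA, Option.mem_some_iff] at hx
      subst hx
      refine (List.isChain_cons.1 hR.1).1 y ?_
      rw [List.head?_append] at hy ⊢
      simpa using hy
  have := not_hasPath_length hp h2
  rw [← hT] at this
  simp only [List.length_append, List.length_reverse] at this
  omega

/-- Pósa's lemma for two disjoint paths starting at `u` and at `v`. -/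
lemma degIn_add_degIn_lt (hG : G.Connected) {p : ℕ} (hp : ¬ HasPath G (p + 1))
    {A B : List V} {u v : V} (hA : IsPathList G A) (hB : IsPathList G B) (hd : A.Disjoint B)
    (hu : A.head? = some u) (hv : B.head? = some v) (hlen : p + 1 ≤ A.length + B.length) :
    degIn G (A.toFinset ∪ B.toFinset) u + degIn G (A.toFinset ∪ B.toFinset) v + 1 ≤ p := by
  have hdf : Disjoint A.toFinset B.toFinset := by
    rw [disjoint_left]
    exact fun x hx hx' => hd (List.mem_toFinset.1 hx) (List.mem_toFinset.1 hx')
  have huA : u ∈ A := List.mem_of_head? hu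
  have hvB : v ∈ B := List.mem_of_head? hv
  have hlA : degIn G A.toFinset u < A.length := by
    rw [← List.toFinset_card_of_nodup hA.2]
    exact degIn_lt_card (List.mem_toFinset.2 huA)
  have hlB : degIn G B.toFinset v < B.length := by
    rw [← List.toFinset_card_of_nodup hB.2]
    exact degIn_lt_card (List.mem_toFinset.2 hvB)
  rw [degIn_union hdf, degIn_union hdf]
  have hAB := card_nbrIdx_add_le hp hA hB hd hu hv hlen
  have hBA := card_nbrIdx_add_le hp hB hA hd.symm hv hu (by omega)
  rw [card_nbrIdx hA.2, card_nbrIdx hA.2] at hAB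
  rw [card_nbrIdx hB.2, card_nbrIdx hB.2] at hBA
  have hne1 : ¬ (nbrIdx G A v).Nonempty → degIn G A.toFinset v = 0 := fun h => by
    rw [← card_nbrIdx hA.2, card_eq_zero, ← not_nonempty_iff_eq_empty]
    exact h
  have hne2 : ¬ (nbrIdx G B u).Nonempty → degIn G B.toFinset u = 0 := fun h => by
    rw [← card_nbrIdx hB.2, card_eq_zero, ← not_nonempty_iff_eq_empty]
    exact h
  -- A neighbour of `v` on `A` gives `deg_A u + deg_A v + |B| ≤ p`, and symmetrically for `u` and
  -- `B`. Two such inequalities are added, using `|A| + |B| ≥ p + 1`; a single one is completed by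
  -- `deg_B v < |B|` or `deg_A u < |A|`. Only the case without either uses connectedness.
  by_cases h1 : (nbrIdx G A v).Nonempty <;> by_cases h2 : (nbrIdx G B u).Nonempty
  · have := hAB h1
    have := hBA h2
    omega
  · have := hAB h1
    have := hne2 h2
    omega
  · have := hBA h2
    have := hne1 h1
    omega
  · have := hne1 h1
    have := hne2 h2
    have := length_add_one_le_of_noncrossing hG hp hA hB hd hu hv
    omega

/-- A path visits no vertex twice, so it uses the added edge at most once. -/
lemma chain_or_split_of_sup_edge {u v : V} {L : List V}
    (hL : L.IsChain (G ⊔ SimpleGraph.edge u v).Adj) (hn : L.Nodup) :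
    L.IsChain G.Adj ∨ ∃ M N a b, L = M ++ a :: b :: N ∧ (M ++ [a]).IsChain G.Adj ∧
      (b :: N).IsChain G.Adj ∧ (a = u ∧ b = v ∨ a = v ∧ b = u) := by
  induction L with
  | nil => simp
  | cons x L ih =>
    rw [List.isChain_cons] at hL
    rw [List.nodup_cons] at hn
    rcases ih hL.2 hn.2 with h | ⟨M, N, a, b, rfl, hM, hN, hab⟩
    · cases L with
      | nil => simp
      | cons y L =>
        have hxy := hL.1 y (by simp)
        rw [SimpleGraph.sup_adj, SimpleGraph.edge_adj] at hxy
        rcases hxy with hxy | hxy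
        · left
          exact List.isChain_cons_cons.2 ⟨hxy, h⟩
        · right
          exact ⟨[], L, x, y, rfl, by simp, h, hxy.1⟩
    · right
      refine ⟨x :: M, N, a, b, rfl, ?_, hN, hab⟩
      rw [List.cons_append, List.isChain_cons]
      refine ⟨fun y hy => ?_, hM⟩
      have hxy := hL.1 y (by
        rw [List.head?_append] at hy ⊢
        simpa using hy)
      rw [SimpleGraph.sup_adj, SimpleGraph.edge_adj] at hxy
      rcases hxy with hxy | hxy
      · exact hxy
      · simp only [List.mem_append, List.mem_cons, not_or] at hn
        exfalso
        have hxa := hn.1.2.1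
        have hxb := hn.1.2.2.1
        rcases hab with ⟨rfl, rfl⟩ | ⟨rfl, rfl⟩ <;> rcases hxy.1 with h | h <;>
          simp_all

/-- If `G` is edge-maximal without a path on `p + 1` vertices, non-adjacent vertices `u` and `v`
are the first vertices of two disjoint paths with at least `p + 1` vertices in total. -/
lemma exists_two_paths {p : ℕ} (hG : Maximal (fun G : SimpleGraph V => ¬ HasPath G (p + 1)) G)
    {u v : V} (huv : u ≠ v) (hadj : ¬ G.Adj u v) : ∃ A B, IsPathList G A ∧ IsPathList G B ∧
      A.Disjoint B ∧ A.head? = some u ∧ B.head? = some v ∧ p + 1 ≤ A.length + B.length := by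
  have hlt := SimpleGraph.lt_sup_edge (G := G) u v huv hadj
  have hpath : HasPath (G ⊔ SimpleGraph.edge u v) (p + 1) := by
    by_contra h
    exact hlt.not_ge (hG.2 h hlt.le)
  obtain ⟨L, hL, hl⟩ := hpath
  rcases chain_or_split_of_sup_edge hL.1 hL.2 with h | ⟨M, N, a, b, rfl, hM, hN, hab⟩
  · exact absurd ⟨L, ⟨h, hL.2⟩, hl⟩ hG.1
  · have hn : (M ++ [a] ++ (b :: N)).Nodup := by simpa using hL.2
    rw [List.nodup_append'] at hn
    have hA : IsPathList G (M ++ [a]).reverse := IsPathList.reverse ⟨hM, hn.1⟩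
    have hB : IsPathList G (b :: N) := ⟨hN, hn.2.1⟩
    have hd : (M ++ [a]).reverse.Disjoint (b :: N) :=
      fun x hx hx' => hn.2.2 (List.mem_reverse.1 hx) hx'
    have hlen : p + 1 ≤ (M ++ [a]).reverse.length + (b :: N).length := by
      simp only [List.length_append, List.length_cons, List.length_reverse,
        List.length_nil] at hl ⊢
      omega
    rcases hab with ⟨rfl, rfl⟩ | ⟨rfl, rfl⟩
    · exact ⟨_, _, hA, hB, hd, by simp, by simp, hlen⟩
    · exact ⟨_, _, hB, hA, hd.symm, by simp, by simp, by omega⟩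

lemma exists_adj_notMem_of_degIn_lt {U s : Finset V} {u : V} (h : degIn G s u < degIn G U u) :
    ∃ w ∈ U, G.Adj u w ∧ w ∉ s := by
  by_contra hcon
  push Not at hcon
  refine absurd h (not_lt.2 (card_le_card fun w hw => ?_))
  simp only [mem_filter] at hw ⊢
  exact ⟨hcon w hw.1 hw.2, hw.2⟩

/-- Kopylov's argument: in an edge-maximal graph without a path on `p + 1` vertices, vertices of
two sets of large inner minimum degree are adjacent. -/
lemma adj_of_le_degIn [Fintype V] (hconn : G.Connected) {p a b : ℕ}
    (hG : Maximal (fun G : SimpleGraph V => ¬ HasPath G (p + 1)) G) {U W : Finset V}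
    (hU : ∀ u ∈ U, a ≤ degIn G U u) (hW : ∀ v ∈ W, b ≤ degIn G W v) (hab : p ≤ a + b)
    {u v : V} (hu : u ∈ U) (hv : v ∈ W) (huv : u ≠ v) : G.Adj u v := by
  by_contra hadj
  -- The total length of the two paths can be made arbitrarily large. By Pósa's lemma and `p ≤ a +
  -- b`, one of the two ends has a neighbour in its own set off both paths, and this neighbour
  -- becomes the new end.
  have key : ∀ m, p + 1 ≤ m → ∃ u ∈ U, ∃ v ∈ W, u ≠ v ∧ ¬ G.Adj u v ∧ ∃ A B, IsPathList G A ∧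
      IsPathList G B ∧ A.Disjoint B ∧ A.head? = some u ∧ B.head? = some v ∧
      m ≤ A.length + B.length := by
    intro m hm
    induction m, hm using Nat.le_induction with
    | base => exact ⟨u, hu, v, hv, huv, hadj, exists_two_paths hG huv hadj⟩
    | succ m hm ih =>
      obtain ⟨u, hu, v, hv, huv, hadj, A, B, hA, hB, hd, hAu, hBv, hl⟩ := ih
      have hposa := degIn_add_degIn_lt hconn hG.1 hA hB hd hAu hBv (hm.trans hl)
      have huA : u ∈ A := List.mem_of_head? hAu
      have hvB : v ∈ B := List.mem_of_head? hBv
      have hU' := hU u hu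
      have hW' := hW v hv
      -- A common neighbour off both paths would splice them into a path on more than `p` vertices.
      -- Hence the new end is again nonadjacent to the opposite end.
      have no_common : ∀ w, w ∉ A.toFinset ∪ B.toFinset → G.Adj u w → ¬ G.Adj v w := by
        intro w hw huw hvw
        simp only [mem_union, List.mem_toFinset, not_or] at hw
        have h1 : IsPathList G (w :: B) := hB.cons hw.2 fun y hy => by
          rw [hBv, Option.mem_some_iff] at hy
          exact hy ▸ hvw.symm
        have h2 : IsPathList G (A.reverse ++ w :: B) := by
          refine hA.reverse.append h1 ?_ ?_
          · intro x hx hx'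
            rw [List.mem_reverse] at hx
            rcases List.mem_cons.1 hx' with rfl | h
            · exact hw.1 hx
            · exact hd hx h
          · intro x hx y hy
            simp only [List.getLast?_reverse, hAu, List.head?_cons, Option.mem_some_iff] at hx hy
            exact hx ▸ hy ▸ huw
        have := not_hasPath_length hG.1 h2
        simp only [List.length_append, List.length_reverse, List.length_cons] at this
        omega
      rcases lt_or_ge (degIn G (A.toFinset ∪ B.toFinset) u) (degIn G U u) with h | h
      · obtain ⟨w, hwU, huw, hw⟩ := exists_adj_notMem_of_degIn_lt h
        have hvw := no_common w hw huw
        simp only [mem_union, List.mem_toFinset, not_or] at hw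
        refine ⟨w, hwU, v, hv, fun h => hw.2 (h ▸ hvB), fun h => hvw h.symm, w :: A, B, ?_, hB,
          ?_, rfl, hBv, by simp only [List.length_cons]; omega⟩
        · refine hA.cons hw.1 fun y hy => ?_
          rw [hAu, Option.mem_some_iff] at hy
          exact hy ▸ huw.symm
        · rw [List.disjoint_cons_left]
          exact ⟨hw.2, hd⟩
      · obtain ⟨w, hwW, hvw, hw⟩ :=
          exists_adj_notMem_of_degIn_lt (G := G) (U := W) (s := A.toFinset ∪ B.toFinset)
            (u := v) (by omega)
        have huw : ¬ G.Adj u w := fun h => no_common w hw h hvw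
        simp only [mem_union, List.mem_toFinset, not_or] at hw
        refine ⟨u, hu, w, hwW, fun h => hw.1 (h ▸ huA), huw, A, w :: B, hA, ?_,
          ?_, hAu, rfl, by simp only [List.length_cons]; omega⟩
        · refine hB.cons hw.2 fun y hy => ?_
          rw [hBv, Option.mem_some_iff] at hy
          exact hy ▸ hvw.symm
        · rw [List.disjoint_cons_right]
          exact ⟨hw.1, hd⟩
  -- Two disjoint paths cannot have more vertices in total than the graph.
  obtain ⟨u, -, v, -, -, -, A, B, hA, hB, hd, -, -, hl⟩ :=
    key (p + 1 + Fintype.card V) (by omega)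
  have := (List.nodup_append'.2 ⟨hA.2, hB.2, hd⟩).length_le_card
  rw [List.length_append] at this
  omega

lemma isPathList_toList_of_clique {s : Finset V} (hs : ∀ x ∈ s, ∀ y ∈ s, x ≠ y → G.Adj x y) :
    IsPathList G s.toList := by
  refine ⟨List.Pairwise.isChain ?_, s.nodup_toList⟩
  refine (s.nodup_toList.pairwise_of_forall_ne (r := G.Adj) fun x hx y hy hxy => ?_)
  exact hs x (mem_toList.1 hx) y (mem_toList.1 hy) hxy

end Posa


/-! ### Cores and Kopylov's theorem. -/

section Kopylov

variable {V : Type*} [Fintype V] {G : SimpleGraph V}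

/-- The largest set of vertices inducing a subgraph of minimum degree greater than `t`. -/
noncomputable def core (G : SimpleGraph V) (t : ℕ) : Finset V :=
  {v | ∃ T : Finset V, v ∈ T ∧ ∀ x ∈ T, t + 1 ≤ degIn G T x}

lemma subset_core {t : ℕ} {T : Finset V} (h : ∀ x ∈ T, t + 1 ≤ degIn G T x) : T ⊆ core G t :=
  fun x hx => by
    simp only [core, mem_filter, mem_univ, true_and]
    exact ⟨T, hx, h⟩

lemma le_degIn_core {t : ℕ} {x : V} (hx : x ∈ core G t) : t + 1 ≤ degIn G (core G t) x := by
  simp only [core, mem_filter, mem_univ, true_and] at hx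
  obtain ⟨T, hxT, hT⟩ := hx
  exact (hT x hxT).trans (degIn_mono (subset_core hT) x)

/-- If every vertex of `T` outside the core had more than `t` neighbours in `T`, then `T` together
with the core would have inner minimum degree above `t`, so `T` would lie in the core. -/
lemma degenOver_core (t : ℕ) : DegenOver G t (core G t) := by
  intro T hT
  by_contra hcon
  push Not at hcon
  refine hT (subset_union_left.trans (subset_core (T := T ∪ core G t) fun x hx => ?_))
  by_cases hxc : x ∈ core G t
  · exact (le_degIn_core hxc).trans (degIn_mono subset_union_right x)
  · exact (hcon x ((mem_union.1 hx).resolve_right hxc) hxc).trans_le (degIn_mono subset_union_left x)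

lemma exists_adj_of_connected (hG : G.Connected) {s : Finset V} (hs : s.Nonempty)
    (hs' : s ≠ univ) : ∃ x ∈ s, ∃ y ∉ s, G.Adj x y := by
  obtain ⟨x, hx⟩ := hs
  obtain ⟨y, hy⟩ : ∃ y, y ∉ s := by
    by_contra h
    push Not at h
    exact hs' (eq_univ_of_forall h)
  obtain ⟨w⟩ := hG x y
  obtain ⟨d, -, hd, hd'⟩ := w.exists_boundary_dart (s : Set V) hx hy
  exact ⟨d.fst, hd, d.snd, hd', d.adj⟩

/-- **Kopylov's theorem** on connected graphs without a path on `p + 1` vertices, in its structural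
form. -/
theorem exists_degenOver (hconn : G.Connected) {p : ℕ} (hp3 : 3 ≤ p) (hp : ¬ HasPath G (p + 1))
    (hcard : p + 1 ≤ Fintype.card V) :
    ∃ t Q, 1 ≤ t ∧ 2 * t + 1 ≤ p ∧ #Q + t ≤ p ∧ DegenOver G t Q := by
  obtain ⟨G', hGG', hmax⟩ :=
    Finite.exists_le_maximal (p := fun G : SimpleGraph V => ¬ HasPath G (p + 1)) hp
  suffices h : ∃ t Q, 1 ≤ t ∧ 2 * t + 1 ≤ p ∧ #Q + t ≤ p ∧ DegenOver G' t Q by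
    obtain ⟨t, Q, h1, h2, h3, h4⟩ := h
    exact ⟨t, Q, h1, h2, h3, h4.anti_graph hGG'⟩
  have hconn' : G'.Connected := hconn.mono hGG'
  by_contra hcon
  push Not at hcon
  have hbig : ∀ t, 1 ≤ t → 2 * t + 1 ≤ p → p < #(core G' t) + t := fun t h1 h2 => by
    by_contra h
    exact hcon t (core G' t) h1 h2 (by omega) (degenOver_core t)
  set d := (p - 1) / 2
  set Q := core G' d with hQ
  have hQc := hbig d (by omega) (by omega)
  rw [← hQ] at hQc
  have hclique : ∀ x ∈ Q, ∀ y ∈ Q, x ≠ y → G'.Adj x y := fun x hx y hy hxy =>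
    adj_of_le_degIn hconn' hmax (a := d + 1) (b := d + 1) (fun u hu => le_degIn_core hu)
      (fun u hu => le_degIn_core hu) (by omega) hx hy hxy
  have hQp : #Q ≤ p := by
    have := not_hasPath_length hmax.1 (isPathList_toList_of_clique hclique)
    rwa [length_toList] at this
  -- A clique on `p` vertices and an edge leaving it, which connectedness provides, form a path on
  -- `p + 1` vertices.
  have hQp' : #Q ≠ p := by
    intro h
    obtain ⟨x, hx, y, hy, hxy⟩ := exists_adj_of_connected hconn' (s := Q)
      (card_pos.1 (by omega)) (fun h' => by rw [h', card_univ] at h; omega)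
    have h1 : IsPathList G' (Q.erase x).toList := isPathList_toList_of_clique
      fun a ha b hb hab => hclique a (mem_of_mem_erase ha) b (mem_of_mem_erase hb) hab
    have h2 : IsPathList G' (x :: (Q.erase x).toList) := h1.cons (by simp) fun z hz => by
      have := mem_toList.1 (List.mem_of_head? hz)
      exact hclique x hx z (mem_of_mem_erase this) (ne_of_mem_erase this).symm
    have h3 : IsPathList G' (y :: x :: (Q.erase x).toList) := h2.cons
      (by
        simp only [List.mem_cons, mem_toList, mem_erase, not_or, not_and]
        exact ⟨fun h => hy (h ▸ hx), fun _ => hy⟩)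
      fun z hz => by
        simp only [List.head?_cons, Option.mem_some_iff] at hz
        exact hz ▸ hxy.symm
    have := not_hasPath_length hmax.1 h3
    simp only [List.length_cons, length_toList, card_erase_of_mem hx] at this
    omega
  -- The value `t = p - #Q` is admissible because `p - #Q < d`, and its core has more than `#Q`
  -- vertices. A vertex of it outside `Q` turns out to be adjacent to all of `Q`, hence belongs to
  -- the core `Q` after all.
  have hlarge := hbig (p - #Q) (by omega) (by omega)
  obtain ⟨v, hv, hvQ⟩ : ∃ v ∈ core G' (p - #Q), v ∉ Q := by
    by_contra h
    push Not at h
    have := card_le_card (show core G' (p - #Q) ⊆ Q from h)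
    omega
  have hdeg : ∀ u ∈ Q, #Q - 1 ≤ degIn G' Q u := fun u hu => by
    rw [← card_erase_of_mem hu]
    refine card_le_card fun y hy => ?_
    simp only [mem_filter]
    exact ⟨mem_of_mem_erase hy, hclique u hu y (mem_of_mem_erase hy) (ne_of_mem_erase hy).symm⟩
  have hall : ∀ u ∈ Q, G'.Adj u v := fun u hu =>
    adj_of_le_degIn hconn' hmax (a := #Q - 1) (b := p - #Q + 1) hdeg
      (fun w hw => le_degIn_core hw) (by omega) hu hv (fun h => hvQ (h ▸ hu))
  have hsub : insert v Q ⊆ core G' d := subset_core fun x hx => by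
    rcases mem_insert.1 hx with rfl | hx
    · rw [degIn_insert_self]
      have : #Q ≤ degIn G' Q x := card_le_card fun u hu => mem_filter.2 ⟨hu, (hall u hu).symm⟩
      omega
    · exact (le_degIn_core hx).trans (degIn_mono (subset_insert _ _) x)
  exact hvQ (hsub (mem_insert_self _ _))

end Kopylov


/-! ### The equality case on `2l + 3` vertices. -/

section Structure

variable {V : Type*} {G : SimpleGraph V}

/-- `G[s]` is the join of the clique on `A` with the disjoint union of the edge `xy` and an
independent set. -/
structure IsJoinEdge (G : SimpleGraph V) (s A : Finset V) (x y : V) : Prop where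
  subset : A ⊆ s
  left_mem : x ∈ s
  right_mem : y ∈ s
  left_notMem : x ∉ A
  right_notMem : y ∉ A
  ne : x ≠ y
  adj_iff : ∀ a ∈ s, ∀ b ∈ s,
    G.Adj a b ↔ a ≠ b ∧ (a ∈ A ∨ b ∈ A ∨ (a = x ∧ b = y) ∨ (a = y ∧ b = x))

lemma degIn_map {W : Type*} {G' : SimpleGraph W} (f : G ↪g G') (s : Finset V) (v : V) :
    degIn G' (s.map f.toEmbedding) (f v) = degIn G s v := by
  unfold degIn
  rw [filter_map, card_map]
  congr 1
  ext y
  simp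

lemma map_induce_univ (s : Finset V) :
    (univ : Finset (s : Set V)).map (SimpleGraph.Embedding.induce (G := G) (s : Set V)).toEmbedding
      = s := by
  ext x
  simp [SimpleGraph.Embedding.induce]

lemma degIn_induce (s : Finset V) (v : (s : Set V)) :
    degIn (G.induce (s : Set V)) univ v = degIn G s v := by
  rw [← degIn_map (SimpleGraph.Embedding.induce (s : Set V)), map_induce_univ]
  rfl

lemma clique_of_le_pairs {s : Finset V} (h : #s * (#s - 1) ≤ pairs G s) :
    ∀ x ∈ s, ∀ y ∈ s, x ≠ y → G.Adj x y := by
  intro x hx y hy hxy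
  by_contra hadj
  have h1 : degIn G s x + #{x, y} ≤ #s := degIn_add_card_le (by
    intro z hz
    rcases mem_insert.1 hz with rfl | hz
    · exact hx
    · rwa [mem_singleton.1 hz]) (by
    intro z hz
    rcases mem_insert.1 hz with rfl | hz
    · exact G.irrefl
    · rwa [mem_singleton.1 hz])
  rw [card_pair hxy] at h1
  have h2 : pairs G s < ∑ _x ∈ s, (#s - 1) := sum_lt_sum (fun v hv => by
    have := degIn_lt_card (G := G) hv
    omega) ⟨x, hx, by omega⟩
  simp only [sum_const, smul_eq_mul] at h2
  omega

/-- The list alternates `i, a, i, a, …`. It starts in `Is` and ends in `As`, so it can be continued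
at its last vertex to anything joined to `As`. -/
lemma exists_zigzag {As Is : List V} (hA : As.Nodup) (hI : Is.Nodup) (hd : As.Disjoint Is)
    (hl : As.length = Is.length) (hadj : ∀ a ∈ As, ∀ i ∈ Is, G.Adj a i) :
    ∃ Z, IsPathList G Z ∧ (∀ z ∈ Z, z ∈ As ∨ z ∈ Is) ∧ Z.length = 2 * As.length ∧
      Z.head? = Is.head? ∧ ∀ z ∈ Z.getLast?, z ∈ As := by
  induction As generalizing Is with
  | nil =>
    cases Is with
    | nil => exact ⟨[], ⟨by simp, by simp⟩, by simp, by simp, by simp, by simp⟩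
    | cons => simp at hl
  | cons a As ih =>
    cases Is with
    | nil => simp at hl
    | cons i Is =>
      rw [List.nodup_cons] at hA hI
      simp only [List.disjoint_cons_left, List.disjoint_cons_right, List.mem_cons, not_or] at hd
      simp only [List.length_cons, Nat.add_right_cancel_iff] at hl
      obtain ⟨Z, hZ, hZm, hZl, hZh, hZt⟩ := ih hA.2 hI.2 hd.2.2 hl
        fun b hb j hj => hadj b (by simp [hb]) j (by simp [hj])
      have h1 : IsPathList G (a :: Z) := hZ.cons
        (fun h => by rcases hZm a h with h | h <;> tauto)
        fun y hy => hadj a (by simp) y (by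
          rw [hZh] at hy
          exact List.mem_cons_of_mem _ (List.mem_of_head? hy))
      have h2 : IsPathList G (i :: a :: Z) := h1.cons
        (fun h => by
          rcases List.mem_cons.1 h with h | h
          · exact hd.1.1 h
          · rcases hZm i h with h | h <;> tauto)
        fun y hy => by
          simp only [List.head?_cons, Option.mem_some_iff] at hy
          exact hy ▸ (hadj a (by simp) i (by simp)).symm
      refine ⟨_, h2, ?_, by simp only [List.length_cons, hZl]; ring, by simp, ?_⟩
      · intro z hz
        simp only [List.mem_cons] at hz ⊢
        rcases hz with rfl | rfl | hz
        · simp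
        · simp
        · rcases hZm z hz with h | h <;> simp [h]
      · intro z hz
        rw [List.getLast?_cons_cons] at hz
        cases Z with
        | nil =>
          simp only [List.getLast?_singleton, Option.mem_some_iff] at hz
          simp [hz]
        | cons w Z =>
          rw [List.getLast?_cons_cons] at hz
          exact List.mem_cons_of_mem _ (hZt z hz)

/-- The component of the clique has at least `l + 2` vertices. A vertex outside it has `l`
neighbours outside, so the complement has at least `l + 1`. The sizes are then forced, and two
cliques of these sizes have too few edges. -/
lemma connected_of_pairs [Fintype V] {l : ℕ} (hl : 1 ≤ l) (hV : Fintype.card V = 2 * l + 3)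
    (hdeg : ∀ v, l ≤ degIn G univ v) {K : Finset V} (hK : #K = l + 2)
    (hcl : ∀ x ∈ K, ∀ y ∈ K, x ≠ y → G.Adj x y)
    (hpairs : (l + 2) * (l + 1) + 2 * l * (l + 1) ≤ pairs G univ) : G.Connected := by
  obtain ⟨x₀, hx₀⟩ : K.Nonempty := card_pos.1 (by omega)
  rw [SimpleGraph.connected_iff_exists_forall_reachable]
  refine ⟨x₀, ?_⟩
  by_contra hcon
  push Not at hcon
  obtain ⟨v, hv⟩ := hcon
  set C : Finset V := {y | G.Reachable x₀ y} with hC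
  have hmem : ∀ y, y ∈ C ↔ G.Reachable x₀ y := fun y => by simp [hC]
  have hKC : K ⊆ C := fun y hy => by
    rw [hmem]
    by_cases h : x₀ = y
    · exact h ▸ SimpleGraph.Reachable.rfl
    · exact (hcl x₀ hx₀ y hy h).reachable
  have hno : ∀ x ∈ C, ∀ y ∈ Cᶜ, ¬ G.Adj x y := fun x hx y hy hxy => by
    rw [mem_compl, hmem] at hy
    exact hy (((hmem x).1 hx).trans hxy.reachable)
  have hvC : v ∈ Cᶜ := by rwa [mem_compl, hmem]
  have h1 : degIn G Cᶜ v < #Cᶜ := degIn_lt_card hvC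
  have h2 : degIn G univ v = degIn G C v + degIn G Cᶜ v := by
    rw [← degIn_union disjoint_compl_right, union_compl]
  have h3 : degIn G C v = 0 := by
    rw [degIn, card_eq_zero, filter_eq_empty_iff]
    exact fun x hx hvx => hno x hx v hvC hvx.symm
  have h4 := card_le_card hKC
  have h5 := card_add_card_compl C
  have h6 := hdeg v
  have h7 : pairs G univ = pairs G C + pairs G Cᶜ := by
    rw [← pairs_union_of_forall_not_adj disjoint_compl_right hno, union_compl]
  have h8 := pairs_le_clique (G := G) C
  have h9 := pairs_le_clique (G := G) Cᶜ
  rw [show #C = l + 2 by omega] at h8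
  rw [show #Cᶜ = l + 1 by omega] at h9
  simp only [Nat.add_sub_cancel, show l + 2 - 1 = l + 1 by omega] at h8 h9
  nlinarith

/-- The case of `2l + 3` vertices: a non-traceable graph with many edges containing a clique on
`l + 2` vertices. -/
lemma exists_isJoinEdge_of_card_eq [Fintype V] {l : ℕ} (hl : 1 ≤ l)
    (hV : Fintype.card V = 2 * l + 3) (hp : ¬ HasPath G (2 * l + 3))
    (hdeg : ∀ v, l ≤ degIn G univ v) {K : Finset V} (hK : #K = l + 2)
    (hcl : ∀ x ∈ K, ∀ y ∈ K, x ≠ y → G.Adj x y)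
    (hpairs : (l + 2) * (l + 1) + 2 * l * (l + 1) ≤ pairs G univ) :
    ∃ A x y, #A = l ∧ IsJoinEdge G univ A x y := by
  have hconn := connected_of_pairs hl hV hdeg hK hcl hpairs
  obtain ⟨G', hGG', hmax⟩ :=
    Finite.exists_le_maximal (p := fun G : SimpleGraph V => ¬ HasPath G (2 * l + 2 + 1)) hp
  have hconn' := hconn.mono hGG'
  have hdeg' : ∀ v, l ≤ degIn G' univ v := fun v =>
    (hdeg v).trans (degIn_mono_graph hGG' univ v)
  -- Here `p + 1` is the number of vertices, so the two paths starting at nonadjacent `u` and `v`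
  -- cover the whole graph and Pósa's lemma bounds the full degrees.
  have hclos : ∀ u v, u ≠ v → ¬ G'.Adj u v →
      degIn G' univ u + degIn G' univ v + 1 ≤ 2 * l + 2 := by
    intro u v huv hadj
    obtain ⟨A, B, hA, hB, hd, hAu, hBv, hlen⟩ := exists_two_paths hmax huv hadj
    have h := degIn_add_degIn_lt hconn' hmax.1 hA hB hd hAu hBv hlen
    have huniv : A.toFinset ∪ B.toFinset = univ := by
      rw [← List.toFinset_append]
      apply eq_univ_of_card
      have hn := List.nodup_append'.2 ⟨hA.2, hB.2, hd⟩
      have := hn.length_le_card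
      rw [List.toFinset_card_of_nodup hn, List.length_append] at *
      omega
    rwa [huniv] at h
  have hcl' : ∀ x ∈ K, ∀ y ∈ K, x ≠ y → G'.Adj x y := fun x hx y hy h => hGG' (hcl x hx y hy h)
  have hKdeg : ∀ x ∈ K, degIn G' K x = l + 1 := fun x hx => by
    have h1 := degIn_lt_card (G := G') hx
    have h2 : #(K.erase x) ≤ degIn G' K x := card_le_card fun y hy => mem_filter.2
      ⟨mem_of_mem_erase hy, hcl' x hx y (mem_of_mem_erase hy) (ne_of_mem_erase hy).symm⟩
    rw [card_erase_of_mem hx] at h2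
    omega
  -- The remaining argument determines `G'`. A vertex outside `K` of degree above `l` would make the
  -- vertices of degree at least `l + 1` a clique on at least `l + 3` vertices, against the degree
  -- condition `hclos` for one of them and a nonadjacent vertex of degree `l`. A vertex of `K` with
  -- an outside neighbour has degree at least `l + 2`, so it is adjacent to everything outside.
  -- Counting edges yields exactly `l` such vertices.
  have hsplit : ∀ x, degIn G' univ x = degIn G' K x + degIn G' Kᶜ x := fun x => by
    rw [← degIn_union disjoint_compl_right, union_compl]
  have hout : ∀ v ∉ K, degIn G' univ v = l := by
    intro v hv
    by_contra hne
    have hv1 : l + 1 ≤ degIn G' univ v := by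
      have := hdeg' v
      omega
    set H : Finset V := {x | l + 1 ≤ degIn G' univ x} with hH
    have hmem : ∀ x, x ∈ H ↔ l + 1 ≤ degIn G' univ x := fun x => by simp [hH]
    have hHcl : ∀ x ∈ H, ∀ y ∈ H, x ≠ y → G'.Adj x y := by
      intro x hx y hy hxy
      by_contra h
      have := hclos x y hxy h
      rw [hmem] at hx hy
      omega
    have hsub : insert v K ⊆ H := by
      intro x hx
      rw [hmem]
      rcases mem_insert.1 hx with rfl | hx
      · exact hv1
      · rw [hsplit, hKdeg x hx]
        omega
    have hHc := card_le_card hsub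
    rw [card_insert_of_notMem hv] at hHc
    obtain ⟨z, hz⟩ : ∃ z, z ∉ H := by
      by_contra h
      push Not at h
      have h1 := not_hasPath_length hmax.1 (isPathList_toList_of_clique hHcl)
      rw [length_toList, eq_univ_of_forall h, card_univ] at h1
      omega
    have hzl : degIn G' univ z = l := by
      have := hdeg' z
      rw [hmem] at hz
      omega
    obtain ⟨u, hu, huz⟩ : ∃ u ∈ H, ¬ G'.Adj u z := by
      by_contra h
      push Not at h
      have : #H ≤ degIn G' univ z :=
        card_le_card fun u hu => mem_filter.2 ⟨mem_univ _, (h u hu).symm⟩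
      omega
    have h1 := hclos u z (fun h => hz (h ▸ hu)) huz
    have h2 : #(H.erase u) ≤ degIn G' univ u := card_le_card fun y hy => mem_filter.2
      ⟨mem_univ _, hHcl u hu y (mem_of_mem_erase hy) (ne_of_mem_erase hy).symm⟩
    rw [card_erase_of_mem hu] at h2
    omega
  have hKc : #Kᶜ = l + 1 := by
    have := card_add_card_compl K
    omega
  set A : Finset V := {u ∈ K | ∃ w ∉ K, G'.Adj u w} with hA
  have hAall : ∀ u ∈ A, ∀ v ∉ K, G'.Adj u v := by
    intro u hu v hv
    obtain ⟨huK, w, hw, huw⟩ := mem_filter.1 hu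
    by_contra h
    have h1 := hclos u v (fun h => hv (h ▸ huK)) h
    rw [hsplit, hKdeg u huK, hout v hv] at h1
    have h2 : 0 < degIn G' Kᶜ u := card_pos.2 ⟨w, mem_filter.2 ⟨mem_compl.2 hw, huw⟩⟩
    omega
  have hAnot : ∀ u ∈ K, u ∉ A → ∀ v ∉ K, ¬ G'.Adj u v := fun u hu huA v hv h =>
    huA (mem_filter.2 ⟨hu, v, hv, h⟩)
  have hAK : A ⊆ K := filter_subset _ _
  have hoddK : ∀ v ∉ K, degIn G' K v = #A := by
    intro v hv
    unfold degIn
    congr 1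
    ext u
    simp only [mem_filter]
    constructor
    · rintro ⟨hu, hvu⟩
      by_contra h
      exact hAnot u hu h v hv hvu.symm
    · exact fun hu => ⟨hAK hu, (hAall u hu v hv).symm⟩
  have hsum : pairs G' univ = (l + 2) * (l + 1) + #A * (l + 1) + (l + 1) * l := by
    unfold pairs
    rw [← sum_add_sum_compl K]
    congr 1
    · rw [sum_congr rfl fun x hx => (by rw [hsplit, hKdeg x hx] :
        degIn G' univ x = l + 1 + degIn G' Kᶜ x), sum_add_distrib]
      congr 1
      · simp [hK]
      · rw [← sum_subset hAK fun x hx hxA => by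
          rw [degIn, card_eq_zero, filter_eq_empty_iff]
          exact fun v hv => hAnot x hx hxA v (mem_compl.1 hv)]
        rw [sum_congr rfl fun x hx => (by
          rw [degIn, filter_true_of_mem fun v hv => hAall x hx v (mem_compl.1 hv), hKc] :
          degIn G' Kᶜ x = l + 1)]
        simp
    · rw [sum_congr rfl fun x hx => hout x (mem_compl.1 hx)]
      simp [hKc]
  have hle := hpairs.trans (pairs_mono_graph hGG' univ)
  have hAl : l ≤ #A := by
    by_contra h
    have : #A + 1 ≤ l := by omega
    nlinarith
  obtain ⟨v₀, hv₀⟩ : Kᶜ.Nonempty := card_pos.1 (by omega)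
  have hAl' : #A = l := by
    have h1 := hout v₀ (mem_compl.1 hv₀)
    rw [hsplit, hoddK v₀ (mem_compl.1 hv₀)] at h1
    omega
  have hindep : ∀ v ∉ K, ∀ w ∉ K, ¬ G'.Adj v w := by
    intro v hv w hw hvw
    have h1 := hout v hv
    rw [hsplit, hoddK v hv] at h1
    have h2 : 0 < degIn G' Kᶜ v := card_pos.2 ⟨w, mem_filter.2 ⟨mem_compl.2 hw, hvw⟩⟩
    omega
  -- The count for `G'` equals the lower bound assumed for `G`, so passing to the edge-maximal graph
  -- added nothing.
  have hG : G = G' := pairs_eq_of_le_of_pairs_le hGG' (by rw [hsum, hAl']; nlinarith)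
  subst hG
  obtain ⟨x, y, hxy, hxyA⟩ := card_eq_two.1 (by
    rw [card_sdiff_of_subset hAK]
    omega : #(K \ A) = 2)
  have hx : x ∈ K ∧ x ∉ A := mem_sdiff.1 (by simp [hxyA])
  have hy : y ∈ K ∧ y ∉ A := mem_sdiff.1 (by simp [hxyA])
  have hKA : ∀ z ∈ K, z ∉ A → z = x ∨ z = y := fun z hz hzA => by
    have : z ∈ K \ A := mem_sdiff.2 ⟨hz, hzA⟩
    simpa [hxyA] using this
  refine ⟨A, x, y, hAl', subset_univ _, mem_univ _, mem_univ _, hx.2, hy.2, hxy, ?_⟩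
  intro a _ b _
  constructor
  · intro hab
    refine ⟨hab.ne, ?_⟩
    by_contra h
    push Not at h
    obtain ⟨haA, hbA, h1, h2⟩ := h
    by_cases haK : a ∈ K <;> by_cases hbK : b ∈ K
    · rcases hKA a haK haA with rfl | rfl <;> rcases hKA b hbK hbA with rfl | rfl
      · exact hab.ne rfl
      · exact h1 rfl rfl
      · exact h2 rfl rfl
      · exact hab.ne rfl
    · exact hAnot a haK haA b hbK hab
    · exact hAnot b hbK hbA a haK hab.symm
    · exact hindep a haK b hbK hab
  · rintro ⟨hab, h | h | ⟨rfl, rfl⟩ | ⟨rfl, rfl⟩⟩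
    · by_cases hbK : b ∈ K
      · exact hcl a (hAK h) b hbK hab
      · exact hAall a h b hbK
    · by_cases haK : a ∈ K
      · exact hcl a haK b (hAK h) hab
      · exact (hAall b h a haK).symm
    · exact hcl _ hx.1 _ hy.1 hab
    · exact hcl _ hy.1 _ hx.1 hab

end Structure


/-! ### The equality case in general, by adding vertices back. -/

section Structure

variable {V : Type*} {G : SimpleGraph V}

lemma IsJoinEdge.map {W : Type*} {G' : SimpleGraph W} {s A : Finset V} {x y : V}
    (h : IsJoinEdge G s A x y) (f : G ↪g G') :
    IsJoinEdge G' (s.map f.toEmbedding) (A.map f.toEmbedding) (f x) (f y) where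
  subset := map_subset_map.2 h.subset
  left_mem := mem_map_of_mem _ h.left_mem
  right_mem := mem_map_of_mem _ h.right_mem
  left_notMem := fun hx => h.left_notMem (by simpa using hx)
  right_notMem := fun hy => h.right_notMem (by simpa using hy)
  ne := f.injective.ne h.ne
  adj_iff := by
    intro a ha b hb
    obtain ⟨a, ha', rfl⟩ := mem_map.1 ha
    obtain ⟨b, hb', rfl⟩ := mem_map.1 hb
    have := h.adj_iff a ha' b hb'
    simpa using this

/-- Adding a vertex with `l` neighbours to the extremal structure. -/
lemma IsJoinEdge.insert_vertex {l : ℕ} {s A : Finset V} {x y v : V} (hp : ¬ HasPath G (2 * l + 3))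
    (h : IsJoinEdge G s A x y) (hA : #A = l) (hs : 2 * l + 2 ≤ #s) (hv : v ∉ s)
    (hdeg : l ≤ degIn G s v) (hl : 1 ≤ l) : IsJoinEdge G (insert v s) A x y := by
  set I : Finset V := s \ (A ∪ {x, y}) with hI
  have hAxy : #(A ∪ {x, y}) = l + 2 := by
    rw [card_union_of_disjoint, hA, card_pair h.ne]
    simp [h.left_notMem, h.right_notMem]
  have hAxys : A ∪ {x, y} ⊆ s := union_subset h.subset (by
    intro z hz
    rcases mem_insert.1 hz with rfl | hz
    · exact h.left_mem
    · rw [mem_singleton.1 hz]; exact h.right_mem)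
  have hIc : l ≤ #I := by
    rw [hI, card_sdiff_of_subset hAxys]
    omega
  have hmemI : ∀ z, z ∈ I ↔ z ∈ s ∧ z ∉ A ∧ z ≠ x ∧ z ≠ y := fun z => by
    simp only [hI, mem_sdiff, mem_union, mem_insert, mem_singleton, not_or]
  have hAI : ∀ a ∈ A.toList, ∀ i ∈ s, i ≠ a → G.Adj a i := fun a ha i hi hia => by
    have ha' := mem_toList.1 ha
    exact (h.adj_iff a (h.subset ha') i hi).2 ⟨hia.symm, Or.inl ha'⟩
  have key : ∀ Is : List V, Is.Nodup → Is.length = l → (∀ i ∈ Is, i ∈ I) →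
      ∃ Z, IsPathList G Z ∧ (∀ z ∈ Z, z ∈ A ∨ z ∈ Is) ∧ Z.length = 2 * l ∧
      Z.head? = Is.head? ∧ ∀ z ∈ Z.getLast?, z ∈ A := by
    intro Is hn hlen hIs
    obtain ⟨Z, h1, h2, h3, h4, h5⟩ := exists_zigzag (G := G) (As := A.toList) (Is := Is)
      A.nodup_toList hn
      (fun a ha hi => ((hmemI a).1 (hIs a hi)).2.1 (mem_toList.1 ha)) (by simp [hA, hlen])
      (fun a ha i hi => hAI a ha i ((hmemI i).1 (hIs i hi)).1
        fun hia => ((hmemI i).1 (hIs i hi)).2.1 (hia ▸ mem_toList.1 ha))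
    refine ⟨Z, h1, ?_, by simpa [hA] using h3, h4, ?_⟩
    · simpa using h2
    · simpa using h5
  have hxy : G.Adj x y := (h.adj_iff x h.left_mem y h.right_mem).2 ⟨h.ne, by simp⟩
  have hmemZ : ∀ {Z Is : List V}, (∀ i ∈ Is, i ∈ I) → (∀ z ∈ Z, z ∈ A ∨ z ∈ Is) →
      ∀ z ∈ Z, z ∈ s ∧ z ≠ x ∧ z ≠ y := by
    intro Z Is hIs hZ z hz
    rcases hZ z hz with hz | hz
    · exact ⟨h.subset hz, fun e => h.left_notMem (e ▸ hz), fun e => h.right_notMem (e ▸ hz)⟩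
    · have := (hmemI z).1 (hIs z hz)
      exact ⟨this.1, this.2.2⟩
  -- An edge from `v` to an end `b` of the special edge `ab` gives the path `i a … i a` through all
  -- of `A`, followed by `a, b, v`: `2l + 3` vertices.
  have hend : ∀ a b, (a = x ∧ b = y ∨ a = y ∧ b = x) → ¬ G.Adj v b := by
    intro a b hab hvb
    obtain ⟨I', hI', hI'c⟩ := exists_subset_card_eq hIc
    have hsubI : ∀ i ∈ I'.toList, i ∈ I := fun i hi => hI' (mem_toList.1 hi)
    obtain ⟨Z, h1, h2, h3, h4, h5⟩ := key I'.toList I'.nodup_toList (by simp [hI'c]) hsubI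
    have hZ := hmemZ hsubI h2
    have has : a ∈ s ∧ a ∉ A ∧ ∀ z ∈ Z, z ≠ a := by
      rcases hab with ⟨rfl, rfl⟩ | ⟨rfl, rfl⟩
      · exact ⟨h.left_mem, h.left_notMem, fun z hz => (hZ z hz).2.1⟩
      · exact ⟨h.right_mem, h.right_notMem, fun z hz => (hZ z hz).2.2⟩
    have hbs : b ∈ s ∧ b ∉ A ∧ (∀ z ∈ Z, z ≠ b) ∧ G.Adj a b := by
      rcases hab with ⟨rfl, rfl⟩ | ⟨rfl, rfl⟩
      · exact ⟨h.right_mem, h.right_notMem, fun z hz => (hZ z hz).2.2, hxy⟩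
      · exact ⟨h.left_mem, h.left_notMem, fun z hz => (hZ z hz).2.1, hxy.symm⟩
    have hav : a ≠ v := fun e => hv (e ▸ has.1)
    have hp3 : IsPathList G [a, b, v] := by
      refine ⟨by simp [hbs.2.2.2, hvb.symm], ?_⟩
      simp [hbs.2.2.2.ne, hav, hvb.ne.symm]
    have hpath : IsPathList G (Z ++ [a, b, v]) := by
      refine h1.append hp3 ?_ ?_
      · intro z hz hz'
        simp only [List.mem_cons, List.not_mem_nil, or_false] at hz'
        rcases hz' with rfl | rfl | rfl
        · exact has.2.2 z hz rfl
        · exact hbs.2.2.1 z hz rfl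
        · exact hv (hZ z hz).1
      · intro z hz w hw
        simp only [List.head?_cons, Option.mem_some_iff] at hw
        subst hw
        exact hAI z (mem_toList.2 (h5 z hz)) _ has.1 fun e => has.2.1 (e ▸ h5 z hz)
    exact hp ⟨_, hpath, by simp [h3]⟩
  -- An edge from `v` to an independent vertex `w` gives `v`, an alternating path through `A`
  -- starting at `w`, then `x, y`: again `2l + 3` vertices.
  have hindep : ∀ w ∈ I, ¬ G.Adj v w := by
    intro w hw hvw
    obtain ⟨I', hI', hI'c⟩ := exists_subset_card_eq
      (show l - 1 ≤ #(I.erase w) by rw [card_erase_of_mem hw]; omega)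
    have hsubI : ∀ i ∈ w :: I'.toList, i ∈ I := fun i hi => by
      rcases List.mem_cons.1 hi with rfl | hi
      · exact hw
      · exact mem_of_mem_erase (hI' (mem_toList.1 hi))
    obtain ⟨Z, h1, h2, h3, h4, h5⟩ := key (w :: I'.toList)
      (List.nodup_cons.2 ⟨fun hi => notMem_erase _ _ (hI' (mem_toList.1 hi)), I'.nodup_toList⟩)
      (by simp [hI'c]; omega) hsubI
    have hZ := hmemZ hsubI h2
    have hZv : IsPathList G (v :: Z) := h1.cons (fun hz => hv (hZ v hz).1) fun z hz => by
      rw [h4, List.head?_cons, Option.mem_some_iff] at hz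
      exact hz ▸ hvw
    have hpath : IsPathList G ((v :: Z) ++ [x, y]) := by
      refine hZv.append ⟨by simp [hxy], by simp [h.ne]⟩ ?_ ?_
      · intro z hz hz'
        simp only [List.mem_cons, List.not_mem_nil, or_false] at hz hz'
        rcases hz with rfl | hz
        · rcases hz' with rfl | rfl
          · exact hv h.left_mem
          · exact hv h.right_mem
        · rcases hz' with e | e
          · exact (hZ z hz).2.1 e
          · exact (hZ z hz).2.2 e
      · intro z hz b hb
        simp only [List.head?_cons, Option.mem_some_iff] at hb
        subst hb
        have hz' : z ∈ Z.getLast? := by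
          cases Z with
          | nil => simp at h3; omega
          | cons => simpa using hz
        exact hAI z (mem_toList.2 (h5 z hz')) _ h.left_mem fun e => h.left_notMem (e ▸ h5 z hz')
    exact hp ⟨_, hpath, by simp [h3]⟩
  have hnot : ∀ w ∈ s, w ∉ A → ¬ G.Adj v w := by
    intro w hw hwA
    by_cases hwx : w = x
    · exact hwx ▸ hend y x (by simp)
    by_cases hwy : w = y
    · exact hwy ▸ hend x y (by simp)
    exact hindep w ((hmemI w).2 ⟨hw, hwA, hwx, hwy⟩)
  have hsub : s.filter (G.Adj v) ⊆ A := fun w hw => by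
    by_contra hwA
    exact hnot w (mem_filter.1 hw).1 hwA (mem_filter.1 hw).2
  have heq : s.filter (G.Adj v) = A := eq_of_subset_of_card_le hsub (by rw [hA]; exact hdeg)
  have hadjA : ∀ a ∈ A, G.Adj v a := fun a ha => by
    rw [← heq] at ha
    exact (mem_filter.1 ha).2
  have hvA : v ∉ A := fun hvA => hv (h.subset hvA)
  have hvx : v ≠ x := fun e => hv (e ▸ h.left_mem)
  have hvy : v ≠ y := fun e => hv (e ▸ h.right_mem)
  have hviff : ∀ b ∈ s, G.Adj v b ↔ b ∈ A := fun b hb =>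
    ⟨fun hvb => by_contra fun hbA => hnot b hb hbA hvb, hadjA b⟩
  refine ⟨h.subset.trans (subset_insert _ _), mem_insert_of_mem h.left_mem,
    mem_insert_of_mem h.right_mem, h.left_notMem, h.right_notMem, h.ne, ?_⟩
  intro a ha b hb
  rcases mem_insert.1 ha with rfl | ha' <;> rcases mem_insert.1 hb with rfl | hb'
  · simp
  · rw [hviff b hb']
    have : a ≠ b := fun e => hv (e ▸ hb')
    simp [this, hvA, hvx, hvy]
  · rw [G.adj_comm, hviff a ha']
    have : a ≠ b := fun e => hv (e ▸ ha')
    simp [this, hvA, hvx, hvy]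
  · exact h.adj_iff a ha' b hb'

/-- Uniqueness of the extremal structure among the graphs without a path on `2l + 3` vertices which
are `l`-degenerate over a set of `l + 2` vertices. -/
theorem exists_isJoinEdge {l : ℕ} (hl : 1 ≤ l) (hp : ¬ HasPath G (2 * l + 3)) {Q : Finset V}
    (hQ : #Q ≤ l + 2) (hd : DegenOver G l Q) {s : Finset V} (hs : 2 * l + 3 ≤ #s)
    (hpairs : (l + 2) * (l + 1) + 2 * l * (#s - (l + 2)) ≤ pairs G s) :
    ∃ A x y, #A = l ∧ IsJoinEdge G s A x y := by
  induction hm : #s - (2 * l + 3) generalizing s with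
  | zero =>
    have hsc : #s = 2 * l + 3 := by omega
    -- Equality in the peeling bound leaves room for no missing edge among the last `l + 2`
    -- vertices.
    obtain ⟨K, hKs, hK, hKp⟩ := hd.exists_pairs_le hQ (by omega : l + 2 ≤ #s)
    have hcl := clique_of_le_pairs (G := G) (s := K) (by
      rw [hK, show l + 2 - 1 = l + 1 by omega]
      omega)
    -- Deleting a vertex of smaller degree would leave more edges than the peeling bound allows.
    have hdeg : ∀ v ∈ s, l ≤ degIn G s v := by
      intro v hv
      have h1 := hd.pairs_le hQ (T := s.erase v) (by rw [card_erase_of_mem hv]; omega)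
      rw [card_erase_of_mem hv, hsc, show 2 * l + 3 - 1 - (l + 2) = l by omega,
        show l + 2 - 1 = l + 1 by omega] at h1
      rw [pairs_erase hv, hsc, show 2 * l + 3 - (l + 2) = l + 1 by omega] at hpairs
      nlinarith
    obtain ⟨A, x, y, hA, h⟩ := exists_isJoinEdge_of_card_eq (V := (s : Set V))
      (G := G.induce (s : Set V)) (K := K.subtype (· ∈ (s : Set V))) hl (by simpa using hsc)
      (fun h => hp (h.map (SimpleGraph.Embedding.induce (s : Set V)).toHom
        Subtype.val_injective))
      (fun v => by
        rw [degIn_induce]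
        exact hdeg v v.2)
      (by
        rw [card_subtype, filter_true_of_mem fun x hx => by exact_mod_cast hKs hx, hK])
      (fun x hx y hy hxy => by
        rw [mem_subtype] at hx hy
        exact hcl x hx y hy fun e => hxy (Subtype.ext e))
      (by
        rw [pairs_induce]
        rwa [hsc, show 2 * l + 3 - (l + 2) = l + 1 by omega] at hpairs)
    have h' := h.map (SimpleGraph.Embedding.induce (s : Set V))
    rw [map_induce_univ] at h'
    exact ⟨_, _, _, by rw [card_map, hA], h'⟩
  | succ m ih =>
    obtain ⟨v, hv, -, hdv⟩ := hd s fun h => by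
      have := card_le_card h
      omega
    have hc := card_erase_of_mem hv
    have hpe := pairs_erase (G := G) hv
    have hc' : #s - (l + 2) = #(s.erase v) - (l + 2) + 1 := by omega
    obtain ⟨A, x, y, hA, h⟩ := ih (s := s.erase v) (by omega) (by
      rw [hpe, hc'] at hpairs
      nlinarith) (by omega)
    have hub := hd.pairs_le hQ (T := s.erase v) (by omega)
    rw [show l + 2 - 1 = l + 1 by omega] at hub
    have hdv' : l ≤ degIn G (s.erase v) v := by
      rw [degIn_erase_self]
      rw [hpe, hc'] at hpairs
      nlinarith
    refine ⟨A, x, y, hA, ?_⟩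
    have := h.insert_vertex hp hA (by omega) (notMem_erase v s) hdv' hl
    rwa [insert_erase hv] at this

end Structure


/-! ### Restriction to connected components. -/

section Components

variable {V : Type*} {G : SimpleGraph V}

lemma exists_component (s : Finset V) {x : V} (hx : x ∈ s) : ∃ C ⊆ s, x ∈ C ∧
    (G.induce (C : Set V)).Connected ∧ ∀ a ∈ C, ∀ b ∈ s \ C, ¬ G.Adj a b := by
  set H := G.induce (s : Set V)
  set c := H.connectedComponentMk ⟨x, hx⟩
  set C : Finset V := {y ∈ s | ∃ h : y ∈ (s : Set V), (⟨y, h⟩ : (s : Set V)) ∈ c.supp} with hC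
  refine ⟨C, filter_subset _ _, ?_, ?_, ?_⟩
  · simp only [hC, mem_filter]
    exact ⟨hx, hx, SimpleGraph.ConnectedComponent.connectedComponentMk_mem⟩
  · have h1 : (H.induce c.supp).Connected := c.maximal_connected_induce_supp.1
    refine h1.map (H := G.induce (C : Set V))
      ⟨fun z => ⟨z.1.1, by
        simp only [hC, coe_filter, Set.mem_ofPred_eq]
        exact ⟨z.1.2, z.1.2, z.2⟩⟩, fun {a b} hab => hab⟩ ?_
    rintro ⟨y, hy⟩
    simp only [hC, coe_filter, Set.mem_ofPred_eq] at hy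
    obtain ⟨-, h, hc⟩ := hy
    exact ⟨⟨⟨y, h⟩, hc⟩, rfl⟩
  · intro a ha b hb hab
    simp only [hC, mem_filter] at ha
    obtain ⟨-, h, hc⟩ := ha
    have hb' := mem_sdiff.1 hb
    refine hb'.2 ?_
    simp only [hC, mem_filter]
    refine ⟨hb'.1, hb'.1, ?_⟩
    exact c.mem_supp_of_adj_mem_supp hc (show H.Adj ⟨a, h⟩ ⟨b, hb'.1⟩ from hab)

lemma hasPath_of_induce {s : Set V} {k : ℕ} (h : HasPath (G.induce s) k) : HasPath G k :=
  h.map (SimpleGraph.Embedding.induce s).toHom Subtype.val_injective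

lemma pairs_le_of_connected {C : Finset V} (hC : (G.induce (C : Set V)).Connected) {p : ℕ}
    (hp3 : 3 ≤ p) (hp : ¬ HasPath (G.induce (C : Set V)) (p + 1)) (hcard : p + 1 ≤ #C) : ∃ t, 1 ≤ t ∧ 2 * t + 1 ≤ p ∧
      pairs G C ≤ (p - t) * (p - t - 1) + 2 * t * (#C - (p - t)) := by
  obtain ⟨t, Q, h1, h2, h3, h4⟩ := exists_degenOver hC hp3 hp
    (by simpa using hcard)
  have hcu : #(univ : Finset (C : Set V)) = #C := by simp
  have := h4.pairs_le (k := p - t) (T := univ) (by omega) (by rw [hcu]; omega)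
  rw [pairs_induce, hcu] at this
  exact ⟨t, h1, h2, this⟩

end Components

/-! ### The bound for graphs without `P_{2l+1}`. -/

section FaudreeSchelp

/-- Twice the number of edges of the disjoint union of copies of `K_m` and one smaller clique on
`n` vertices in total. -/
def cliquesPairs (m n : ℕ) : ℕ := n / m * (m * (m - 1)) + n % m * (n % m - 1)

lemma cast_mul_pred (r : ℕ) : ((r * (r - 1) : ℕ) : ℤ) = r * (r - 1) := by
  cases r <;> simp

/-- Moving vertices from one clique until the other is a full `K_m` gains `(m - r₁)(m - r₂)` edges.
-/
lemma mul_pred_add_le {m r₁ r₂ : ℕ} (h₁ : r₁ ≤ m) (h₂ : r₂ ≤ m) (h : m ≤ r₁ + r₂) :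
    r₁ * (r₁ - 1) + r₂ * (r₂ - 1) ≤ m * (m - 1) + (r₁ + r₂ - m) * (r₁ + r₂ - m - 1) := by
  obtain ⟨R, hR⟩ := Nat.exists_eq_add_of_le h
  rw [hR, Nat.add_sub_cancel_left]
  zify
  have := cast_mul_pred r₁
  have := cast_mul_pred r₂
  have := cast_mul_pred m
  have := cast_mul_pred R
  push_cast at *
  have e : (R : ℤ) = r₁ + r₂ - m := by omega
  nlinarith [mul_nonneg (show (0 : ℤ) ≤ m - r₁ by omega) (show (0 : ℤ) ≤ m - r₂ by omega)]

lemma cliquesPairs_add_le {m : ℕ} (hm : 0 < m) (a b : ℕ) :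
    cliquesPairs m a + cliquesPairs m b ≤ cliquesPairs m (a + b) := by
  unfold cliquesPairs
  have ha := Nat.mod_lt a hm
  have hb := Nat.mod_lt b hm
  rcases lt_or_ge (a % m + b % m) m with h | h
  · rw [Nat.add_mod_of_add_mod_lt h, Nat.add_div_eq_of_add_mod_lt h]
    have h1 : a % m * (a % m - 1) ≤ a % m * (a % m + b % m - 1) := Nat.mul_le_mul_left _ (by omega)
    have h2 : b % m * (b % m - 1) ≤ b % m * (a % m + b % m - 1) := Nat.mul_le_mul_left _ (by omega)
    nlinarith
  · have h1 : (a + b) % m = a % m + b % m - m := by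
      have := Nat.add_mod_add_of_le_add_mod h
      omega
    have h2 : (a + b) / m = a / m + b / m + 1 := Nat.add_div_eq_of_le_mod_add_mod h hm
    rw [h1, h2]
    have := mul_pred_add_le ha.le hb.le h
    nlinarith

/-- With `n = 2l(a + 1) + r`, the right side exceeds the left by `(2la + 2t)(2l - 2t - 1) + (r -
t)(r - t - 1)`. The last product is nonnegative because its factors are consecutive integers. -/
lemma kopylov_le_cliquesPairs {l n t : ℕ} (ht : 1 ≤ t) (htl : t + 1 ≤ l) (hn : 2 * l + 1 ≤ n) :
    (2 * l - t) * (2 * l - t - 1) + 2 * t * (n - (2 * l - t)) ≤ cliquesPairs (2 * l) n := by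
  unfold cliquesPairs
  set r := n % (2 * l)
  obtain ⟨a, ha⟩ : ∃ a, n / (2 * l) = a + 1 :=
    Nat.exists_eq_add_of_le' (Nat.div_pos (by omega) (by omega))
  have hnr : n = 2 * l * (a + 1) + r := by rw [← ha]; exact (Nat.div_add_mod n (2 * l)).symm
  rw [ha]
  have e1 := cast_mul_pred (2 * l - t)
  have e2 := cast_mul_pred (2 * l)
  have e3 := cast_mul_pred r
  have hsub : n - (2 * l - t) = 2 * l * a + r + t := by
    rw [hnr]
    have : 2 * l * (a + 1) = 2 * l * a + 2 * l := by ring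
    omega
  rw [hsub]
  zify
  rw [← Nat.cast_mul (2 * l - t) _, ← Nat.cast_mul r, e1, e3]
  rw [show ((2 * (l : ℤ)) * ((2 * l - 1 : ℕ) : ℤ)) = ((2 * l * (2 * l - 1) : ℕ) : ℤ) by push_cast; ring,
    e2]
  push_cast [show t ≤ 2 * l by omega]
  obtain ⟨u, rfl⟩ := Nat.exists_eq_add_of_le htl
  push_cast
  have h1 : (0 : ℤ) ≤ (a : ℤ) * u := by positivity
  have h2 : (0 : ℤ) ≤ (t : ℤ) * u := by positivity
  have h3 : (0 : ℤ) ≤ (a : ℤ) * t := by positivity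
  have h4 : (0 : ℤ) ≤ ((r : ℤ) - t) * (r - t - 1) := by
    rcases le_or_gt (r : ℤ) t with h | h
    · nlinarith
    · exact mul_nonneg (by omega) (by omega)
  nlinarith [mul_nonneg h1 (show (0 : ℤ) ≤ u by omega), mul_nonneg h1 (show (0 : ℤ) ≤ t by omega)]

/-- The Faudree–Schelp bound on the number of edges of a graph without a path on `2l + 1`
vertices. -/
theorem pairs_le_cliquesPairs {V : Type*} {G : SimpleGraph V} {l : ℕ} (hl : 2 ≤ l)
    (hp : ¬ HasPath G (2 * l + 1)) (s : Finset V) : pairs G s ≤ cliquesPairs (2 * l) #s := by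
  induction hm : #s using Nat.strong_induction_on generalizing s with
  | _ m ih =>
    rcases s.eq_empty_or_nonempty with rfl | ⟨x, hx⟩
    · simp
    obtain ⟨C, hCs, hxC, hconn, hno⟩ := exists_component (G := G) s hx
    have hCpos : 0 < #C := card_pos.2 ⟨x, hxC⟩
    have h1 : pairs G C ≤ cliquesPairs (2 * l) #C := by
      rcases le_or_gt #C (2 * l) with h | h
      · refine (pairs_le_clique C).trans ?_
        unfold cliquesPairs
        rcases h.lt_or_eq with h | h
        · rw [Nat.div_eq_of_lt h, Nat.mod_eq_of_lt h]
          omega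
        · rw [h, Nat.div_self (by omega)]
          omega
      · obtain ⟨t, h1, h2, h3⟩ := pairs_le_of_connected hconn (by omega)
          (fun h => hp (hasPath_of_induce h)) h
        exact h3.trans (kopylov_le_cliquesPairs h1 (by omega) h)
    have hcard : #(s \ C) + #C = #s := card_sdiff_add_card_eq_card hCs
    have h2 := ih #(s \ C) (by omega) (s \ C) rfl
    have h3 := pairs_union_of_forall_not_adj disjoint_sdiff hno
    rw [union_sdiff_of_subset hCs] at h3
    have h4 := cliquesPairs_add_le (show 0 < 2 * l by omega) #C #(s \ C)
    rw [add_comm #C, hcard, hm] at h4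
    omega

end FaudreeSchelp


/-! ### Kopylov's bounds against the clique and join terms. -/

section Arithmetic

lemma cast_mul_pred' (r : ℕ) : ((r : ℤ) * ((r - 1 : ℕ) : ℤ)) = r * (r - 1) := by
  exact_mod_cast cast_mul_pred r

/-- The convex function of `t` in Kopylov's bound for paths on `2l + 4` vertices is dominated for
`t < l`. -/
lemma kopylov_lt_max {l t q n : ℕ} (ht : 1 ≤ t) (htl : t + 1 ≤ l) (hl : 2 ≤ l)
    (hn : n = 2 * l + 3 + q) (hq : 1 ≤ q) :
    (2 * l + 3 - t) * (2 * l + 3 - t - 1) + 2 * t * (n - (2 * l + 3 - t)) <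
      max ((2 * l + 3) * (2 * l + 2) + 2 * (q / 2))
        ((l + 2) * (l + 1) + 2 * l * (n - (l + 2))) := by
  have e1 := cast_mul_pred' (2 * l + 3 - t)
  obtain ⟨u, rfl⟩ := Nat.exists_eq_add_of_le htl
  rw [show n - (2 * (t + 1 + u) + 3 - t) = q + t by omega,
    show n - (t + 1 + u + 2) = q + t + u + 2 by omega]
  rw [show 2 * (t + 1 + u) + 3 - t = t + 2 * u + 5 by omega] at e1 ⊢
  rw [lt_max_iff]
  rw [Nat.add_sub_cancel (n := t + 2 * u + 4) (m := 1)]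
  rcases le_or_gt (2 * q + t) (4 * u + 9) with h | h
  · rcases Nat.lt_or_ge 1 q with hq1 | hq1
    · left
      have := Nat.div_add_mod q 2
      have : 1 ≤ q / 2 := by omega
      nlinarith
    · obtain rfl : q = 1 := by omega
      rcases Nat.lt_or_ge (2 + t) (4 * u + 9) with h' | h'
      · left
        simp only [show 1 / 2 = 0 by norm_num]
        nlinarith
      · right
        nlinarith
  · right
    nlinarith

/-- The left side is Kopylov's bound with `p = 2l` on the `n - 3` vertices left after deleting a
`P_3`, plus twice the at most `n + 2l - 4` edges that the deletion destroys. For `t + 1 < l` it is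
dominated by the previous bound at `t + 1`; for `t + 1 = l` it lies below the join term directly. -/
lemma kopylov_add_lt_max {l t q n : ℕ} (ht : 1 ≤ t) (htl : t + 1 ≤ l) (hl : 2 ≤ l)
    (hn : n = 2 * l + 3 + q) (hq : 1 ≤ q) :
    (2 * l - t) * (2 * l - t - 1) + 2 * t * (n - 3 - (2 * l - t)) + 2 * (n + 2 * l - 4) <
      max ((2 * l + 3) * (2 * l + 2) + 2 * (q / 2))
        ((l + 2) * (l + 1) + 2 * l * (n - (l + 2))) := by
  rcases htl.lt_or_eq with h | h
  · have := kopylov_lt_max (t := t + 1) (by omega) h hl hn hq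
    refine lt_of_le_of_lt ?_ this
    obtain ⟨u, rfl⟩ := Nat.exists_eq_add_of_le h
    rw [show n - 3 - (2 * (t + 1 + 1 + u) - t) = q + t by omega,
      show n - (2 * (t + 1 + 1 + u) + 3 - (t + 1)) = q + t + 1 by omega,
      show n + 2 * (t + 1 + 1 + u) - 4 = 4 * t + 4 * u + 7 + q by omega,
      show 2 * (t + 1 + 1 + u) + 3 - (t + 1) = t + 2 * u + 6 by omega,
      show 2 * (t + 1 + 1 + u) - t - 1 = t + 2 * u + 3 by omega,
      show 2 * (t + 1 + 1 + u) - t = t + 2 * u + 4 by omega,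
      show t + 2 * u + 6 - 1 = t + 2 * u + 5 by omega]
    nlinarith
  · rw [lt_max_iff]
    right
    subst h
    rw [show n - 3 - (2 * (t + 1) - t) = q + t by omega,
      show n - (t + 1 + 2) = q + t + 2 by omega,
      show n + 2 * (t + 1) - 4 = 4 * t + 3 + q by omega,
      show 2 * (t + 1) - t - 1 = t + 1 by omega,
      show 2 * (t + 1) - t = t + 2 by omega]
    nlinarith

end Arithmetic


/-! ### Forbidden adjacencies around a path on `2l + 3` vertices. -/

section IndexedPaths

variable {V : Type*} {G : SimpleGraph V}

/-- `G` does not contain disjoint paths on `k` and on `3` vertices. -/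
def NoTwoPaths (G : SimpleGraph V) (k : ℕ) : Prop :=
  ∀ L L', IsPathList G L → IsPathList G L' → L.Disjoint L' → k ≤ L.length → 3 ≤ L'.length → False

lemma NoTwoPaths.not_hasPath {k : ℕ} (h : NoTwoPaths G k) : ¬ HasPath G (k + 3) := by
  rintro ⟨L, hL, hl⟩
  refine h (L.take k) (L.drop k) (hL.take k) (hL.drop k) (List.disjoint_take_drop hL.2 le_rfl) ?_ ?_
  · simp; omega
  · simp; omega

/-- `v 1, …, v p` are the consecutive vertices of a path. -/
structure IsPathSeq (G : SimpleGraph V) (v : ℕ → V) (p : ℕ) : Prop where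
  adj : ∀ i, 1 ≤ i → i < p → G.Adj (v i) (v (i + 1))
  inj : ∀ i j, 1 ≤ i → i ≤ p → 1 ≤ j → j ≤ p → v i = v j → i = j

lemma IsPathSeq.reverse {v : ℕ → V} {p : ℕ} (h : IsPathSeq G v p) :
    IsPathSeq G (fun i => v (p + 1 - i)) p where
  adj i h1 h2 := by
    have := h.adj (p - i) (by omega) (by omega)
    rw [show p - i + 1 = p + 1 - i by omega] at this
    rw [show p + 1 - (i + 1) = p - i by omega]
    exact this.symm
  inj i j h1 h2 h3 h4 h5 := by
    have := h.inj _ _ (by omega) (by omega) (by omega) (by omega) h5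
    omega

lemma exists_isPathSeq {p : ℕ} (h : HasPath G p) (hp : 1 ≤ p) : ∃ v : ℕ → V, IsPathSeq G v p := by
  obtain ⟨L, hL, hl⟩ := h
  have h0 : 0 < L.length := by omega
  -- List positions start at `0`, the sequence at `1`; the default is never reached for indices from
  -- `1` to `p`.
  refine ⟨fun i => L.getD (i - 1) (L[0]), ?_, ?_⟩
  · intro i h1 h2
    have := List.isChain_iff_getElem.1 hL.1 (i - 1) (by omega)
    rw [List.getD_eq_getElem _ _ (by omega), List.getD_eq_getElem _ _ (by omega)]
    convert this using 2
    omega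
  · intro i j h1 h2 h3 h4 h5
    rw [List.getD_eq_getElem _ _ (by omega), List.getD_eq_getElem _ _ (by omega)] at h5
    have := (hL.2.getElem_inj_iff).1 h5
    omega

/-- The list `v a, …, v b`. -/
def seg (v : ℕ → V) (a b : ℕ) : List V := (List.range' a (b + 1 - a)).map v

/-- The vertex `w` is not among `v 1, …, v p`. -/
def OffSeq (v : ℕ → V) (p : ℕ) (w : V) : Prop := ∀ i, 1 ≤ i → i ≤ p → v i ≠ w

variable {v : ℕ → V} {p : ℕ}

lemma OffSeq.reverse {w : V} (h : OffSeq v p w) : OffSeq (fun i => v (p + 1 - i)) p w :=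
  fun i h1 h2 => h _ (by omega) (by omega)

lemma mem_seg {a b : ℕ} {x : V} : x ∈ seg v a b ↔ ∃ i, a ≤ i ∧ i ≤ b ∧ v i = x := by
  simp only [seg, List.mem_map, List.mem_range'_1]
  constructor
  · rintro ⟨i, h1, h2⟩
    exact ⟨i, by omega, by omega, h2⟩
  · rintro ⟨i, h1, h2, h3⟩
    exact ⟨i, by omega, h3⟩

@[simp] lemma length_seg (a b : ℕ) : (seg v a b).length = b + 1 - a := by simp [seg]

lemma head?_seg {a b : ℕ} (h : a ≤ b) : (seg v a b).head? = some (v a) := by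
  simp [seg, List.head?_range']
  omega

lemma getLast?_seg {a b : ℕ} (h : a ≤ b) : (seg v a b).getLast? = some (v b) := by
  simp only [seg, List.getLast?_map, List.getLast?_range']
  rw [if_neg (by omega)]
  simp
  congr 1; omega

lemma IsPathSeq.seg (h : IsPathSeq G v p) {a b : ℕ} (ha : 1 ≤ a) (hb : b ≤ p) :
    IsPathList G (seg v a b) := by
  refine ⟨?_, ?_⟩
  · rw [DisjointPaths.seg, List.isChain_map, List.isChain_iff_getElem]
    intro i hi
    simp only [List.length_range'] at hi
    simp only [List.getElem_range']
    have := h.adj (a + i) (by omega) (by omega)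
    simpa [add_assoc] using this
  · rw [DisjointPaths.seg]
    refine List.Nodup.map_on ?_ (List.nodup_range' (h := by omega))
    intro x hx y hy hxy
    rw [List.mem_range'_1] at hx hy
    exact h.inj _ _ (by omega) (by omega) (by omega) (by omega) hxy

lemma OffSeq.notMem_seg {w : V} (h : OffSeq v p w) {a b : ℕ} (ha : 1 ≤ a) (hb : b ≤ p) :
    w ∉ seg v a b := by
  rw [mem_seg]
  rintro ⟨i, h1, h2, h3⟩
  exact h i (by omega) (by omega) h3

lemma IsPathSeq.notMem_seg (h : IsPathSeq G v p) {i a b : ℕ} (hi : 1 ≤ i) (hi' : i ≤ p)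
    (ha : 1 ≤ a) (hb : b ≤ p) (hab : i < a ∨ b < i) : v i ∉ DisjointPaths.seg v a b := by
  rw [mem_seg]
  rintro ⟨j, h1, h2, h3⟩
  have := h.inj _ _ (by omega) (by omega) (by omega) (by omega) h3
  omega

lemma IsPathSeq.disjoint_seg (h : IsPathSeq G v p) {a b c d : ℕ} (ha : 1 ≤ a) (hd : d ≤ p)
    (hb : b < c) : (DisjointPaths.seg v a b).Disjoint (DisjointPaths.seg v c d) := by
  intro x hx hy
  obtain ⟨i, h1, h2, rfl⟩ := mem_seg.1 hx
  by_cases hid : i ≤ p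
  · exact h.notMem_seg (by omega) hid (by omega) hd (Or.inl (by omega)) hy
  · obtain ⟨j, h3, h4, h5⟩ := mem_seg.1 hy
    omega

/-- The path `w, v a, …, v b`. -/
lemma IsPathSeq.cons_seg (h : IsPathSeq G v p) {w : V} (hw : OffSeq v p w) {a b : ℕ} (ha : 1 ≤ a)
    (hb : b ≤ p) (hadj : a ≤ b → G.Adj w (v a)) : IsPathList G (w :: DisjointPaths.seg v a b) := by
  refine (h.seg ha hb).cons (hw.notMem_seg ha hb) ?_
  intro y hy
  by_cases hab : a ≤ b
  · rw [head?_seg hab] at hy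
    cases hy
    exact hadj hab
  · rw [List.length_eq_zero_iff.1 (show (DisjointPaths.seg v a b).length = 0 by simp; omega)] at hy
    simp at hy

variable {l : ℕ} {w w' : V}

lemma not_adj_one (h : IsPathSeq G v (2 * l + 3)) (hN : NoTwoPaths G (2 * l + 1))
    (hw : OffSeq v (2 * l + 3) w) : ¬ G.Adj w (v 1) := fun hadj =>
  hN.not_hasPath ⟨_, h.cons_seg hw (b := 2 * l + 3) le_rfl le_rfl fun _ => hadj, by simp⟩

lemma isPathList_three {a b c : V} (hab : G.Adj a b) (hbc : G.Adj b c) (hac : a ≠ c) :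
    IsPathList G [a, b, c] := by
  refine ⟨by simp [hab, hbc], ?_⟩
  simp [hab.ne, hbc.ne, hac]

/-- The `P_3` is `v 1, v 2, w`, and `v 3, …` has exactly `2l + 1` vertices. The lemmas that follow
likewise cut a `P_3` from the path and let outside vertices or a reversal make up the missing
length. -/
lemma not_adj_two (h : IsPathSeq G v (2 * l + 3)) (hN : NoTwoPaths G (2 * l + 1))
    (hw : OffSeq v (2 * l + 3) w) : ¬ G.Adj w (v 2) := fun hadj => by
  refine hN (seg v 3 (2 * l + 3)) [v 1, v 2, w] (h.seg (by omega) le_rfl)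
    (isPathList_three (h.adj 1 le_rfl (by omega)) hadj.symm (hw 1 le_rfl (by omega))) ?_
    (by simp) (by simp)
  simp only [List.disjoint_cons_right]
  refine ⟨h.notMem_seg ?_ ?_ ?_ ?_ ?_, h.notMem_seg ?_ ?_ ?_ ?_ ?_, hw.notMem_seg ?_ ?_, by simp⟩ <;>
    omega

lemma not_adj_four (hl : 2 ≤ l) (h : IsPathSeq G v (2 * l + 3)) (hN : NoTwoPaths G (2 * l + 1))
    (hw : OffSeq v (2 * l + 3) w) : ¬ G.Adj w (v 4) := fun hadj => by
  refine hN (w :: seg v 4 (2 * l + 3)) (seg v 1 3) (h.cons_seg hw (by omega) le_rfl fun _ => hadj)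
    (h.seg le_rfl (by omega)) ?_ (by simp) (by simp)
  rw [List.disjoint_cons_left]
  exact ⟨hw.notMem_seg le_rfl (by omega), (h.disjoint_seg le_rfl le_rfl (by omega)).symm⟩

lemma not_adj_five (hl : 2 ≤ l) (h : IsPathSeq G v (2 * l + 3)) (hN : NoTwoPaths G (2 * l + 1))
    (hw : OffSeq v (2 * l + 3) w) (hw' : OffSeq v (2 * l + 3) w') (hww : G.Adj w w') :
    ¬ G.Adj w (v 5) := fun hadj => by
  refine hN (w' :: w :: seg v 5 (2 * l + 3)) (seg v 1 3)
    ((h.cons_seg hw (by omega) le_rfl fun _ => hadj).cons ?_ ?_)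
    (h.seg le_rfl (by omega)) ?_ (by simp; omega) (by simp)
  · rw [List.mem_cons, not_or]
    exact ⟨hww.ne', hw'.notMem_seg (by omega) le_rfl⟩
  · simp [hww.symm]
  · simp only [List.disjoint_cons_left]
    exact ⟨hw'.notMem_seg le_rfl (by omega), hw.notMem_seg le_rfl (by omega),
      (h.disjoint_seg le_rfl le_rfl (by omega)).symm⟩

/-- Rerouting `v 1, …, v i, w, v j, …, v p`. -/
lemma IsPathSeq.detour (h : IsPathSeq G v p) (hw : OffSeq v p w) {i j : ℕ} (hi : 1 ≤ i)
    (hij : i < j) (hj : j ≤ p) (h1 : G.Adj w (v i)) (h2 : G.Adj w (v j)) :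
    IsPathList G (DisjointPaths.seg v 1 i ++ w :: DisjointPaths.seg v j p) := by
  refine (h.seg le_rfl (by omega)).append
    (h.cons_seg hw (by omega) le_rfl fun _ => h2) ?_ ?_
  · rw [List.disjoint_cons_right]
    exact ⟨hw.notMem_seg le_rfl (by omega), h.disjoint_seg le_rfl le_rfl hij⟩
  · rw [getLast?_seg hi]
    simpa using h1.symm

lemma not_adj_succ (h : IsPathSeq G v (2 * l + 3)) (hN : NoTwoPaths G (2 * l + 1))
    (hw : OffSeq v (2 * l + 3) w) {i : ℕ} (hi : 1 ≤ i) (hi' : i < 2 * l + 3)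
    (hadj : G.Adj w (v i)) : ¬ G.Adj w (v (i + 1)) := fun hadj' =>
  hN.not_hasPath ⟨_, h.detour hw hi (by omega) hi' hadj hadj', by simp; omega⟩

/-- The detour through `w` frees the three vertices `v (i+1), v (i+2), v (i+3)` and keeps `2l + 1`
vertices. -/
lemma not_adj_add_four (h : IsPathSeq G v (2 * l + 3)) (hN : NoTwoPaths G (2 * l + 1))
    (hw : OffSeq v (2 * l + 3) w) {i : ℕ} (hi : 1 ≤ i) (hi' : i + 4 ≤ 2 * l + 3)
    (hadj : G.Adj w (v i)) : ¬ G.Adj w (v (i + 4)) := fun hadj' => by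
  refine hN _ (seg v (i + 1) (i + 3)) (h.detour hw hi (by omega) hi' hadj hadj')
    (h.seg (by omega) (by omega)) ?_ (by simp; omega) (by simp)
  rw [List.disjoint_append_left, List.disjoint_cons_left]
  exact ⟨h.disjoint_seg le_rfl (by omega) (by omega), hw.notMem_seg (by omega) (by omega),
    (h.disjoint_seg (by omega) (by omega) (by omega)).symm⟩

lemma eq_of_adj_of_offSeq (h : IsPathSeq G v (2 * l + 3)) (hN : NoTwoPaths G (2 * l + 1))
    (hw : OffSeq v (2 * l + 3) w) {a b : V} (ha : OffSeq v (2 * l + 3) a)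
    (hb : OffSeq v (2 * l + 3) b) (hwa : G.Adj w a) (hwb : G.Adj w b) : a = b := by
  by_contra hab
  refine hN (seg v 1 (2 * l + 3)) [a, w, b] (h.seg le_rfl le_rfl)
    (isPathList_three hwa.symm hwb hab) ?_ (by simp) (by simp)
  simp only [List.disjoint_cons_right]
  exact ⟨ha.notMem_seg le_rfl le_rfl, hw.notMem_seg le_rfl le_rfl, hb.notMem_seg le_rfl le_rfl,
    by simp⟩

/-- Otherwise `w, v i, …, v 1, v (i+1), …` is a path on `2l + 4` vertices. -/
lemma not_adj_one_succ (h : IsPathSeq G v (2 * l + 3)) (hN : NoTwoPaths G (2 * l + 1))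
    (hw : OffSeq v (2 * l + 3) w) {i : ℕ} (hi : 1 ≤ i) (hi' : i < 2 * l + 3)
    (hadj : G.Adj w (v i)) : ¬ G.Adj (v 1) (v (i + 1)) := fun hadj' => by
  refine hN.not_hasPath ⟨w :: ((seg v 1 i).reverse ++ seg v (i + 1) (2 * l + 3)),
    (((h.seg le_rfl hi'.le).reverse.append (h.seg (by omega) le_rfl) ?_ ?_).cons ?_ ?_), ?_⟩
  · intro x hx
    exact h.disjoint_seg le_rfl le_rfl (by omega) (List.mem_reverse.1 hx)
  · rw [List.getLast?_reverse, head?_seg hi, head?_seg hi']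
    simpa using hadj'
  · rw [List.mem_append, List.mem_reverse, not_or]
    exact ⟨hw.notMem_seg le_rfl (by omega), hw.notMem_seg (by omega) le_rfl⟩
  · rw [List.head?_append, List.head?_reverse, getLast?_seg hi]
    simpa using hadj
  · simp; omega

/-- Otherwise `v (i-1), …, v 1, v (i+2), …` has `2l + 1` vertices and avoids `w, v i, v (i+1)`. -/
lemma not_adj_one_add_two (h : IsPathSeq G v (2 * l + 3)) (hN : NoTwoPaths G (2 * l + 1))
    (hw : OffSeq v (2 * l + 3) w) {i : ℕ} (hi : 2 ≤ i) (hi' : i + 2 ≤ 2 * l + 3)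
    (hadj : G.Adj w (v i)) : ¬ G.Adj (v 1) (v (i + 2)) := fun hadj' => by
  refine hN ((seg v 1 (i - 1)).reverse ++ seg v (i + 2) (2 * l + 3)) [w, v i, v (i + 1)]
    ((h.seg le_rfl (by omega)).reverse.append (h.seg (by omega) le_rfl) ?_ ?_)
    (isPathList_three hadj (h.adj i (by omega) (by omega))
      fun e => hw (i + 1) (by omega) (by omega) e.symm) ?_ ?_ (by simp)
  · intro x hx
    exact h.disjoint_seg le_rfl le_rfl (by omega) (List.mem_reverse.1 hx)
  · rw [List.getLast?_reverse, head?_seg (by omega), head?_seg hi']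
    simpa using hadj'
  · simp only [List.disjoint_cons_right, List.mem_append, List.mem_reverse, not_or]
    refine ⟨⟨hw.notMem_seg ?_ ?_, hw.notMem_seg ?_ ?_⟩,
      ⟨h.notMem_seg ?_ ?_ ?_ ?_ ?_, h.notMem_seg ?_ ?_ ?_ ?_ ?_⟩,
      ⟨h.notMem_seg ?_ ?_ ?_ ?_ ?_, h.notMem_seg ?_ ?_ ?_ ?_ ?_⟩, by simp⟩ <;> omega
  · simp; omega

/-- On a path with seven vertices. -/
lemma not_adj_two_five (h : IsPathSeq G v 7) (hN : NoTwoPaths G 5) (hw : OffSeq v 7 w)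
    (hadj : G.Adj w (v 3)) : ¬ G.Adj (v 2) (v 5) := fun hadj' => by
  refine hN (seg v 1 2 ++ seg v 5 7) [w, v 3, v 4]
    ((h.seg le_rfl (by omega)).append (h.seg (by omega) le_rfl)
      (h.disjoint_seg le_rfl le_rfl (by omega)) ?_)
    (isPathList_three hadj (h.adj 3 (by omega) (by omega))
      fun e => hw 4 (by omega) (by omega) e.symm) ?_ (by simp) (by simp)
  · rw [getLast?_seg (by omega), head?_seg (by omega)]
    simpa using hadj'
  · simp only [List.disjoint_cons_right, List.mem_append, not_or]
    refine ⟨⟨hw.notMem_seg ?_ ?_, hw.notMem_seg ?_ ?_⟩,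
      ⟨h.notMem_seg ?_ ?_ ?_ ?_ ?_, h.notMem_seg ?_ ?_ ?_ ?_ ?_⟩,
      ⟨h.notMem_seg ?_ ?_ ?_ ?_ ?_, h.notMem_seg ?_ ?_ ?_ ?_ ?_⟩, by simp⟩ <;> omega

/-- On a path with seven vertices. -/
lemma not_adj_three_of_adj (h : IsPathSeq G v 7) (hN : NoTwoPaths G 5) (hw : OffSeq v 7 w)
    (hw' : OffSeq v 7 w') (hww : G.Adj w w') : ¬ G.Adj w (v 3) := fun hadj => by
  refine hN (w' :: w :: (seg v 1 3).reverse) (seg v 5 7)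
    (((h.seg le_rfl (by omega)).reverse.cons ?_ ?_).cons ?_ ?_)
    (h.seg (by omega) le_rfl) ?_ (by simp) (by simp)
  · rw [List.mem_reverse]
    exact hw.notMem_seg le_rfl (by omega)
  · rw [List.head?_reverse, getLast?_seg (by omega)]
    simpa using hadj
  · rw [List.mem_cons, List.mem_reverse, not_or]
    exact ⟨hww.ne', hw'.notMem_seg le_rfl (by omega)⟩
  · simp [hww.symm]
  · simp only [List.disjoint_cons_left]
    refine ⟨hw'.notMem_seg (by omega) le_rfl, hw.notMem_seg (by omega) le_rfl, fun x hx => ?_⟩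
    exact h.disjoint_seg le_rfl le_rfl (by omega) (List.mem_reverse.1 hx)

end IndexedPaths


/-! ### Degrees of the vertices off the path. -/

section OutsideDegrees

variable {V : Type*} {G : SimpleGraph V} {v : ℕ → V} {p : ℕ}

/-- The set `{v a, …, v b}`. -/
noncomputable def segSet (v : ℕ → V) (a b : ℕ) : Finset V := (Icc a b).image v

lemma mem_segSet {a b : ℕ} {x : V} : x ∈ segSet v a b ↔ ∃ i, a ≤ i ∧ i ≤ b ∧ v i = x := by
  simp [segSet, and_assoc]

lemma offSeq_iff {w : V} : OffSeq v p w ↔ w ∉ segSet v 1 p := by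
  simp [mem_segSet, OffSeq]

lemma IsPathSeq.card_segSet (h : IsPathSeq G v p) {a b : ℕ} (ha : 1 ≤ a) (hb : b ≤ p) :
    #(segSet v a b) = b + 1 - a := by
  rw [segSet, card_image_of_injOn, Nat.card_Icc]
  intro i hi j hj hij
  simp only [coe_Icc, Set.mem_Icc] at hi hj
  exact h.inj _ _ (by omega) (by omega) (by omega) (by omega) hij

lemma IsPathSeq.mem_segSet_iff (h : IsPathSeq G v p) {i a b : ℕ} (hi : 1 ≤ i) (hi' : i ≤ p)
    (ha : 1 ≤ a) (hb : b ≤ p) : v i ∈ segSet v a b ↔ a ≤ i ∧ i ≤ b := by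
  rw [mem_segSet]
  constructor
  · rintro ⟨j, h1, h2, h3⟩
    have := h.inj _ _ (by omega) (by omega) (by omega) (by omega) h3
    omega
  · rintro ⟨h1, h2⟩
    exact ⟨i, h1, h2, rfl⟩

lemma degIn_segSet_le (a b : ℕ) (x : V) :
    degIn G (segSet v a b) x ≤ #{i ∈ Icc a b | G.Adj x (v i)} := by
  refine (card_le_card ?_).trans (card_image_le (f := v))
  intro y hy
  simp only [mem_filter, mem_segSet] at hy
  obtain ⟨⟨i, h1, h2, rfl⟩, h3⟩ := hy
  exact mem_image_of_mem _ (by simp [h1, h2, h3])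

lemma two_mul_card_le_of_succ_notMem {S : Finset ℕ} {a b : ℕ} (hS : S ⊆ Icc a b)
    (h : ∀ i ∈ S, i + 1 ∉ S) : 2 * #S ≤ b + 2 - a := by
  have hd : Disjoint S (S.image (· + 1)) := by
    rw [disjoint_left]
    intro i hi hi'
    obtain ⟨j, hj, rfl⟩ := mem_image.1 hi'
    exact h j hj hi
  have h1 : S ∪ S.image (· + 1) ⊆ Icc a (b + 1) := by
    intro i hi
    rcases mem_union.1 hi with hi | hi
    · have := mem_Icc.1 (hS hi)
      rw [mem_Icc]; omega
    · obtain ⟨j, hj, rfl⟩ := mem_image.1 hi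
      have := mem_Icc.1 (hS hj)
      rw [mem_Icc]; omega
  have := card_le_card h1
  rw [card_union_of_disjoint hd, card_image_of_injective _ (add_left_injective 1),
    Nat.card_Icc] at this
  omega

variable {l : ℕ} {w w' : V}

lemma nbrs_subset_Icc (h : IsPathSeq G v (2 * l + 3)) (hN : NoTwoPaths G (2 * l + 1))
    (hw : OffSeq v (2 * l + 3) w) {i : ℕ} (hi : 1 ≤ i) (hi' : i ≤ 2 * l + 3)
    (hadj : G.Adj w (v i)) : 3 ≤ i ∧ i ≤ 2 * l + 1 := by
  have h1 : i ≠ 1 := by rintro rfl; exact not_adj_one h hN hw hadj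
  have h2 : i ≠ 2 := by rintro rfl; exact not_adj_two h hN hw hadj
  have h3 : i ≠ 2 * l + 3 := by
    rintro rfl; exact not_adj_one h.reverse hN hw.reverse (by simpa using hadj)
  have h4 : i ≠ 2 * l + 2 := by
    rintro rfl; exact not_adj_two h.reverse hN hw.reverse (by simpa using hadj)
  omega

/-- An outside vertex has no two consecutive neighbours on the path, so at most about half of the
indices between `a` and `b` belong to neighbours. -/
lemma two_mul_card_nbrs_le (h : IsPathSeq G v (2 * l + 3)) (hN : NoTwoPaths G (2 * l + 1))
    (hw : OffSeq v (2 * l + 3) w) {a b : ℕ} :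
    2 * #{i ∈ Icc 1 (2 * l + 3) | G.Adj w (v i) ∧ a ≤ i ∧ i ≤ b} ≤ b + 2 - a := by
  refine two_mul_card_le_of_succ_notMem (fun i hi => ?_) fun i hi hi' => ?_
  · simp only [mem_filter] at hi
    exact mem_Icc.2 hi.2.2
  · simp only [mem_filter, mem_Icc] at hi hi'
    exact not_adj_succ h hN hw hi.1.1 (by omega) hi.2.1 hi'.2.1

lemma degIn_path_le (h : IsPathSeq G v (2 * l + 3)) (hN : NoTwoPaths G (2 * l + 1))
    (hw : OffSeq v (2 * l + 3) w) : degIn G (segSet v 1 (2 * l + 3)) w ≤ l := by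
  have h1 := degIn_segSet_le (G := G) (v := v) 1 (2 * l + 3) w
  have h2 := two_mul_card_nbrs_le h hN hw (a := 3) (b := 2 * l + 1)
  have h3 : #{i ∈ Icc 1 (2 * l + 3) | G.Adj w (v i)} ≤
      #{i ∈ Icc 1 (2 * l + 3) | G.Adj w (v i) ∧ 3 ≤ i ∧ i ≤ 2 * l + 1} := by
    refine card_le_card fun i hi => ?_
    simp only [mem_filter, mem_Icc] at hi ⊢
    exact ⟨hi.1, hi.2, nbrs_subset_Icc h hN hw hi.1.1 hi.1.2 hi.2⟩
  omega

lemma degIn_path_lt_of_not_adj_three (h : IsPathSeq G v (2 * l + 3)) (hl : 2 ≤ l)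
    (hN : NoTwoPaths G (2 * l + 1))
    (hw : OffSeq v (2 * l + 3) w) (h3 : ¬ G.Adj w (v 3)) :
    degIn G (segSet v 1 (2 * l + 3)) w < l := by
  have h1 := degIn_segSet_le (G := G) (v := v) 1 (2 * l + 3) w
  have h2 := two_mul_card_nbrs_le h hN hw (a := 5) (b := 2 * l + 1)
  have h4 : #{i ∈ Icc 1 (2 * l + 3) | G.Adj w (v i)} ≤
      #{i ∈ Icc 1 (2 * l + 3) | G.Adj w (v i) ∧ 5 ≤ i ∧ i ≤ 2 * l + 1} := by
    refine card_le_card fun i hi => ?_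
    simp only [mem_filter, mem_Icc] at hi ⊢
    have := nbrs_subset_Icc h hN hw hi.1.1 hi.1.2 hi.2
    have h5 : i ≠ 3 := by rintro rfl; exact h3 hi.2
    have h6 : i ≠ 4 := by rintro rfl; exact not_adj_four hl h hN hw hi.2
    exact ⟨hi.1, hi.2, by omega, by omega⟩
  omega

lemma degIn_path_lt_of_not_adj_five (h : IsPathSeq G v (2 * l + 3)) (hl : 2 ≤ l)
    (hN : NoTwoPaths G (2 * l + 1))
    (hw : OffSeq v (2 * l + 3) w) (h5 : ¬ G.Adj w (v 5)) :
    degIn G (segSet v 1 (2 * l + 3)) w < l := by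
  have h1 := degIn_segSet_le (G := G) (v := v) 1 (2 * l + 3) w
  have h2 := two_mul_card_nbrs_le h hN hw (a := 6) (b := 2 * l + 1)
  have h4 : #{i ∈ Icc 1 (2 * l + 3) | G.Adj w (v i)} ≤
      #(insert 3 {i ∈ Icc 1 (2 * l + 3) | G.Adj w (v i) ∧ 6 ≤ i ∧ i ≤ 2 * l + 1}) := by
    refine card_le_card fun i hi => ?_
    simp only [mem_insert, mem_filter, mem_Icc] at hi ⊢
    have := nbrs_subset_Icc h hN hw hi.1.1 hi.1.2 hi.2
    have h7 : i ≠ 5 := by rintro rfl; exact h5 hi.2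
    have h6 : i ≠ 4 := by rintro rfl; exact not_adj_four hl h hN hw hi.2
    by_cases h3 : i = 3
    · exact Or.inl h3
    · exact Or.inr ⟨hi.1, hi.2, by omega, by omega⟩
  have := card_insert_le 3 {i ∈ Icc 1 (2 * l + 3) | G.Adj w (v i) ∧ 6 ≤ i ∧ i ≤ 2 * l + 1}
  omega

/-- Degree `l` requires both `v 3` and `v 5` as neighbours. These exclude `v 4`, `v 6` and `v 7`,
and too few positions remain from `8` on. -/
lemma degIn_path_lt_of_three_le (h : IsPathSeq G v (2 * l + 3)) (hl : 3 ≤ l)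
    (hN : NoTwoPaths G (2 * l + 1))
    (hw : OffSeq v (2 * l + 3) w) : degIn G (segSet v 1 (2 * l + 3)) w < l := by
  by_cases h3 : G.Adj w (v 3)
  swap
  · exact degIn_path_lt_of_not_adj_three h (by omega) hN hw h3
  by_cases h5 : G.Adj w (v 5)
  swap
  · exact degIn_path_lt_of_not_adj_five h (by omega) hN hw h5
  have h1 := degIn_segSet_le (G := G) (v := v) 1 (2 * l + 3) w
  have h2 := two_mul_card_nbrs_le h hN hw (a := 8) (b := 2 * l + 1)
  have h4 : #{i ∈ Icc 1 (2 * l + 3) | G.Adj w (v i)} ≤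
      #(insert 3 (insert 5
        {i ∈ Icc 1 (2 * l + 3) | G.Adj w (v i) ∧ 8 ≤ i ∧ i ≤ 2 * l + 1})) := by
    refine card_le_card fun i hi => ?_
    simp only [mem_insert, mem_filter, mem_Icc] at hi ⊢
    have := nbrs_subset_Icc h hN hw hi.1.1 hi.1.2 hi.2
    have h6 : i ≠ 4 := by rintro rfl; exact not_adj_four (by omega) h hN hw hi.2
    have h7 : i ≠ 6 := by
      rintro rfl; exact not_adj_succ h hN hw (by omega) (by omega) h5 hi.2
    have h8 : i ≠ 7 := by
      rintro rfl; exact not_adj_add_four h hN hw (by omega) (by omega) h3 hi.2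
    by_cases h3 : i = 3
    · exact Or.inl h3
    by_cases h5 : i = 5
    · exact Or.inr (Or.inl h5)
    · exact Or.inr (Or.inr ⟨hi.1, hi.2, by omega, by omega⟩)
  have h9 := card_insert_le 5 {i ∈ Icc 1 (2 * l + 3) | G.Adj w (v i) ∧ 8 ≤ i ∧ i ≤ 2 * l + 1}
  have h10 := card_insert_le 3 (insert 5
    {i ∈ Icc 1 (2 * l + 3) | G.Adj w (v i) ∧ 8 ≤ i ∧ i ≤ 2 * l + 1})
  omega

lemma degIn_path_lt_of_adj (h : IsPathSeq G v (2 * l + 3)) (hl : 2 ≤ l)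
    (hN : NoTwoPaths G (2 * l + 1)) (hw : OffSeq v (2 * l + 3) w)
    (hw' : OffSeq v (2 * l + 3) w') (hww : G.Adj w w') :
    degIn G (segSet v 1 (2 * l + 3)) w < l :=
  degIn_path_lt_of_not_adj_five h hl hN hw (not_adj_five hl h hN hw hw' hww)

variable [Fintype V]

lemma degIn_outside_le_one (h : IsPathSeq G v (2 * l + 3)) (hN : NoTwoPaths G (2 * l + 1))
    (hw : OffSeq v (2 * l + 3) w) : degIn G (segSet v 1 (2 * l + 3))ᶜ w ≤ 1 := by
  rw [degIn, card_le_one]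
  intro a ha b hb
  simp only [mem_filter, mem_compl, ← offSeq_iff] at ha hb
  exact eq_of_adj_of_offSeq h hN hw ha.1 hb.1 ha.2 hb.2

lemma degIn_univ_eq (s : Finset V) (x : V) : degIn G univ x = degIn G s x + degIn G sᶜ x := by
  rw [← degIn_union disjoint_compl_right, union_compl]

/-- There is at most one neighbour off the path, and if there is one, `v 5` is excluded and the
degree into the path drops below `l`. -/
lemma degIn_univ_le (h : IsPathSeq G v (2 * l + 3)) (hl : 2 ≤ l)
    (hN : NoTwoPaths G (2 * l + 1)) (hw : OffSeq v (2 * l + 3) w) : degIn G univ w ≤ l := by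
  rw [degIn_univ_eq (segSet v 1 (2 * l + 3))]
  have h1 := degIn_outside_le_one h hN hw
  rcases Nat.eq_zero_or_pos (degIn G (segSet v 1 (2 * l + 3))ᶜ w) with h0 | h0
  · have := degIn_path_le h hN hw
    omega
  · obtain ⟨w', hw'⟩ := card_pos.1 h0
    simp only [mem_filter, mem_compl, ← offSeq_iff] at hw'
    have := degIn_path_lt_of_adj h hl hN hw hw'.1 hw'.2
    omega

end OutsideDegrees


/-! ### Few outside edges, or a `P_3` that is cheap to delete. -/

section Removal

variable {V : Type*} {G : SimpleGraph V} {v : ℕ → V} {l : ℕ}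

lemma pairs_union_of_independent {s t : Finset V} (hd : Disjoint s t)
    (h : ∀ x ∈ t, ∀ y ∈ t, ¬ G.Adj x y) :
    pairs G (s ∪ t) = pairs G s + 2 * ∑ x ∈ t, degIn G s x := by
  induction t using Finset.induction_on with
  | empty => simp
  | insert a t ha ih =>
    rw [disjoint_insert_right] at hd
    rw [union_insert, pairs_insert (by simp [hd.1, ha]), ih hd.2
      fun x hx y hy => h x (mem_insert_of_mem hx) y (mem_insert_of_mem hy), sum_insert ha,
      degIn_union hd.2]
    have : degIn G t a = 0 := by
      rw [degIn, card_eq_zero, filter_eq_empty_iff]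
      exact fun y hy => h a (mem_insert_self _ _) y (mem_insert_of_mem hy)
    omega

lemma degIn_erase_add_one_le {s : Finset V} {x y : V} (hy : y ∈ s) (hxy : G.Adj x y) :
    degIn G (s.erase y) x + 1 ≤ degIn G s x := by
  conv_rhs => rw [← insert_erase hy]
  rw [degIn_insert (notMem_erase _ _), if_pos hxy]

variable [Fintype V]

lemma pairs_univ_erase_three {a b c : V} (hab : a ≠ b) (hac : a ≠ c) (hbc : b ≠ c) :
    pairs G univ = pairs G (univ \ {a, b, c}) + 2 * (degIn G univ a + degIn G (univ.erase a) b +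
      degIn G ((univ.erase a).erase b) c) := by
  have : ((univ.erase a).erase b).erase c = univ \ {a, b, c} := by
    ext x; simp; tauto
  rw [pairs_erase (mem_univ a), pairs_erase (s := univ.erase a) (v := b) (by simp [hab.symm]),
    pairs_erase (s := (univ.erase a).erase b) (v := c) (by simp [hac.symm, hbc.symm]), this]
  omega

/-- The number of edges leaving the path is at most the number of path vertices with an outside
neighbour. Each of these forces its successor to be a non-neighbour of `v 1`, and the last one
forces one more, so `v 1` loses more edges than the outside contributes. -/
lemma pairs_univ_lt_of_independent (h : IsPathSeq G v (2 * l + 3))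
    (hN : NoTwoPaths G (2 * l + 1))
    (hind : ∀ w w', OffSeq v (2 * l + 3) w → OffSeq v (2 * l + 3) w' → ¬ G.Adj w w')
    (huniq : ∀ i, 1 ≤ i → i ≤ 2 * l + 3 → ∀ w w', OffSeq v (2 * l + 3) w →
      OffSeq v (2 * l + 3) w' → G.Adj w (v i) → G.Adj w' (v i) → w = w')
    (hex : ∃ w i, OffSeq v (2 * l + 3) w ∧ 1 ≤ i ∧ i ≤ 2 * l + 3 ∧ G.Adj w (v i)) :
    pairs G univ < (2 * l + 3) * (2 * l + 2) := by
  set P := segSet v 1 (2 * l + 3) with hP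
  have hPc : #P = 2 * l + 3 := by rw [h.card_segSet le_rfl le_rfl]; rfl
  set S : Finset ℕ :=
    {i ∈ Icc 1 (2 * l + 3) | ∃ w, OffSeq v (2 * l + 3) w ∧ G.Adj w (v i)} with hS
  have hSb : ∀ i ∈ S, 3 ≤ i ∧ i ≤ 2 * l + 1 := by
    intro i hi
    simp only [hS, mem_filter, mem_Icc] at hi
    obtain ⟨hi, w, hw, hadj⟩ := hi
    exact nbrs_subset_Icc h hN hw hi.1 hi.2 hadj
  have hSne : S.Nonempty := by
    obtain ⟨w, i, hw, h1, h2, hadj⟩ := hex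
    exact ⟨i, by simp only [hS, mem_filter, mem_Icc]; exact ⟨⟨h1, h2⟩, w, hw, hadj⟩⟩
  have hsum : ∑ w ∈ Pᶜ, degIn G P w ≤ #S := by
    refine (sum_le_sum fun w _ => degIn_segSet_le 1 (2 * l + 3) w).trans ?_
    rw [← card_biUnion]
    · refine card_le_card fun i hi => ?_
      simp only [mem_biUnion, mem_compl, mem_filter, hP, ← offSeq_iff] at hi
      obtain ⟨w, hw, hi, hadj⟩ := hi
      simp only [hS, mem_filter]
      exact ⟨hi, w, hw, hadj⟩
    · intro a ha b hb hab
      simp only [coe_compl, Set.mem_compl_iff, mem_coe, hP, ← offSeq_iff] at ha hb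
      rw [Function.onFun, disjoint_left]
      intro i hi hi'
      simp only [mem_filter, mem_Icc] at hi hi'
      exact hab (huniq i hi.1.1 hi.1.2 a b ha hb hi.2 hi'.2)
  obtain ⟨m, hm, hmax⟩ : ∃ m ∈ S, ∀ i ∈ S, i ≤ m := ⟨S.max' hSne, S.max'_mem _, S.le_max'⟩
  -- Positions not adjacent to `v 1`: itself, the successors of `S`, and `m + 2` for the last `m` in
  -- `S`. The extra `m + 2` makes the final inequality strict.
  set N : Finset ℕ := insert 1 (insert (m + 2) (S.image (· + 1))) with hNdef
  have hNc : #N = #S + 2 := by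
    rw [hNdef, card_insert_of_notMem, card_insert_of_notMem,
      card_image_of_injective _ (add_left_injective 1)]
    · simp only [mem_image, not_exists, not_and]
      intro i hi
      have := hmax i hi
      omega
    · simp only [mem_insert, mem_image, not_or, not_exists, not_and]
      refine ⟨by omega, fun i hi => ?_⟩
      have := hSb i hi
      omega
  have hNb : ∀ i ∈ N, 1 ≤ i ∧ i ≤ 2 * l + 3 := by
    intro i hi
    simp only [hNdef, mem_insert, mem_image] at hi
    rcases hi with rfl | rfl | ⟨j, hj, rfl⟩
    · omega
    · have := hSb m hm
      omega
    · have := hSb j hj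
      omega
  have hdeg : degIn G P (v 1) + (#S + 2) ≤ 2 * l + 3 := by
    rw [← hPc, ← hNc, ← card_image_of_injOn (s := N) (f := v)]
    · refine degIn_add_card_le ?_ ?_
      · intro x hx
        obtain ⟨i, hi, rfl⟩ := mem_image.1 hx
        exact mem_segSet.2 ⟨i, (hNb i hi).1, (hNb i hi).2, rfl⟩
      · intro x hx
        obtain ⟨i, hi, rfl⟩ := mem_image.1 hx
        simp only [hNdef, mem_insert, mem_image] at hi
        have key : ∀ j ∈ S, ∃ w, OffSeq v (2 * l + 3) w ∧ G.Adj w (v j) := fun j hj => by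
          simp only [hS, mem_filter] at hj
          exact hj.2
        rcases hi with rfl | rfl | ⟨j, hj, rfl⟩
        · exact G.irrefl
        · obtain ⟨w, hw, hadj⟩ := key m hm
          have := hSb m hm
          exact not_adj_one_add_two h hN hw (by omega) (by omega) hadj
        · obtain ⟨w, hw, hadj⟩ := key j hj
          have := hSb j hj
          exact not_adj_one_succ h hN hw (by omega) (by omega) hadj
    · intro i hi j hj hij
      exact h.inj i j (hNb i hi).1 (hNb i hi).2 (hNb j hj).1 (hNb j hj).2 hij
  have h1 : v 1 ∈ P := mem_segSet.2 ⟨1, le_rfl, by omega, rfl⟩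
  have h2 := pairs_erase (G := G) h1
  have h3 := pairs_le_clique (G := G) (P.erase (v 1))
  rw [card_erase_of_mem h1, hPc] at h3
  have h4 := pairs_union_of_independent (G := G) (s := P) (t := Pᶜ) disjoint_compl_right
    fun x hx y hy => hind x y (by simpa [hP, ← offSeq_iff] using hx)
      (by simpa [hP, ← offSeq_iff] using hy)
  rw [union_compl] at h4
  have h5 : (2 * l + 3 - 1) * (2 * l + 3 - 1 - 1) = (2 * l + 2) * (2 * l + 1) := rfl
  nlinarith

/-- The outside vertices have degree at most `l` and `v i` has at most `n - 3` neighbours besides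
`w` and `w'`, which bounds the edges by `n + 2l - 3`. One more must be saved: the edge `w w'` is
counted twice, or `w` has degree below `l`, or (only for `l = 2`) `v i` misses a path vertex. -/
lemma exists_removable (h : IsPathSeq G v (2 * l + 3)) (hl : 2 ≤ l)
    (hN : NoTwoPaths G (2 * l + 1)) (hG : G.Connected)
    (hT : (∃ w w', OffSeq v (2 * l + 3) w ∧ OffSeq v (2 * l + 3) w' ∧ G.Adj w w') ∨
      ∃ i w w', 1 ≤ i ∧ i ≤ 2 * l + 3 ∧ OffSeq v (2 * l + 3) w ∧ OffSeq v (2 * l + 3) w' ∧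
        G.Adj w (v i) ∧ G.Adj w' (v i) ∧ w ≠ w') :
    ∃ w w' i, OffSeq v (2 * l + 3) w ∧ OffSeq v (2 * l + 3) w' ∧ w ≠ w' ∧ 3 ≤ i ∧ i ≤ 2 * l + 1 ∧
      G.Adj w (v i) ∧ (∃ L, IsPathList G L ∧ L.length = 3 ∧ ∀ x ∈ L, x = w ∨ x = w' ∨ x = v i) ∧
      degIn G univ w + degIn G (univ.erase w) w' + degIn G ((univ.erase w).erase w') (v i) ≤
        Fintype.card V + 2 * l - 4 := by
  have hmem : ∀ {w w' : V} {i : ℕ}, 1 ≤ i → i ≤ 2 * l + 3 → OffSeq v (2 * l + 3) w →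
      OffSeq v (2 * l + 3) w' → v i ∈ (univ.erase w).erase w' := by
    intro w w' i h1 h2 hw hw'
    simp [hw i h1 h2, hw' i h1 h2]
  have hcard : ∀ {w w' : V}, w ≠ w' → #((univ.erase w).erase w') = Fintype.card V - 2 := by
    intro w w' hww
    rw [card_erase_of_mem (by simp [hww.symm]), card_erase_of_mem (mem_univ _), card_univ]
    omega
  have hVc : 2 * l + 3 ≤ Fintype.card V := by
    have := card_le_univ (segSet v 1 (2 * l + 3))
    rw [h.card_segSet le_rfl le_rfl] at this
    exact this
  by_cases hT' : ∃ w w', OffSeq v (2 * l + 3) w ∧ OffSeq v (2 * l + 3) w' ∧ G.Adj w w'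
  · have : ∃ w w' y, OffSeq v (2 * l + 3) w ∧ OffSeq v (2 * l + 3) w' ∧ G.Adj w w' ∧
        y ≠ w' ∧ G.Adj w y := by
      obtain ⟨w, w', hw, hw', hww⟩ := hT'
      obtain ⟨x, hx, y, hy, hxy⟩ := exists_adj_of_connected hG (s := {w, w'}) (by simp)
        (fun e => hw 1 le_rfl (by omega) <| by
          have : v 1 ∈ ({w, w'} : Finset V) := e ▸ mem_univ _
          simp only [mem_insert, mem_singleton] at this
          exact this.resolve_right (hw' 1 le_rfl (by omega)))
      simp only [mem_insert, mem_singleton, not_or] at hx hy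
      rcases hx with rfl | rfl
      · exact ⟨x, w', y, hw, hw', hww, hy.2, hxy⟩
      · exact ⟨x, w, y, hw', hw, hww.symm, hy.1, hxy⟩
    obtain ⟨w, w', y, hw, hw', hww, hy, hwy⟩ := this
    have hyP : ¬ OffSeq v (2 * l + 3) y := fun hyo =>
      hy (eq_of_adj_of_offSeq h hN hw hyo hw' hwy hww)
    rw [offSeq_iff, not_not, mem_segSet] at hyP
    obtain ⟨i, h1, h2, rfl⟩ := hyP
    have hi := nbrs_subset_Icc h hN hw h1 h2 hwy
    refine ⟨w, w', i, hw, hw', hww.ne, hi.1, hi.2, hwy, ⟨[w', w, v i],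
      isPathList_three hww.symm hwy (hw' i h1 h2).symm, rfl, by simp⟩, ?_⟩
    have e1 := degIn_univ_le h hl hN hw
    have e2 := degIn_univ_le h hl hN hw'
    have e3 := degIn_erase_add_one_le (mem_univ w) hww.symm
    have e4 := degIn_lt_card (G := G) (hmem h1 h2 hw hw')
    rw [hcard hww.ne] at e4
    omega
  · obtain ⟨i, w, w', h1, h2, hw, hw', hwi, hwi', hww⟩ := hT.resolve_left hT'
    push Not at hT'
    have hi := nbrs_subset_Icc h hN hw h1 h2 hwi
    refine ⟨w, w', i, hw, hw', hww, hi.1, hi.2, hwi, ⟨[w, v i, w'],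
      isPathList_three hwi hwi'.symm hww, rfl, by simp⟩, ?_⟩
    have e1 := degIn_univ_le h hl hN hw
    have e2 := degIn_univ_le h hl hN hw'
    have e3 := degIn_mono (G := G) (erase_subset w univ) w'
    have e4 := degIn_lt_card (G := G) (hmem h1 h2 hw hw')
    rw [hcard hww] at e4
    have e5 : degIn G univ w = degIn G (segSet v 1 (2 * l + 3)) w := by
      rw [degIn_univ_eq (segSet v 1 (2 * l + 3))]
      suffices degIn G (segSet v 1 (2 * l + 3))ᶜ w = 0 by omega
      rw [degIn, card_eq_zero, filter_eq_empty_iff]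
      intro x hx
      rw [mem_compl, ← offSeq_iff] at hx
      exact hT' w x hw hx
    by_cases hdl : degIn G univ w < l
    · omega
    rw [e5] at hdl
    obtain rfl : l = 2 := by
      by_contra hl3
      exact hdl (degIn_path_lt_of_three_le h (by omega) hN hw)
    have a3 : G.Adj w (v 3) := by
      by_contra hc
      exact hdl (degIn_path_lt_of_not_adj_three h le_rfl hN hw hc)
    have a5 : G.Adj w (v 5) := by
      by_contra hc
      exact hdl (degIn_path_lt_of_not_adj_five h le_rfl hN hw hc)
    have i4 : i ≠ 4 := by rintro rfl; exact not_adj_four le_rfl h hN hw hwi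
    -- With `w` adjacent to both `v 3` and `v 5`, the pairs `v 2, v 5` and, by reversal, `v 3, v 6`
    -- are nonadjacent.
    have key : ∃ j, 1 ≤ j ∧ j ≤ 7 ∧ j ≠ i ∧ ¬ G.Adj (v i) (v j) := by
      obtain rfl | rfl : i = 3 ∨ i = 5 := by omega
      · refine ⟨6, by omega, by omega, by omega, fun e => ?_⟩
        exact not_adj_two_five h.reverse hN hw.reverse a5 e.symm
      · refine ⟨2, by omega, by omega, by omega, fun e => ?_⟩
        exact not_adj_two_five h hN hw a3 e.symm
    obtain ⟨j, j1, j2, j3, j4⟩ := key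
    have e6 := degIn_add_card_le (G := G) (s := (univ.erase w).erase w') (N := {v i, v j})
      (v := v i) (by
        rw [insert_subset_iff, singleton_subset_iff]
        exact ⟨hmem h1 h2 hw hw', hmem j1 j2 hw hw'⟩) (by simp [j4])
    rw [hcard hww, card_pair fun e => j3 (h.inj _ _ j1 j2 h1 h2 e.symm)] at e6
    omega

end Removal


/-! ### Paths that separate at one vertex, and the strict bound. -/

section Split

variable {V : Type*} {G : SimpleGraph V} {v : ℕ → V} {l : ℕ}

/-- The bound for two sets covering `2l + 4` vertices in the split case. -/
lemma split_le_of_succ {x y l A B : ℕ} (hl : 3 ≤ l) (hx : 3 ≤ x) (hxy : x ≤ y)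
    (h : x + y = 2 * l + 4) (hA : A ≤ x * (x - 1))
    (hB : B ≤ (l + 2) * (l + 1) + 2 * (l + 1) * (y - (l + 2))) :
    A + B + 2 ≤ (l + 2) * (l + 1) + 2 * l * (l + 1) := by
  obtain ⟨k, rfl⟩ : ∃ k, l = x - 2 + k := ⟨l + 2 - x, by omega⟩
  obtain ⟨z, rfl⟩ := Nat.exists_eq_add_of_le hx
  obtain rfl : y = z + 3 + 2 * k := by omega
  rw [show 3 + z - 1 = z + 2 by omega] at hA
  rw [show z + 3 + 2 * k - (3 + z - 2 + k + 2) = k by omega] at hB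
  rw [show 3 + z - 2 = z + 1 by omega] at hB ⊢
  have : 2 ≤ z + k := by omega
  rcases Nat.eq_zero_or_pos k with rfl | hk
  · nlinarith
  · rcases Nat.eq_zero_or_pos z with rfl | hz
    · nlinarith
    · nlinarith

lemma split_le {x y l A B : ℕ} (hl : 3 ≤ l) (hx : 3 ≤ x) (hxy : l + 3 ≤ y)
    (h : x + y = 2 * l + 4) (hA : A ≤ x * (x - 1))
    (hB : B ≤ (l + 3) * (l + 2) + 2 * l * (y - (l + 3))) :
    A + B + 2 ≤ (l + 2) * (l + 1) + 2 * l * (l + 1) := by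
  obtain ⟨k, rfl⟩ : ∃ k, l = x - 1 + k := ⟨l + 1 - x, by omega⟩
  obtain ⟨z, rfl⟩ := Nat.exists_eq_add_of_le hx
  obtain rfl : y = z + 5 + 2 * k := by omega
  rw [show 3 + z - 1 = z + 2 by omega] at *
  rw [show z + 5 + 2 * k - (z + 2 + k + 3) = k by omega] at hB
  have : 1 ≤ z + k := by omega
  rcases Nat.eq_zero_or_pos k with rfl | hk
  · nlinarith
  · rcases Nat.eq_zero_or_pos z with rfl | hz
    · nlinarith
    · nlinarith

/-- No edge joins the two parts into which `v i` divides the path. -/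
def SplitsAt (G : SimpleGraph V) (v : ℕ → V) (p i : ℕ) : Prop :=
  ∀ a b, 1 ≤ a → a < i → i < b → b ≤ p → ¬ G.Adj (v a) (v b)

lemma SplitsAt.reverse {p i : ℕ} (h : SplitsAt G v p i) (hi : i ≤ p) :
    SplitsAt G (fun i => v (p + 1 - i)) p (p + 1 - i) := by
  intro a b h1 h2 h3 h4 hab
  exact h (p + 1 - b) (p + 1 - a) (by omega) (by omega) (by omega) (by omega) hab.symm

lemma pairs_of_splitsAt {p i : ℕ} (h : IsPathSeq G v p) (hi : 1 ≤ i) (hip : i ≤ p)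
    (hs : SplitsAt G v p i) :
    pairs G (segSet v 1 p) = pairs G (segSet v 1 i) + pairs G (segSet v i p) := by
  have e1 : segSet v 1 i = insert (v i) (segSet v 1 (i - 1)) := by
    rw [segSet, segSet, ← image_insert]
    congr 1
    ext x; simp; omega
  have e2 : segSet v i p = insert (v i) (segSet v (i + 1) p) := by
    rw [segSet, segSet, ← image_insert]
    congr 1
    ext x; simp; omega
  have e3 : segSet v 1 p = insert (v i) (segSet v 1 (i - 1) ∪ segSet v (i + 1) p) := by
    rw [segSet, segSet, segSet, ← image_union, ← image_insert]
    congr 1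
    ext x; simp; omega
  have n1 : v i ∉ segSet v 1 (i - 1) := by
    rw [h.mem_segSet_iff hi hip le_rfl (by omega)]
    omega
  have n2 : v i ∉ segSet v (i + 1) p := by
    rw [h.mem_segSet_iff hi hip (by omega) le_rfl]
    omega
  have hd : Disjoint (segSet v 1 (i - 1)) (segSet v (i + 1) p) := by
    rw [disjoint_left]
    intro x hx hx'
    obtain ⟨a, a1, a2, rfl⟩ := mem_segSet.1 hx
    rw [h.mem_segSet_iff a1 (by omega) (by omega) le_rfl] at hx'
    omega
  have hno : ∀ x ∈ segSet v 1 (i - 1), ∀ y ∈ segSet v (i + 1) p, ¬ G.Adj x y := by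
    intro x hx y hy
    obtain ⟨a, a1, a2, rfl⟩ := mem_segSet.1 hx
    obtain ⟨b, b1, b2, rfl⟩ := mem_segSet.1 hy
    exact hs a b a1 (by omega) (by omega) b2
  rw [e1, e2, e3, pairs_insert n1, pairs_insert n2, pairs_insert (by simp [n1, n2]),
    pairs_union_of_forall_not_adj hd hno, degIn_union hd]
  omega

variable [Fintype V]

lemma pairs_univ_le_path (h : IsPathSeq G v (2 * l + 3)) {q d : ℕ}
    (hV : Fintype.card V = 2 * l + 3 + q)
    (hd : ∀ w, OffSeq v (2 * l + 3) w → degIn G univ w ≤ d) :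
    pairs G univ ≤ pairs G (segSet v 1 (2 * l + 3)) + 2 * d * q := by
  have := pairs_union_le (G := G) (s := segSet v 1 (2 * l + 3)) (d := d)
    (disjoint_compl_right) (fun x hx => by
      rw [union_compl]
      exact hd x (by rwa [offSeq_iff, ← mem_compl]))
  rw [union_compl, card_compl, h.card_segSet le_rfl le_rfl, hV] at this
  convert this using 3
  omega

/-- The path's vertex set consists of two blocks sharing only `v i`, of sizes adding up to `2l + 4`.
The smaller is bounded by a clique, the larger by Kopylov's peeling with `t = l` or `t = l + 1` (or
by a clique if both have `l + 2` vertices). Each vertex off the path adds at most `l` edges, the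
same rate as in the join term. -/
lemma pairs_univ_lt_of_splitsAt (h : IsPathSeq G v (2 * l + 3)) (hl : 3 ≤ l)
    (hN : NoTwoPaths G (2 * l + 1)) (hG : G.Connected) {q : ℕ} (hq : 1 ≤ q)
    (hV : Fintype.card V = 2 * l + 3 + q) {i : ℕ} (hi : 3 ≤ i) (hi' : i ≤ 2 * l + 1)
    (hs : SplitsAt G v (2 * l + 3) i) :
    pairs G univ < max ((2 * l + 3) * (2 * l + 2) + 2 * (q / 2))
      ((l + 2) * (l + 1) + 2 * l * (2 * l + 3 + q - (l + 2))) := by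
  obtain ⟨t, Q, h1, h2, h3, h4⟩ := exists_degenOver hG (p := 2 * l + 3) (by omega)
    hN.not_hasPath (by omega)
  by_cases ht : t + 1 ≤ l
  · refine lt_of_le_of_lt ?_ (kopylov_lt_max h1 ht (by omega) rfl hq)
    have := h4.pairs_le (k := 2 * l + 3 - t) (T := univ) (by omega)
      (by rw [card_univ]; omega)
    rwa [card_univ, hV] at this
  rw [lt_max_iff]
  right
  have b1 := pairs_univ_le_path h hV fun w hw => degIn_univ_le h (by omega) hN hw
  rw [pairs_of_splitsAt h (by omega) (by omega) hs] at b1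
  obtain ⟨X, Y, hX, hXY, hc, hXYp⟩ : ∃ X Y : Finset V, 3 ≤ #X ∧ #X ≤ #Y ∧ #X + #Y = 2 * l + 4 ∧
      pairs G (segSet v 1 i) + pairs G (segSet v i (2 * l + 3)) = pairs G X + pairs G Y := by
    have c1 := h.card_segSet (a := 1) (b := i) le_rfl (by omega)
    have c2 := h.card_segSet (a := i) (b := 2 * l + 3) (by omega) le_rfl
    by_cases hc : #(segSet v 1 i) ≤ #(segSet v i (2 * l + 3))
    · exact ⟨_, _, by omega, hc, by omega, rfl⟩
    · exact ⟨_, _, by omega, (not_le.1 hc).le, by omega, add_comm _ _⟩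
  rw [hXYp] at b1
  have pX := pairs_le_clique (G := G) X
  have key : pairs G X + pairs G Y + 2 ≤ (l + 2) * (l + 1) + 2 * l * (l + 1) := by
    rcases (by omega : t = l + 1 ∨ t = l) with rfl | rfl
    · exact split_le_of_succ hl hX hXY hc pX
        (h4.pairs_le (k := l + 2) (T := Y) (by omega) (by omega))
    · by_cases hY : t + 3 ≤ #Y
      · exact split_le hl hX hY hc pX
          (h4.pairs_le (k := t + 3) (T := Y) (by omega) (by omega))
      · have pY := pairs_le_clique (G := G) Y
        obtain hY : #Y = t + 2 := by omega
        have hX : #X = t + 2 := by omega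
        rw [hY] at pY
        rw [hX] at pX
        simp only [show t + 2 - 1 = t + 1 by omega] at pX pY
        nlinarith
  have : 2 * l * (2 * l + 3 + q - (l + 2)) = 2 * l * (l + 1) + 2 * l * q := by
    rw [← mul_add]; congr 1; omega
  omega

/-- The case of a path with seven vertices. -/
lemma pairs_univ_lt_of_splitsAt_three (h : IsPathSeq G v 7)
    (hN : NoTwoPaths G 5) {q : ℕ} (hq : 1 ≤ q)
    (hV : Fintype.card V = 7 + q) (hs : SplitsAt G v 7 3) :
    pairs G univ < max (42 + 2 * (q / 2)) (12 + 4 * (7 + q - 4)) := by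
  have e := pairs_of_splitsAt h (by omega) (by omega) hs
  have p1 := pairs_le_clique (G := G) (segSet v 1 3)
  have p2 := pairs_le_clique (G := G) (segSet v 3 7)
  rw [h.card_segSet le_rfl (by omega)] at p1
  have c2 : #(segSet v 3 7) = 5 := h.card_segSet (by omega) le_rfl
  rw [c2] at p2
  -- The blocks have 3 and 5 vertices, so cliques give `6 + 20`, slightly too much. A neighbour of
  -- `v 5` off the path removes two edges at `v 7`; without one, every outside vertex has degree at
  -- most one.
  by_cases hz : ∃ z, OffSeq v 7 z ∧ G.Adj z (v 5)
  · obtain ⟨z, hz, hz5⟩ := hz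
    have n1 : ¬ G.Adj (v 7) (v 4) :=
      not_adj_one_succ (l := 2) h.reverse hN hz.reverse (i := 3) (by omega) (by omega) hz5
    have n2 : ¬ G.Adj (v 7) (v 3) :=
      not_adj_one_add_two (l := 2) h.reverse hN hz.reverse (i := 3) (by omega) (by omega) hz5
    have h7 : v 7 ∈ segSet v 3 7 := mem_segSet.2 ⟨7, by omega, le_rfl, rfl⟩
    have e2 := pairs_erase (G := G) h7
    have p3 := pairs_le_clique (G := G) ((segSet v 3 7).erase (v 7))
    rw [card_erase_of_mem h7, c2] at p3
    have e3 := degIn_add_card_le (G := G) (s := segSet v 3 7) (v := v 7)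
      (N := (({3, 4, 7} : Finset ℕ).image v)) (by
        intro x hx
        simp only [mem_image, mem_insert, mem_singleton] at hx
        obtain ⟨i, hi, rfl⟩ := hx
        exact mem_segSet.2 ⟨i, by omega, by omega, rfl⟩) (by simp [n1, n2])
    rw [card_image_of_injOn, c2] at e3
    · have b1 := pairs_univ_le_path (l := 2) h hV fun w hw => degIn_univ_le h le_rfl hN hw
      rw [show 2 * 2 + 3 = 7 from rfl] at b1
      simp at e3 p3 p1
      rw [lt_max_iff]
      omega
    · intro i hi j hj hij
      simp at hi hj
      exact h.inj i j (by omega) (by omega) (by omega) (by omega) hij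
  · push Not at hz
    have b1 := pairs_univ_le_path (l := 2) h hV (d := 1) fun w hw => by
      have a1 := degIn_outside_le_one (l := 2) h hN hw
      rw [degIn_univ_eq (segSet v 1 (2 * 2 + 3))]
      have a2 := degIn_path_lt_of_not_adj_five (l := 2) h le_rfl hN hw (hz w hw)
      by_cases h3 : G.Adj w (v 3)
      · suffices degIn G (segSet v 1 (2 * 2 + 3))ᶜ w = 0 by omega
        rw [degIn, card_eq_zero, filter_eq_empty_iff]
        intro x hx hwx
        rw [mem_compl, ← offSeq_iff] at hx
        exact not_adj_three_of_adj h hN hw hx hwx h3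
      · suffices degIn G (segSet v 1 (2 * 2 + 3)) w = 0 by omega
        rw [degIn, card_eq_zero, filter_eq_empty_iff]
        intro x hx hwx
        obtain ⟨i, i1, i2, rfl⟩ := mem_segSet.1 hx
        have := nbrs_subset_Icc (l := 2) h hN hw i1 i2 hwx
        obtain rfl | rfl | rfl : i = 3 ∨ i = 4 ∨ i = 5 := by omega
        · exact h3 hwx
        · exact not_adj_four (l := 2) le_rfl h hN hw hwx
        · exact hz w hw hwx
    rw [show 2 * 2 + 3 = 7 from rfl] at b1
    simp at p1
    rw [lt_max_iff]
    omega

/-- A connected graph without disjoint paths on `2l + 1` and `3` vertices that contains a path on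
`2l + 3` vertices and is not spanned by it has few edges. -/
theorem pairs_univ_lt_max (hl : 2 ≤ l) (hN : NoTwoPaths G (2 * l + 1)) (hG : G.Connected)
    (hp : HasPath G (2 * l + 3)) {q : ℕ} (hq : 1 ≤ q) (hV : Fintype.card V = 2 * l + 3 + q) :
    pairs G univ < max ((2 * l + 3) * (2 * l + 2) + 2 * (q / 2))
      ((l + 2) * (l + 1) + 2 * l * (2 * l + 3 + q - (l + 2))) := by
  obtain ⟨v, h⟩ := exists_isPathSeq hp (by omega)
  set P := segSet v 1 (2 * l + 3) with hP
  have hPc : #P = 2 * l + 3 := h.card_segSet le_rfl le_rfl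
  by_cases hT : (∃ w w', OffSeq v (2 * l + 3) w ∧ OffSeq v (2 * l + 3) w' ∧ G.Adj w w') ∨
      ∃ i w w', 1 ≤ i ∧ i ≤ 2 * l + 3 ∧ OffSeq v (2 * l + 3) w ∧ OffSeq v (2 * l + 3) w' ∧
        G.Adj w (v i) ∧ G.Adj w' (v i) ∧ w ≠ w'
  swap
  · push Not at hT
    have hne : P ≠ univ := fun e => by
      rw [e, card_univ] at hPc; omega
    obtain ⟨x, hx, w, hw, hxw⟩ := exists_adj_of_connected hG (card_pos.1 (by omega)) hne
    obtain ⟨i, i1, i2, rfl⟩ := mem_segSet.1 hx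
    have := pairs_univ_lt_of_independent h hN hT.1
      (fun i h1 h2 w w' hw hw' a1 a2 => hT.2 i w w' h1 h2 hw hw' a1 a2)
      ⟨w, i, offSeq_iff.2 hw, i1, i2, hxw.symm⟩
    rw [lt_max_iff]
    omega
  obtain ⟨w, w', i, hw, hw', hww, hi, hi', hwi, ⟨L, hL, hLl, hLm⟩, hdeg⟩ :=
    exists_removable h hl hN hG hT
  have e1 := pairs_univ_erase_three (G := G) hww (hw i (by omega) (by omega)).symm
    (hw' i (by omega) (by omega)).symm
  rw [hV] at hdeg
  set U : Finset V := univ \ {w, w', v i} with hU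
  have hmemU : ∀ j, 1 ≤ j → j ≤ 2 * l + 3 → j ≠ i → v j ∈ U := by
    intro j j1 j2 hj
    simp only [hU, mem_sdiff, mem_univ, mem_insert, mem_singleton, true_and, not_or]
    exact ⟨hw j j1 j2, hw' j j1 j2, fun e => hj (h.inj j i j1 j2 (by omega) (by omega) e)⟩
  obtain ⟨C, hCU, h1C, hCc, hCno⟩ := exists_component (G := G) U (hmemU 1 le_rfl (by omega)
    (by omega))
  have hUc : #U = 2 * l + q := by
    rw [hU, card_sdiff_of_subset (subset_univ _), card_univ, hV, card_insert_of_notMem,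
      card_insert_of_notMem, card_singleton]
    · omega
    · simpa using (hw' i (by omega) (by omega)).symm
    · simpa [hww] using (hw i (by omega) (by omega)).symm
  have hstep : ∀ j, 1 ≤ j → j < 2 * l + 3 → j ≠ i → j + 1 ≠ i → (v j ∈ C ↔ v (j + 1) ∈ C) := by
    intro j j1 j2 j3 j4
    have hadj := h.adj j j1 j2
    constructor
    · intro hj
      by_contra hc
      exact hCno _ hj _ (mem_sdiff.2 ⟨hmemU (j + 1) (by omega) (by omega) j4, hc⟩) hadj
    · intro hj
      by_contra hc
      exact hCno _ hj _ (mem_sdiff.2 ⟨hmemU j (by omega) (by omega) j3, hc⟩) hadj.symm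
  have hleft : ∀ a, 1 ≤ a → a < i → v a ∈ C := by
    intro a h1 h2
    induction a, h1 using Nat.le_induction with
    | base => exact h1C
    | succ n hn ih => exact (hstep n hn (by omega) (by omega) (by omega)).1 (ih (by omega))
  have hright : ∀ b, i + 1 ≤ b → b ≤ 2 * l + 3 → (v b ∈ C ↔ v (i + 1) ∈ C) := by
    intro b h1 h2
    induction b, h1 using Nat.le_induction with
    | base => rfl
    | succ n hn ih =>
      exact (hstep n (by omega) (by omega) (by omega) (by omega)).symm.trans (ih (by omega))
  -- If both halves of the path lie in one component `C` after the deletion, then `C` has at least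
  -- `2l + 2` vertices and no path on `2l + 1`, since the deleted vertices carry a `P_3`; vertices
  -- of `U` outside `C` have degree at most one in `U`. Otherwise the path splits at `v i`.
  by_cases hR : v (i + 1) ∈ C
  · have hPC : P.erase (v i) ⊆ C := by
      intro x hx
      obtain ⟨hxi, hx⟩ := mem_erase.1 hx
      obtain ⟨j, j1, j2, rfl⟩ := mem_segSet.1 hx
      rcases lt_trichotomy j i with hj | rfl | hj
      · exact hleft j j1 hj
      · exact absurd rfl hxi
      · exact (hright j hj j2).2 hR
    have hCcard : 2 * l + 2 ≤ #C := by
      have := card_le_card hPC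
      rw [card_erase_of_mem (mem_segSet.2 ⟨i, by omega, by omega, rfl⟩), hPc] at this
      omega
    have hCp : ¬ HasPath (G.induce (C : Set V)) (2 * l + 1) := by
      rintro ⟨M, hM, hMl⟩
      refine hN (M.map Subtype.val) L ⟨?_, hM.2.map Subtype.val_injective⟩ hL ?_ (by simpa)
        (by omega)
      · rw [List.isChain_map]
        exact hM.1
      · intro x hx hx'
        obtain ⟨⟨y, hy⟩, -, rfl⟩ := List.mem_map.1 hx
        have := hCU hy
        simp only [hU, mem_sdiff, mem_univ, mem_insert, mem_singleton, true_and] at this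
        exact this (hLm _ hx')
    obtain ⟨t, t1, t2, t3⟩ := pairs_le_of_connected hCc (p := 2 * l) (by omega) hCp (by omega)
    refine lt_of_le_of_lt ?_ (kopylov_add_lt_max t1 (by omega) hl rfl hq)
    have e2 := pairs_union_le (G := G) (s := C) (t := U \ C) (d := 1) disjoint_sdiff ?_
    · rw [union_sdiff_of_subset hCU, card_sdiff_of_subset hCU] at e2
      obtain ⟨r, hr⟩ := Nat.exists_eq_add_of_le (card_le_card hCU)
      have e3 : 2 * t * (2 * l + 3 + q - 3 - (2 * l - t)) =
          2 * t * (#C - (2 * l - t)) + 2 * t * r := by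
        rw [← mul_add]; congr 1; omega
      have e4 : r ≤ t * r := Nat.le_mul_of_pos_left _ t1
      have e5 : 2 * t * r = 2 * (t * r) := mul_assoc _ _ _
      have e6 : 2 * 1 * (#U - #C) = 2 * r := by omega
      omega
    · intro x hx
      rw [union_sdiff_of_subset hCU]
      obtain ⟨hxU, hxC⟩ := mem_sdiff.1 hx
      have hxP : OffSeq v (2 * l + 3) x := by
        rw [offSeq_iff]
        intro hxP
        refine hxC (hPC (mem_erase.2 ⟨?_, hxP⟩))
        rintro rfl
        simp [hU] at hxU
      refine (card_le_card fun y hy => ?_).trans (degIn_outside_le_one h hN hxP)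
      simp only [mem_filter, mem_compl] at hy ⊢
      refine ⟨fun hyP => ?_, hy.2⟩
      refine hCno y (hPC (mem_erase.2 ⟨?_, hyP⟩)) x (mem_sdiff.2 ⟨hxU, hxC⟩) hy.2.symm
      rintro rfl
      simp [hU] at hy
  · have hs : SplitsAt G v (2 * l + 3) i := by
      intro a b a1 a2 b1 b2 hab
      exact hCno _ (hleft a a1 a2) _ (mem_sdiff.2 ⟨hmemU b (by omega) b2 (by omega),
        fun hb => hR ((hright b b1 b2).1 hb)⟩) hab
    rcases hl.lt_or_eq with hl3 | rfl
    · exact pairs_univ_lt_of_splitsAt h hl3 hN hG hq hV hi hi' hs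
    · have h4 : i ≠ 4 := by rintro rfl; exact not_adj_four le_rfl h hN hw hwi
      obtain rfl | rfl : i = 3 ∨ i = 5 := by omega
      · exact pairs_univ_lt_of_splitsAt_three h hN hq hV hs
      · exact pairs_univ_lt_of_splitsAt_three h.reverse hN hq hV (hs.reverse (by omega))

end Split


/-! ### The upper bound for graphs that contain `P_{2l+1}`. -/

section Bound

variable {V : Type*} {G : SimpleGraph V} {l : ℕ}

/-- Twice the number of edges of `K_{2l+3} ∪ M_{n-2l-3}`. -/
def cliqueMatchingPairs (l n : ℕ) : ℕ := (2 * l + 3) * (2 * l + 2) + 2 * ((n - (2 * l + 3)) / 2)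

/-- Twice the number of edges of `K_l + (K_2 ∪ \bar K_{n-l-2})`. -/
def joinEdgePairs (l n : ℕ) : ℕ := (l + 2) * (l + 1) + 2 * l * (n - (l + 2))

/-- The structure of `K_{2l+3} ∪ M_{n-2l-3}`: a clique `C` without edges to its complement, whose
complement is a maximum matching. -/
structure IsCliqueMatching [Fintype V] (G : SimpleGraph V) (C : Finset V) : Prop where
  clique : ∀ x ∈ C, ∀ y ∈ C, x ≠ y → G.Adj x y
  not_adj : ∀ x ∈ C, ∀ y ∉ C, ¬ G.Adj x y
  degIn_le : ∀ x ∉ C, degIn G Cᶜ x ≤ 1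
  pairs_eq : pairs G Cᶜ = 2 * (#Cᶜ / 2)

lemma pairs_mod_two (s : Finset V) : pairs G s % 2 = 0 := by
  induction s using Finset.induction_on with
  | empty => simp
  | insert a s ha ih => rw [pairs_insert ha]; omega

lemma pairs_le_of_degIn_le_one {s : Finset V} (h : ∀ x ∈ s, degIn G s x ≤ 1) :
    pairs G s ≤ 2 * (#s / 2) := by
  have h1 : pairs G s ≤ #s := by
    unfold pairs
    simpa using sum_le_card_nsmul s (degIn G s) 1 h
  have := pairs_mod_two (G := G) s
  omega

lemma NoTwoPaths.induce {k : ℕ} (h : NoTwoPaths G k) (s : Set V) :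
    NoTwoPaths (G.induce s) k := by
  have key : ∀ L, IsPathList (G.induce s) L → IsPathList G (L.map Subtype.val) := by
    refine fun L hL => ⟨?_, hL.2.map Subtype.val_injective⟩
    rw [List.isChain_map]
    exact hL.1
  intro L L' hL hL' hd h1 h2
  refine h _ _ (key L hL) (key L' hL') ?_ (by simpa) (by simpa)
  intro x hx hx'
  obtain ⟨y, hy, rfl⟩ := List.mem_map.1 hx
  obtain ⟨z, hz, e⟩ := List.mem_map.1 hx'
  obtain rfl := Subtype.val_injective e
  exact hd hy hz

variable [Fintype V]

/-- Kopylov with `p = 2l + 2` gives `t ≤ l`. For `t < l` the bound is below that for `p = 2l + 3`,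
which is already strict; for `t = l` it is the join term itself. -/
lemma pairs_univ_le_of_not_hasPath (hl : 2 ≤ l) (hG : G.Connected)
    (hp : ¬ HasPath G (2 * l + 3)) (hV : 2 * l + 4 ≤ Fintype.card V) :
    pairs G univ < max (cliqueMatchingPairs l (Fintype.card V))
        (joinEdgePairs l (Fintype.card V)) ∨
      pairs G univ ≤ joinEdgePairs l (Fintype.card V) ∧
        (joinEdgePairs l (Fintype.card V) ≤ pairs G univ →
          ∃ A x y, #A = l ∧ IsJoinEdge G univ A x y) := by
  obtain ⟨t, Q, h1, h2, h3, h4⟩ := exists_degenOver hG (p := 2 * l + 2) (by omega) hp (by omega)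
  obtain ⟨q, hq⟩ := Nat.exists_eq_add_of_le (show 2 * l + 3 ≤ Fintype.card V by omega)
  by_cases ht : t + 1 ≤ l
  · left
    have e1 := kopylov_lt_max h1 ht hl hq (by omega)
    have e2 := h4.pairs_le (k := 2 * l + 2 - t) (T := univ) (by omega) (by rw [card_univ]; omega)
    rw [card_univ] at e2
    simp only [cliqueMatchingPairs, joinEdgePairs]
    rw [show (Fintype.card V - (2 * l + 3)) = q by omega]
    refine lt_of_le_of_lt (e2.trans ?_) e1
    obtain ⟨u, rfl⟩ := Nat.exists_eq_add_of_le ht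
    rw [hq, show 2 * (t + 1 + u) + 2 - t = t + 2 * u + 4 by omega,
      show 2 * (t + 1 + u) + 3 - t = t + 2 * u + 5 by omega,
      show t + 2 * u + 4 - 1 = t + 2 * u + 3 by omega,
      show t + 2 * u + 5 - 1 = t + 2 * u + 4 by omega,
      show 2 * (t + 1 + u) + 3 + q - (t + 2 * u + 4) = t + q + 1 by omega,
      show 2 * (t + 1 + u) + 3 + q - (t + 2 * u + 5) = t + q by omega]
    nlinarith
  · right
    obtain rfl : t = l := by omega
    constructor
    · have := h4.pairs_le (k := t + 2) (T := univ) (by omega) (by rw [card_univ]; omega)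
      rwa [card_univ] at this
    · intro h
      exact exists_isJoinEdge (by omega) hp (by omega) h4 (by rw [card_univ]; omega)
        (by rwa [card_univ])

/-- The bound for connected graphs. -/
lemma pairs_univ_le_of_connected (hl : 2 ≤ l) (hG : G.Connected)
    (hN : NoTwoPaths G (2 * l + 1)) (hV : 2 * l + 4 ≤ Fintype.card V) :
    pairs G univ < max (cliqueMatchingPairs l (Fintype.card V))
        (joinEdgePairs l (Fintype.card V)) ∨
      pairs G univ ≤ joinEdgePairs l (Fintype.card V) ∧
        (joinEdgePairs l (Fintype.card V) ≤ pairs G univ →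
          ∃ A x y, #A = l ∧ IsJoinEdge G univ A x y) := by
  by_cases hp : HasPath G (2 * l + 3)
  · left
    obtain ⟨q, hq⟩ := Nat.exists_eq_add_of_le (show 2 * l + 3 ≤ Fintype.card V by omega)
    have := pairs_univ_lt_max hl hN hG hp (by omega) hq
    simp only [cliqueMatchingPairs, joinEdgePairs]
    rwa [hq, Nat.add_sub_cancel_left]
  · exact pairs_univ_le_of_not_hasPath hl hG hp hV

/-- Outside the component of the path no vertex has two neighbours, since these would form a `P_3`
disjoint from the path. -/
lemma exists_path_component {k : ℕ} (hk : 1 ≤ k) (hp : HasPath G k) (hN : NoTwoPaths G k) :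
    ∃ C : Finset V, k ≤ #C ∧ (G.induce (C : Set V)).Connected ∧
      (∀ x ∈ C, ∀ y ∉ C, ¬ G.Adj x y) ∧ ∀ x ∉ C, degIn G Cᶜ x ≤ 1 := by
  obtain ⟨L, hL, hLk⟩ := hp
  obtain ⟨x, M, rfl⟩ : ∃ x M, L = x :: M := by
    cases L with
    | nil => simp at hLk; omega
    | cons x M => exact ⟨x, M, rfl⟩
  obtain ⟨C, -, hxC, hC, hno⟩ := exists_component (G := G) univ (mem_univ x)
  have hno' : ∀ x ∈ C, ∀ y ∉ C, ¬ G.Adj x y := fun a ha b hb => hno a ha b (by simpa using hb)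
  have hLC : ∀ y ∈ x :: M, y ∈ C := by
    intro y hy
    obtain ⟨i, hi, rfl⟩ := List.getElem_of_mem hy
    induction i with
    | zero => exact hxC
    | succ i ih =>
      have := List.isChain_iff_getElem.1 hL.1 i hi
      by_contra hc
      exact hno' _ (ih (by omega) (List.getElem_mem _)) _ hc this
  refine ⟨C, ?_, hC, hno', fun a ha => ?_⟩
  · rw [← List.toFinset_card_of_nodup hL.2] at hLk
    exact hLk.trans (card_le_card fun y hy => hLC y (List.mem_toFinset.1 hy))
  · rw [degIn, card_le_one]
    intro b hb c hc
    simp only [mem_filter, mem_compl] at hb hc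
    by_contra hbc
    refine hN _ [b, a, c] hL (isPathList_three hb.2.symm hc.2 hbc) ?_ hLk (by simp)
    simp only [List.disjoint_cons_right]
    exact ⟨fun h => hb.1 (hLC _ h), fun h => ha (hLC _ h), fun h => hc.1 (hLC _ h), by simp⟩

/-- The bound for graphs containing the longer path. -/
theorem pairs_univ_le_max (hl : 2 ≤ l) (hN : NoTwoPaths G (2 * l + 1))
    (hp : HasPath G (2 * l + 1)) (hV : 2 * l + 4 ≤ Fintype.card V) :
    pairs G univ < max (cliqueMatchingPairs l (Fintype.card V))
        (joinEdgePairs l (Fintype.card V)) ∨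
      (pairs G univ = cliqueMatchingPairs l (Fintype.card V) ∧
        ∃ C, #C = 2 * l + 3 ∧ IsCliqueMatching G C) ∨
      (pairs G univ = joinEdgePairs l (Fintype.card V) ∧
        ∃ A x y, #A = l ∧ IsJoinEdge G univ A x y) := by
  obtain ⟨C, hk, hC, hno, hdeg⟩ := exists_path_component (by omega) hp hN
  have e1 := pairs_union_of_forall_not_adj (G := G) (s := C) (t := Cᶜ) disjoint_compl_right
    fun x hx y hy => hno x hx y (mem_compl.1 hy)
  rw [union_compl] at e1
  have e2 := pairs_le_of_degIn_le_one (G := G) (s := Cᶜ) fun x hx => hdeg x (mem_compl.1 hx)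
  have hcc : #Cᶜ = Fintype.card V - #C := card_compl C
  have hcV := card_le_univ C
  have e3 := pairs_le_clique (G := G) C
  by_cases hc : #C ≤ 2 * l + 3
  · have hlt : #C < 2 * l + 3 → pairs G univ < cliqueMatchingPairs l (Fintype.card V) := by
      intro hc'
      unfold cliqueMatchingPairs
      rcases (by omega : #C = 2 * l + 1 ∨ #C = 2 * l + 2) with h | h
      · rw [h, Nat.add_sub_cancel] at e3
        nlinarith [show #Cᶜ / 2 ≤ (Fintype.card V - (2 * l + 3)) / 2 + 1 by omega]
      · rw [h, show 2 * l + 2 - 1 = 2 * l + 1 by omega] at e3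
        nlinarith [show #Cᶜ / 2 ≤ (Fintype.card V - (2 * l + 3)) / 2 + 1 by omega]
    rcases hc.lt_or_eq with h | h
    · exact Or.inl (lt_max_of_lt_left (hlt h))
    · by_cases heq : pairs G univ < cliqueMatchingPairs l (Fintype.card V)
      · exact Or.inl (lt_max_of_lt_left heq)
      · refine Or.inr (Or.inl ?_)
        have e4 : #C * (#C - 1) = (2 * l + 3) * (2 * l + 2) := by rw [h]; rfl
        have e5 : #Cᶜ = Fintype.card V - (2 * l + 3) := by omega
        unfold cliqueMatchingPairs at heq ⊢
        rw [e5] at e2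
        have e6 : pairs G Cᶜ = 2 * (#Cᶜ / 2) := by rw [e5]; omega
        have e7 : #C * (#C - 1) ≤ pairs G C := by omega
        exact ⟨by omega, C, h, clique_of_le_pairs e7, hno, hdeg, e6⟩
  · have hCcard : Fintype.card (C : Set V) = #C := by simp
    have hC4 : 2 * l + 4 ≤ Fintype.card (C : Set V) := by rw [hCcard]; omega
    obtain ⟨r, hr⟩ := Nat.exists_eq_add_of_le hcV
    have hrc : #Cᶜ = r := by omega
    rw [hrc] at e2
    -- The `r` vertices outside `C` add at most `r` to `pairs`, but `2lr` to the join term. Equality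
    -- therefore forces `r = 0`.
    have e4 : joinEdgePairs l (Fintype.card V) = joinEdgePairs l #C + 2 * l * r := by
      unfold joinEdgePairs
      rw [hr, add_assoc, ← mul_add]
      congr 2; omega
    have e5 : 2 * r ≤ l * r := Nat.mul_le_mul_right _ hl
    rw [show 2 * l * r = 2 * (l * r) from mul_assoc _ _ _] at e4
    have key := pairs_univ_le_of_connected hl hC (hN.induce _) hC4
    rw [hCcard, pairs_induce] at key
    rcases key with key | ⟨key, hkey⟩
    · left
      rw [lt_max_iff] at key ⊢
      refine key.imp (fun key => ?_) (fun key => ?_)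
      · unfold cliqueMatchingPairs at key ⊢
        omega
      · omega
    · by_cases heq : pairs G univ < joinEdgePairs l (Fintype.card V)
      · exact Or.inl (lt_max_of_lt_right heq)
      · refine Or.inr (Or.inr ?_)
        obtain rfl : r = 0 := by clear hkey; omega
        have hCu : C = univ := (card_eq_iff_eq_univ C).1 hr.symm
        have hle : joinEdgePairs l #C ≤ pairs G C := by clear hkey; omega
        obtain ⟨A, x, y, hA, hJ⟩ := hkey hle
        clear hkey
        refine ⟨by omega, ?_⟩
        have := hJ.map (SimpleGraph.Embedding.induce (C : Set V))
        rw [map_induce_univ] at this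
        have h : ∃ A x y, #A = l ∧ IsJoinEdge G C A x y := ⟨_, _, _, by rw [card_map, hA], this⟩
        rwa [hCu] at h

end Bound


/-! ### From subgraph containment to path lists. -/

section Containment

variable {V : Type*} {G : SimpleGraph V}

lemma isPathList_ofFn {k : ℕ} (f : Fin k → V) (hf : Function.Injective f)
    (h : ∀ a b, (SimpleGraph.pathGraph k).Adj a b → G.Adj (f a) (f b)) :
    IsPathList G (List.ofFn f) := by
  refine ⟨?_, List.nodup_ofFn.2 hf⟩
  rw [List.isChain_iff_getElem]
  intro i hi
  simp only [List.length_ofFn] at hi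
  simp only [List.getElem_ofFn]
  exact h _ _ (SimpleGraph.pathGraph_adj.2 (Or.inl rfl))

lemma IsPathList.adj_getElem {L : List V} (hL : IsPathList G L) {k : ℕ} (hk : k ≤ L.length)
    {a b : Fin k} (h : (SimpleGraph.pathGraph k).Adj a b) :
    G.Adj (L[a.1]'(a.2.trans_le hk)) (L[b.1]'(b.2.trans_le hk)) := by
  have key := List.isChain_iff_getElem.1 hL.1
  rcases SimpleGraph.pathGraph_adj.1 h with h | h
  · have := key a.1 (by have := b.2; omega)
    simpa only [h] using this
  · have := key b.1 (by have := a.2; omega)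
    simpa only [h] using this.symm

lemma pathGraph_isContained_iff {k : ℕ} :
    (SimpleGraph.pathGraph k).IsContained G ↔ HasPath G k := by
  constructor
  · rintro ⟨f⟩
    exact ⟨List.ofFn f, isPathList_ofFn f f.injective fun a b h => f.toHom.map_adj h, by simp⟩
  · rintro ⟨L, hL, hk⟩
    refine ⟨⟨⟨fun a => L[a.1]'(a.2.trans_le hk), fun h => hL.adj_getElem hk h⟩, ?_⟩⟩
    intro a b hab
    exact Fin.ext ((hL.2.getElem_inj_iff).1 hab)

lemma twoPaths_free_iff {l : ℕ} : (twoPaths l).Free G ↔ NoTwoPaths G (2 * l + 1) := by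
  constructor
  · intro h L L' hL hL' hd hk hk'
    refine h ⟨⟨⟨Sum.elim (fun a => L[a.1]'(a.2.trans_le hk))
      (fun a => L'[a.1]'(a.2.trans_le hk')), ?_⟩, ?_⟩⟩
    · rintro (a | a) (b | b) hab
      · exact hL.adj_getElem hk hab
      · simp at hab
      · simp at hab
      · exact hL'.adj_getElem hk' hab
    · rintro (a | a) (b | b) hab
      · exact congrArg Sum.inl (Fin.ext ((hL.2.getElem_inj_iff).1 hab))
      · exact (hd (List.getElem_mem (a.2.trans_le hk))
          (by rw [show L[a.1] = L'[b.1] from hab]; exact List.getElem_mem _)).elim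
      · exact (hd (List.getElem_mem (b.2.trans_le hk))
          (by
            have e : L'[a.1] = L[b.1] := hab
            rw [← e]; exact List.getElem_mem _)).elim
      · exact congrArg Sum.inr (Fin.ext ((hL'.2.getElem_inj_iff).1 hab))
  · rintro h ⟨f⟩
    refine h (List.ofFn fun a => f (Sum.inl a)) (List.ofFn fun a => f (Sum.inr a))
      (isPathList_ofFn _ (f.injective.comp Sum.inl_injective) fun a b hab => f.toHom.map_adj ?_)
      (isPathList_ofFn _ (f.injective.comp Sum.inr_injective) fun a b hab => f.toHom.map_adj ?_)
      ?_ (by simp) (by simp)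
    · exact hab
    · exact hab
    · intro x hx hx'
      rw [List.mem_ofFn] at hx hx'
      obtain ⟨a, rfl⟩ := hx
      obtain ⟨b, hb⟩ := hx'
      simpa using f.injective hb

end Containment

/-! ### Disjoint cliques as extremal examples for a single path. -/

section Blocks

/-- Consecutive blocks of `m` natural numbers form cliques. -/
def blockGraph (m : ℕ) : SimpleGraph ℕ where
  Adj i j := i ≠ j ∧ i / m = j / m
  symm := ⟨fun _ _ h => ⟨h.1.symm, h.2.symm⟩⟩
  loopless := ⟨fun _ h => h.1 rfl⟩

lemma degIn_blockGraph {m : ℕ} (hm : 0 < m) (n : ℕ) : degIn (blockGraph m) (range n) n = n % m := by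
  have : {y ∈ range n | (blockGraph m).Adj n y} = Ico (n / m * m) n := by
    ext y
    simp only [mem_filter, mem_range, mem_Ico]
    constructor
    · rintro ⟨h1, h2, h3⟩
      rw [h3]
      exact ⟨Nat.div_mul_le_self y m, h1⟩
    · rintro ⟨h1, h2⟩
      exact ⟨h2, h2.ne', le_antisymm ((Nat.le_div_iff_mul_le hm).2 h1) (Nat.div_le_div_right h2.le)⟩
  rw [degIn, this, Nat.card_Ico]
  have := Nat.div_add_mod n m
  rw [mul_comm] at this
  omega

/-- The vertex `n` joins a block that already holds the `n % m` preceding vertices, or opens a new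
one. -/
lemma cliquesPairs_succ {m : ℕ} (hm : 0 < m) (n : ℕ) :
    cliquesPairs m (n + 1) = cliquesPairs m n + 2 * (n % m) := by
  unfold cliquesPairs
  have hlt := Nat.mod_lt n hm
  rw [Nat.succ_div, Nat.add_mod_eq_ite]
  rcases Nat.lt_or_ge (n % m + 1) m with h | h
  · have h1 : 1 % m = 1 := Nat.mod_eq_of_lt (by omega)
    have h2 : ¬ m ∣ n + 1 := by
      rw [Nat.dvd_iff_mod_eq_zero, Nat.add_mod, h1, Nat.mod_eq_of_lt h]
      omega
    rw [h1, if_neg h2, if_neg (by omega)]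
    generalize n % m = r
    cases r with
    | zero => simp
    | succ r => simp only [Nat.add_sub_cancel]; ring
  · have h2 : m ∣ n + 1 := by
      rw [Nat.dvd_iff_mod_eq_zero, ← Nat.mod_add_mod, show n % m + 1 = m by omega, Nat.mod_self]
    have h3 : m = 1 ∨ 1 % m = 1 := by
      by_cases h : m = 1
      · exact Or.inl h
      · exact Or.inr (Nat.mod_eq_of_lt (by omega))
    rcases h3 with rfl | h3
    · simp [Nat.mod_one]
    · rw [h3, if_pos h2, if_pos h, show n % m = m - 1 by omega]
      obtain ⟨k, rfl⟩ : ∃ k, m = k + 2 := ⟨m - 2, by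
        have : m ≠ 1 := by rintro rfl; simp at h3
        omega⟩
      rw [show k + 2 - 1 = k + 1 by omega, show k + 1 - 1 = k by omega,
        show k + 1 + 1 - (k + 2) = 0 by omega]
      ring

lemma pairs_blockGraph {m : ℕ} (hm : 0 < m) (n : ℕ) :
    pairs (blockGraph m) (range n) = cliquesPairs m n := by
  induction n with
  | zero => simp [cliquesPairs]
  | succ n ih =>
    rw [cliquesPairs_succ hm, ← ih, ← degIn_blockGraph hm n, ← pairs_insert notMem_range_self]
    congr 1
    ext x
    simp only [mem_insert, mem_range]
    omega

lemma not_hasPath_blockGraph {m : ℕ} (hm : 0 < m) : ¬ HasPath (blockGraph m) (m + 1) := by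
  rintro ⟨L, hL, hk⟩
  have key : ∀ L : List ℕ, L.IsChain (blockGraph m).Adj → ∃ c, ∀ x ∈ L, x / m = c := by
    intro L hL
    induction L with
    | nil => exact ⟨0, by simp⟩
    | cons a M ih =>
      cases M with
      | nil => exact ⟨a / m, by simp⟩
      | cons b M =>
        rw [List.isChain_cons_cons] at hL
        obtain ⟨c, hc⟩ := ih hL.2
        refine ⟨c, ?_⟩
        rw [List.forall_mem_cons]
        exact ⟨hL.1.2.trans (hc b (by simp)), hc⟩
  obtain ⟨c, hc⟩ := key L hL.1
  have hsub : L.toFinset ⊆ Ico (c * m) (c * m + m) := by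
    intro x hx
    have := hc x (List.mem_toFinset.1 hx)
    rw [mem_Ico, ← this]
    refine ⟨Nat.div_mul_le_self x m, ?_⟩
    have h1 := Nat.div_add_mod x m
    have h2 := Nat.mod_lt x hm
    rw [mul_comm] at h1
    omega
  have := card_le_card hsub
  rw [List.toFinset_card_of_nodup hL.2, Nat.card_Ico] at this
  omega

lemma pairs_univ_of_embedding {n : ℕ} {G : SimpleGraph (Fin n)} {G' : SimpleGraph ℕ}
    (f : G ↪g G') (hf : ∀ i, f i = i) : pairs G univ = pairs G' (range n) := by
  rw [← pairs_map f]
  congr 1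
  ext x
  simp only [mem_map, mem_univ, true_and, mem_range]
  constructor
  · rintro ⟨i, rfl⟩
    exact (hf i).trans_lt i.2
  · exact fun hx => ⟨⟨x, hx⟩, hf _⟩

lemma pairs_matching (k : ℕ) : pairs (matching k) univ = 2 * (k / 2) := by
  rw [pairs_univ_of_embedding (G' := blockGraph 2) ⟨⟨Fin.val, Fin.val_injective⟩, by
    intro a b; simp [blockGraph, matching, Fin.ext_iff]⟩ fun _ => rfl, pairs_blockGraph two_pos,
    cliquesPairs]
  have : k % 2 = 0 ∨ k % 2 = 1 := by omega
  rcases this with h | h <;> rw [h] <;> simp <;> ring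

lemma exists_not_hasPath_pairs {m : ℕ} (hm : 0 < m) (n : ℕ) :
    ∃ G : SimpleGraph (Fin n), ¬ HasPath G (m + 1) ∧ pairs G univ = cliquesPairs m n := by
  let f : Fin n ↪ ℕ := ⟨Fin.val, Fin.val_injective⟩
  refine ⟨(blockGraph m).comap f, fun h => not_hasPath_blockGraph hm
    (h.map (SimpleGraph.Embedding.comap f _).toHom f.injective), ?_⟩
  rw [pairs_univ_of_embedding (SimpleGraph.Embedding.comap f _) fun _ => rfl, pairs_blockGraph hm]

end Blocks


/-! ### The graph `K_{2l+3} ∪ M_{n-2l-3}`. -/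

section CliqueMatching

variable {V : Type*} {G : SimpleGraph V}

lemma pairs_eq_of_clique {s : Finset V} (h : ∀ x ∈ s, ∀ y ∈ s, x ≠ y → G.Adj x y) :
    pairs G s = #s * (#s - 1) := by
  rw [pairs, sum_congr rfl (g := fun _ => #s - 1), sum_const, smul_eq_mul]
  intro x hx
  rw [← card_erase_of_mem hx, degIn]
  congr 1
  ext y
  simp only [mem_filter, mem_erase]
  exact ⟨fun hy => ⟨hy.2.ne', hy.1⟩, fun hy => ⟨hy.2, h x hx y hy.2 hy.1.symm⟩⟩

/-- Labels matched vertices by `2j` and `2j + 1`, as in `matching`. Each induction step gives `0`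
and `1` to one matched pair and shifts the labels of the rest by two, so label halves agree exactly
on matched pairs. -/
lemma exists_matching_labelling {s : Finset V} (h1 : ∀ x ∈ s, degIn G s x ≤ 1)
    (h2 : pairs G s = 2 * (#s / 2)) : ∃ f : V → ℕ, (∀ x ∈ s, f x < #s) ∧ Set.InjOn f s ∧
      ∀ x ∈ s, ∀ y ∈ s, G.Adj x y ↔ x ≠ y ∧ f x / 2 = f y / 2 := by
  induction hk : #s using Nat.strong_induction_on generalizing s with
  | _ k ih =>
  by_cases hk2 : k ≤ 1
  · have hsub := card_le_one.1 (hk.trans_le hk2)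
    refine ⟨fun _ => 0, fun x hx => ?_, fun x hx y hy _ => hsub x hx y hy, fun x hx y hy => ?_⟩
    · exact hk ▸ card_pos.2 ⟨x, hx⟩
    · rw [hsub x hx y hy]
      simp
  · obtain ⟨a, ha, b, hb, hab⟩ : ∃ a ∈ s, ∃ b ∈ s, G.Adj a b := by
      by_contra hc
      push Not at hc
      have : pairs G s = 0 := by
        rw [pairs, sum_eq_zero_iff]
        intro x hx
        rw [degIn, card_eq_zero, filter_eq_empty_iff]
        exact fun y hy => hc x hx y hy
      omega
    have hb' : b ∈ s.erase a := mem_erase.2 ⟨hab.ne', hb⟩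
    have honly : ∀ x ∈ s, ∀ y ∈ s, ∀ z ∈ s, G.Adj x y → G.Adj x z → y = z := by
      intro x hx y hy z hz hxy hxz
      exact card_le_one.1 (h1 x hx) y (mem_filter.2 ⟨hy, hxy⟩) z (mem_filter.2 ⟨hz, hxz⟩)
    have e1 := pairs_erase (G := G) ha
    have e2 := pairs_erase (G := G) hb'
    have e3 : degIn G s a = 1 :=
      le_antisymm (h1 a ha) (card_pos.2 ⟨b, mem_filter.2 ⟨hb, hab⟩⟩)
    have e4 : degIn G (s.erase a) b = 0 := by
      rw [degIn, card_eq_zero, filter_eq_empty_iff]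
      intro y hy hby
      obtain ⟨hya, hy⟩ := mem_erase.1 hy
      exact hya (honly b hb y hy a ha hby hab.symm)
    have hc : #((s.erase a).erase b) = k - 2 := by
      rw [card_erase_of_mem hb', card_erase_of_mem ha, hk]; omega
    have hsub : (s.erase a).erase b ⊆ s := (erase_subset _ _).trans (erase_subset _ _)
    obtain ⟨f, f1, f2, f3⟩ := ih (k - 2) (by omega) (s := (s.erase a).erase b)
      (fun x hx => (degIn_mono hsub x).trans (h1 x (hsub hx))) (by rw [hc]; omega) hc
    have hmem : ∀ x ∈ s, x ≠ a → x ≠ b → x ∈ (s.erase a).erase b := fun x hx hxa hxb =>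
      mem_erase.2 ⟨hxb, mem_erase.2 ⟨hxa, hx⟩⟩
    refine ⟨fun x => if x = a then 0 else if x = b then 1 else f x + 2, ?_, ?_, ?_⟩
    · intro x hx
      by_cases hxa : x = a
      · simp only [hxa, if_true]; omega
      by_cases hxb : x = b
      · simp only [hxb, if_neg hab.ne', if_true]; omega
      · have := f1 x (hmem x hx hxa hxb)
        simp only [hxa, hxb, if_false]; omega
    · intro x hx y hy hxy
      simp only at hxy
      split_ifs at hxy with i1 i2 i3 i4 i5 i6 i7 <;> try omega
      · rw [i1, i2]
      · rw [i4, i6]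
      · exact f2 (hmem x hx i1 i4) (hmem y hy ‹_› ‹_›) (by omega)
    · intro x hx y hy
      by_cases hxa : x = a
      · subst hxa
        by_cases hya : y = x
        · simp [hya]
        by_cases hyb : y = b
        · subst hyb; simp [hab, hab.ne, hya]
        · have hno : ¬ G.Adj x y := fun e => hyb (honly x hx y hy b hb e hab)
          simp [hya, hyb, hno]
      by_cases hxb : x = b
      · subst hxb
        by_cases hya : y = a
        · subst hya; simp [hab.symm, hxa]
        by_cases hyb : y = x
        · simp [hyb]
        · have hno : ¬ G.Adj x y := fun e => hya (honly x hx y hy a ha e hab.symm)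
          simp [hya, hyb, hno, hxa]
      by_cases hya : y = a
      · subst hya
        have hno : ¬ G.Adj x y := fun e => hxb (honly y hy x hx b hb e.symm hab)
        simp [hxa, hxb, hno]
      by_cases hyb : y = b
      · subst hyb
        have hno : ¬ G.Adj x y := fun e => hxa (honly y hy x hx a ha e.symm hab.symm)
        simp [hya, hxa, hxb, hno]
      · rw [f3 x (hmem x hx hxa hxb) y (hmem y hy hya hyb)]
        simp [hya, hxa, hxb, hyb]

lemma exists_three_of_isPathList {L : List V} (hL : IsPathList G L) (h3 : 3 ≤ L.length) :
    ∃ a b c M, L = a :: b :: c :: M ∧ G.Adj a b ∧ G.Adj b c ∧ a ≠ c := by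
  match L, hL, h3 with
  | a :: b :: c :: M, hL, _ =>
    refine ⟨a, b, c, M, rfl, ?_, ?_, ?_⟩
    · have := hL.1; simp at this; exact this.1
    · have := hL.1; simp at this; exact this.2.1
    · have := hL.2; simp at this; exact this.1.2.1

variable [Fintype V]

lemma compl_eq_of_forall_mem_iff {s t : Finset V} (h : ∀ x, x ∈ t ↔ x ∉ s) : sᶜ = t := by
  ext x
  rw [mem_compl, h]

lemma IsCliqueMatching.subset_of_isPathList {C : Finset V} (h : IsCliqueMatching G C) {L : List V}
    (hL : IsPathList G L) (h3 : 3 ≤ L.length) : ∀ x ∈ L, x ∈ C := by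
  obtain ⟨a, b, c, M, rfl, hab, hbc, hac⟩ := exists_three_of_isPathList hL h3
  have hb : b ∈ C := by
    by_contra hb
    have ha : a ∉ C := fun ha => h.not_adj a ha b hb hab
    have hc : c ∉ C := fun hc => h.not_adj c hc b hb hbc.symm
    refine hac (card_le_one.1 (h.degIn_le b hb) a ?_ c ?_)
    · simp [ha, hab.symm]
    · simp [hc, hbc]
  have ha : a ∈ C := by
    by_contra ha
    exact h.not_adj b hb a ha hab.symm
  intro y hy
  obtain ⟨i, hi, rfl⟩ := List.getElem_of_mem hy
  induction i with
  | zero => exact ha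
  | succ i ih =>
    have := List.isChain_iff_getElem.1 hL.1 i hi
    by_contra hc
    exact h.not_adj _ (ih (by omega) (List.getElem_mem _)) _ hc this

/-- A path on at least three vertices cannot lie in the matching, so both paths would have to fit
into `C`. -/
lemma IsCliqueMatching.noTwoPaths {C : Finset V} (h : IsCliqueMatching G C) {k : ℕ} (hk : 3 ≤ k)
    (hC : #C < k + 3) : NoTwoPaths G k := by
  intro L L' hL hL' hd hLk hLk'
  have h1 := h.subset_of_isPathList hL (by omega)
  have h2 := h.subset_of_isPathList hL' hLk'
  have : (L ++ L').toFinset ⊆ C := by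
    intro x hx
    rw [List.mem_toFinset, List.mem_append] at hx
    exact hx.elim (h1 x) (h2 x)
  have := card_le_card this
  rw [List.toFinset_card_of_nodup (List.nodup_append'.2 ⟨hL.2, hL'.2, hd⟩),
    List.length_append] at this
  omega

lemma IsCliqueMatching.pairs_univ {C : Finset V} (h : IsCliqueMatching G C) :
    pairs G univ = #C * (#C - 1) + 2 * ((Fintype.card V - #C) / 2) := by
  have := pairs_union_of_forall_not_adj (G := G) (s := C) (t := Cᶜ) disjoint_compl_right
    fun x hx y hy => h.not_adj x hx y (mem_compl.1 hy)
  rw [union_compl] at this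
  rw [this, pairs_eq_of_clique h.clique, h.pairs_eq, card_compl]

lemma IsCliqueMatching.nonempty_iso {C : Finset V} {l : ℕ} (h : IsCliqueMatching G C)
    (hC : #C = 2 * l + 3) : Nonempty (G ≃g cliqueWithMatching (Fintype.card V) l) := by
  have hcV := card_le_univ C
  have hcc : #Cᶜ = Fintype.card V - (2 * l + 3) := by rw [card_compl, hC]
  obtain ⟨f, f1, f2, f3⟩ := exists_matching_labelling
    (fun x hx => h.degIn_le x (mem_compl.1 hx)) h.pairs_eq
  rw [hcc] at f1
  let g := C.equivFinOfCardEq hC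
  let F : V → Fin (2 * l + 3) ⊕ Fin (Fintype.card V - (2 * l + 3)) := fun x =>
    if hx : x ∈ C then Sum.inl (g ⟨x, hx⟩) else Sum.inr ⟨f x, f1 x (mem_compl.2 hx)⟩
  have F1 : ∀ x (hx : x ∈ C), F x = Sum.inl (g ⟨x, hx⟩) := fun x hx => dif_pos hx
  have F2 : ∀ x (hx : x ∉ C), F x = Sum.inr ⟨f x, f1 x (mem_compl.2 hx)⟩ :=
    fun x hx => dif_neg hx
  have hF : Function.Injective F := by
    intro x y hxy
    by_cases hx : x ∈ C <;> by_cases hy : y ∈ C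
    · rw [F1 x hx, F1 y hy] at hxy
      simpa using hxy
    · rw [F1 x hx, F2 y hy] at hxy
      simp at hxy
    · rw [F2 x hx, F1 y hy] at hxy
      simp at hxy
    · rw [F2 x hx, F2 y hy] at hxy
      simp only [Sum.inr.injEq, Fin.mk.injEq] at hxy
      exact f2 (by simpa using hx) (by simpa using hy) hxy
  have hb : Function.Bijective F :=
    (Fintype.bijective_iff_injective_and_card F).2 ⟨hF, by simp; omega⟩
  refine ⟨⟨Equiv.ofBijective F hb, ?_⟩⟩
  intro x y
  simp only [Equiv.ofBijective_apply]
  by_cases hx : x ∈ C <;> by_cases hy : y ∈ C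
  · rw [F1 x hx, F1 y hy]
    have : G.Adj x y ↔ x ≠ y := ⟨fun e => e.ne, h.clique x hx y hy⟩
    rw [this]
    simp
  · rw [F1 x hx, F2 y hy]
    have := h.not_adj x hx y hy
    simp [this]
  · rw [F2 x hx, F1 y hy]
    have : ¬ G.Adj x y := fun e => h.not_adj y hy x hx e.symm
    simp [this]
  · rw [F2 x hx, F2 y hy, f3 x (mem_compl.2 hx) y (mem_compl.2 hy)]
    have : f x ≠ f y ↔ x ≠ y := not_congr (f2.eq_iff (by simpa using hx) (by simpa using hy))
    rw [← this]
    simp [matching, Fin.ext_iff]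

lemma isCliqueMatching_cliqueWithMatching (n l : ℕ) :
    IsCliqueMatching (cliqueWithMatching n l) (univ.map Function.Embedding.inl) := by
  have hc := compl_eq_of_forall_mem_iff (s := univ.map Function.Embedding.inl) (t := univ.map
    Function.Embedding.inr) (V := Fin (2 * l + 3) ⊕ Fin (n - (2 * l + 3))) fun x => by
      cases x <;> simp
  let e : matching (n - (2 * l + 3)) ↪g cliqueWithMatching n l :=
    ⟨Function.Embedding.inr, by simp⟩
  have hpm := pairs_map e univ
  have hdm := fun x => degIn_map e univ x
  change pairs _ (univ.map Function.Embedding.inr) = _ at hpm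
  change ∀ x, degIn _ (univ.map Function.Embedding.inr) (Sum.inr x) = _ at hdm
  constructor
  · rintro (x | x) hx (y | y) hy hxy
    · simpa using hxy
    all_goals simp at hx hy
  · rintro (x | x) hx (y | y) hy
    · simp at hy
    · simp
    all_goals simp at hx
  · rintro (x | x) hx
    · simp at hx
    · rw [hc, hdm x, degIn, card_le_one]
      intro a ha b hb
      simp only [mem_filter, mem_univ, true_and] at ha hb
      obtain ⟨h1, h3⟩ : x ≠ a ∧ (x : ℕ) / 2 = (a : ℕ) / 2 := ha
      obtain ⟨h2, h4⟩ : x ≠ b ∧ (x : ℕ) / 2 = (b : ℕ) / 2 := hb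
      rw [Ne, Fin.ext_iff] at h1 h2
      rw [Fin.ext_iff]
      omega
  · rw [hc, hpm, pairs_matching]
    simp

end CliqueMatching


/-! ### The graph `K_l + (K_2 ∪ \bar K_{n-l-2})`. -/

section JoinEdge

variable {V : Type*} {G : SimpleGraph V} {A : Finset V} {x y : V}

section Univ

variable [Fintype V]

lemma IsJoinEdge.adj_of_notMem (h : IsJoinEdge G univ A x y) {a b : V} (ha : a ∉ A) (hb : b ∉ A)
    (hab : G.Adj a b) : (a = x ∧ b = y) ∨ (a = y ∧ b = x) := by
  have := ((h.adj_iff a (mem_univ _) b (mem_univ _)).1 hab).2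
  tauto

/-- Without the edge `xy`, no two consecutive vertices of the path lie outside `A`. -/
lemma IsJoinEdge.length_le_of_notMem (h : IsJoinEdge G univ A x y) : ∀ {L : List V},
    IsPathList G L → (x ∉ L ∨ y ∉ L) → L.length ≤ 2 * L.countP (· ∈ A) + 1
  | [], _, _ => by simp
  | [a], _, _ => by simp
  | a :: b :: L, hL, hxy => by
    have hadj : G.Adj a b := by
      have := hL.1; simp at this; exact this.1
    by_cases ha : a ∈ A
    · have := h.length_le_of_notMem (hL.drop 1) (by
        simp only [List.mem_cons, List.drop_succ_cons, List.drop_zero] at hxy ⊢; tauto)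
      simp only [List.drop_succ_cons, List.drop_zero, List.length_cons] at this
      simp only [List.countP_cons (a := a), ha, decide_true, if_true, List.length_cons]
      omega
    · by_cases hb : b ∈ A
      · have := h.length_le_of_notMem (hL.drop 2) (by
          simp only [List.mem_cons, List.drop_succ_cons, List.drop_zero] at hxy ⊢; tauto)
        simp only [List.drop_succ_cons, List.drop_zero] at this
        simp only [List.countP_cons, ha, hb, decide_true, if_true, List.length_cons]
        omega
      · exfalso
        rcases h.adj_of_notMem ha hb hadj with ⟨rfl, rfl⟩ | ⟨rfl, rfl⟩ <;> simp at hxy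

/-- The edge `xy` occurs at most once, which accounts for one more vertex. After it has been passed,
one of its ends is no longer available and the sharper bound applies. -/
lemma IsJoinEdge.length_le (h : IsJoinEdge G univ A x y) : ∀ {L : List V},
    IsPathList G L → L.length ≤ 2 * L.countP (· ∈ A) + 2
  | [], _ => by simp
  | [a], _ => by simp
  | a :: b :: L, hL => by
    have hadj : G.Adj a b := by
      have := hL.1; simp at this; exact this.1
    by_cases ha : a ∈ A
    · have := h.length_le (hL.drop 1)
      simp only [List.drop_succ_cons, List.drop_zero, List.length_cons] at this
      simp only [List.countP_cons (a := a), ha, decide_true, if_true, List.length_cons]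
      omega
    · by_cases hb : b ∈ A
      · have := h.length_le (hL.drop 2)
        simp only [List.drop_succ_cons, List.drop_zero] at this
        simp only [List.countP_cons, ha, hb, decide_true, if_true, List.length_cons]
        omega
      · have hal : a ∉ b :: L := (List.nodup_cons.1 hL.2).1
        have := h.length_le_of_notMem (hL.drop 1) (by
          simp only [List.drop_succ_cons, List.drop_zero]
          rcases h.adj_of_notMem ha hb hadj with ⟨rfl, rfl⟩ | ⟨rfl, rfl⟩
          · exact Or.inl hal
          · exact Or.inr hal)
        simp only [List.drop_succ_cons, List.drop_zero, List.length_cons] at this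
        simp only [List.countP_cons (a := a), ha, List.length_cons]
        omega

/-- A path on `2 * #A + 1` vertices uses all of `A`. What remains has no edge except possibly `xy`,
hence no `P_3`. -/
lemma IsJoinEdge.noTwoPaths (h : IsJoinEdge G univ A x y) : NoTwoPaths G (2 * #A + 1) := by
  intro L L' hL hL' hd hk hk'
  have hcount := h.length_le hL
  have hsub : (L.filter (· ∈ A)).toFinset ⊆ A := by
    intro z hz
    simp at hz
    exact hz.2
  have hcard : #(L.filter (· ∈ A)).toFinset = L.countP (· ∈ A) := by
    rw [List.toFinset_card_of_nodup (hL.2.filter _), List.countP_eq_length_filter]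
  have heq := eq_of_subset_of_card_le hsub (by omega)
  have hA : ∀ z ∈ L', z ∉ A := by
    intro z hz hzA
    rw [← heq] at hzA
    simp at hzA
    exact hd hzA.1 hz
  obtain ⟨a, b, c, M, rfl, hab, hbc, hac⟩ := exists_three_of_isPathList hL' hk'
  have h1 := h.adj_of_notMem (hA a (by simp)) (hA b (by simp)) hab
  have h2 := h.adj_of_notMem (hA b (by simp)) (hA c (by simp)) hbc
  have := h.ne
  rcases h1 with ⟨rfl, rfl⟩ | ⟨rfl, rfl⟩ <;> rcases h2 with ⟨h3, h4⟩ | ⟨h3, h4⟩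
  · exact this h3.symm
  · exact hac h4.symm
  · exact hac h4.symm
  · exact this h3

lemma IsJoinEdge.card_core (h : IsJoinEdge G univ A x y) :
    #(insert x (insert y A)) = #A + 2 := by
  rw [card_insert_of_notMem, card_insert_of_notMem h.right_notMem]
  simp [h.ne, h.left_notMem]

lemma IsJoinEdge.pairs_univ (h : IsJoinEdge G univ A x y) :
    pairs G univ = joinEdgePairs #A (Fintype.card V) := by
  set K := insert x (insert y A) with hK
  have hKc : #K = #A + 2 := h.card_core
  have hmem : ∀ {z}, z ∈ K ↔ z = x ∨ z = y ∨ z ∈ A := by simp [hK]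
  have hcl : ∀ a ∈ K, ∀ b ∈ K, a ≠ b → G.Adj a b := by
    intro a ha b hb hab
    rw [h.adj_iff a (mem_univ _) b (mem_univ _)]
    refine ⟨hab, ?_⟩
    rcases hmem.1 ha with rfl | rfl | ha <;> rcases hmem.1 hb with rfl | rfl | hb <;> tauto
  have e := pairs_union_of_independent (G := G) (s := K) (t := Kᶜ) disjoint_compl_right
    (fun a ha b hb hab => by
      rw [mem_compl, hmem] at ha hb
      have := h.adj_of_notMem (fun e => ha (Or.inr (Or.inr e))) (fun e => hb (Or.inr (Or.inr e))) hab
      tauto)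
  have hd : ∀ z ∈ Kᶜ, degIn G K z = #A := by
    intro z hz
    rw [degIn]
    congr 1
    ext a
    rw [mem_compl, hmem] at hz
    rw [mem_filter, hmem, h.adj_iff z (mem_univ _) a (mem_univ _)]
    constructor
    · tauto
    · intro ha
      refine ⟨Or.inr (Or.inr ha), ?_, Or.inr (Or.inl ha)⟩
      rintro rfl
      tauto
  rw [union_compl, pairs_eq_of_clique hcl, sum_congr rfl hd, sum_const, smul_eq_mul, card_compl,
    hKc] at e
  rw [e, joinEdgePairs, show #A + 2 - 1 = #A + 1 by omega]
  ring

lemma IsJoinEdge.nonempty_iso {l : ℕ} (h : IsJoinEdge G univ A x y) (hA : #A = l) :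
    Nonempty (G ≃g joinWithEdge (Fintype.card V) l) := by
  set K := insert x (insert y A) with hK
  have hKc : #Kᶜ = Fintype.card V - (l + 2) := by rw [card_compl, h.card_core, hA]
  have hcV := card_le_univ K
  rw [h.card_core, hA] at hcV
  let e₁ := A.equivFinOfCardEq hA
  let e₂ := (Kᶜ).equivFinOfCardEq hKc
  have hmem : ∀ {z}, z ∉ A → z ≠ x → z ≠ y → z ∈ Kᶜ := by
    intro z h1 h2 h3
    simp [hK, h1, h2, h3]
  let F : V → Fin l ⊕ (Fin 2 ⊕ Fin (Fintype.card V - (l + 2))) := fun z =>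
    if h1 : z ∈ A then Sum.inl (e₁ ⟨z, h1⟩)
    else if h2 : z = x then Sum.inr (Sum.inl 0)
    else if h3 : z = y then Sum.inr (Sum.inl 1)
    else Sum.inr (Sum.inr (e₂ ⟨z, hmem h1 h2 h3⟩))
  have F1 : ∀ z (h1 : z ∈ A), F z = Sum.inl (e₁ ⟨z, h1⟩) := fun z h1 => dif_pos h1
  have F2 : F x = Sum.inr (Sum.inl 0) := by simp [F, h.left_notMem]
  have F3 : F y = Sum.inr (Sum.inl 1) := by simp [F, h.right_notMem, h.ne.symm]
  have F4 : ∀ z (h1 : z ∉ A) (h2 : z ≠ x) (h3 : z ≠ y),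
      F z = Sum.inr (Sum.inr (e₂ ⟨z, hmem h1 h2 h3⟩)) := by
    intro z h1 h2 h3
    simp [F, h1, h2, h3]
  have cases4 : ∀ z, z ∈ A ∨ z = x ∨ z = y ∨ (z ∉ A ∧ z ≠ x ∧ z ≠ y) := by
    intro z; tauto
  have hxA := h.left_notMem
  have hyA := h.right_notMem
  have hne := h.ne
  have hF : Function.Injective F := by
    intro a b hab
    rcases cases4 a with ha | rfl | rfl | ⟨a1, a2, a3⟩ <;>
      rcases cases4 b with hb | rfl | rfl | ⟨b1, b2, b3⟩ <;>
      simp_all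
  have hb : Function.Bijective F :=
    (Fintype.bijective_iff_injective_and_card F).2 ⟨hF, by simp; omega⟩
  refine ⟨⟨Equiv.ofBijective F hb, ?_⟩⟩
  intro a b
  simp only [Equiv.ofBijective_apply]
  rw [h.adj_iff a (mem_univ _) b (mem_univ _)]
  rcases cases4 a with ha | rfl | rfl | ⟨a1, a2, a3⟩ <;>
    rcases cases4 b with hb | rfl | rfl | ⟨b1, b2, b3⟩ <;>
    simp_all [join] <;> (intro e; subst e; simp_all)

end Univ

lemma isJoinEdge_joinWithEdge (n l : ℕ) : IsJoinEdge (joinWithEdge n l) univ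
    (univ.map Function.Embedding.inl) (Sum.inr (Sum.inl 0)) (Sum.inr (Sum.inl 1)) where
  subset := subset_univ _
  left_mem := mem_univ _
  right_mem := mem_univ _
  left_notMem := by simp
  right_notMem := by simp
  ne := by simp
  adj_iff := by
    rintro (a | a | a) - (b | b | b) - <;> simp [join]
    fin_cases a <;> fin_cases b <;> simp

end JoinEdge


/-! ### The bracket numbers as doubled edge counts. -/

section Brackets

lemma two_mul_choose_two (n : ℕ) : 2 * n.choose 2 = n * (n - 1) := by
  rw [Nat.choose_two_right, Nat.mul_div_cancel' (Nat.even_mul_pred_self n).two_dvd]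

variable {l n : ℕ}

lemma two_mul_bracket₃_self (hl : 2 ≤ l) (hn : 2 * l + 4 ≤ n) :
    2 * bracket₃ n (2 * l + 1) (2 * l + 1) = cliquesPairs (2 * l) n := by
  -- The bracket counts the first block `K_{2l}` separately, so its quotient is one smaller than `n
  -- / (2l)`, with the same remainder.
  rw [bracket₃, if_neg (by omega), Nat.add_sub_cancel, cliquesPairs,
    Nat.div_eq_sub_div (a := n) (by omega) (by omega), Nat.mod_eq_sub_mod (a := n) (by omega),
    mul_add, mul_add, mul_left_comm, two_mul_choose_two, two_mul_choose_two]
  ring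

lemma two_mul_bracket₃_three (hn : 2 * l + 4 ≤ n) :
    2 * bracket₃ n (2 * l + 4) 3 = cliqueMatchingPairs l n := by
  rw [bracket₃, if_neg (by omega), show 2 * l + 4 - 1 = 2 * l + 3 by omega, cliqueMatchingPairs,
    mul_add, mul_add, two_mul_choose_two]
  -- The remainder modulo `2` is the possible isolated vertex of the matching.
  have h : ((n - (2 * l + 3)) % (3 - 1)).choose 2 = 0 :=
    Nat.choose_eq_zero_of_lt (Nat.mod_lt _ two_pos)
  rw [h]
  simp

lemma two_mul_bracket₂_add_one (hn : 2 * l + 4 ≤ n) :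
    2 * (bracket₂ n (2 * l + 2) + 1) = joinEdgePairs l n := by
  obtain ⟨q, rfl⟩ := Nat.exists_eq_add_of_le hn
  have h := two_mul_choose_two l
  rw [bracket₂, joinEdgePairs, show (2 * l + 2) / 2 - 1 = l by omega,
    show (2 * l + 2 - 2) / 2 = l by omega,
    show 2 * l + 4 + q - (2 * l + 2) / 2 + 1 = l + 4 + q by omega,
    show 2 * l + 4 + q - (l + 2) = l + 2 + q by omega]
  cases l with
  | zero => simp at h ⊢
  | succ k =>
    rw [Nat.add_sub_cancel] at h
    nlinarith

lemma two_mul_maxBracket (hl : 2 ≤ l) (hn : 2 * l + 4 ≤ n) : 2 * maxBracket n l =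
    max (max (cliquesPairs (2 * l) n) (cliqueMatchingPairs l n)) (joinEdgePairs l n) := by
  rw [maxBracket, ← Nat.mul_max_mul_left, ← Nat.mul_max_mul_left, two_mul_bracket₃_self hl hn,
    two_mul_bracket₃_three hn, two_mul_bracket₂_add_one hn]

end Brackets

/-! ### Extremal numbers and extremal graphs. -/

section Extremal

variable {V : Type*} {G : SimpleGraph V} {l n : ℕ}

lemma pathGraph_free_iff {k : ℕ} : (SimpleGraph.pathGraph k).Free G ↔ ¬ HasPath G k :=
  not_congr pathGraph_isContained_iff

lemma noTwoPaths_of_not_hasPath {k : ℕ} (h : ¬ HasPath G k) : NoTwoPaths G k :=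
  fun L _ hL _ _ hk _ => h ⟨L, hL, hk⟩

lemma twoPaths_free_of_pathGraph_free (h : (SimpleGraph.pathGraph (2 * l + 1)).Free G) :
    (twoPaths l).Free G :=
  twoPaths_free_iff.2 (noTwoPaths_of_not_hasPath (pathGraph_free_iff.1 h))

variable [Fintype V]

lemma pairs_univ_le_extremalNumber {W : Type*} {H : SimpleGraph W} (h : H.Free G)
    (hV : Fintype.card V = n) : pairs G univ ≤ 2 * SimpleGraph.extremalNumber n H := by
  rw [← two_mul_card_edgeFinset, ← hV]
  exact Nat.mul_le_mul_left _ (SimpleGraph.card_edgeFinset_le_extremalNumber h)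

lemma isExtremal_free_iff_pairs {W : Type*} {H : SimpleGraph W} [DecidableRel G.Adj]
    (hV : Fintype.card V = n) : G.IsExtremal H.Free ↔
      H.Free G ∧ pairs G univ = 2 * SimpleGraph.extremalNumber n H := by
  rw [SimpleGraph.isExtremal_free_iff, ← two_mul_card_edgeFinset, hV]
  simp

lemma pairs_univ_le_cliquesPairs (hl : 2 ≤ l) (hV : Fintype.card V = n)
    (h : (SimpleGraph.pathGraph (2 * l + 1)).Free G) :
    pairs G univ ≤ cliquesPairs (2 * l) n := by
  have := pairs_le_cliquesPairs hl (pathGraph_free_iff.1 h) univ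
  rwa [card_univ, hV] at this

lemma extremalNumber_pathGraph (hl : 2 ≤ l) (n : ℕ) :
    2 * SimpleGraph.extremalNumber n (SimpleGraph.pathGraph (2 * l + 1)) =
      cliquesPairs (2 * l) n := by
  obtain ⟨G, hG, hp⟩ := exists_not_hasPath_pairs (m := 2 * l) (by omega) n
  refine le_antisymm ?_ (hp ▸ pairs_univ_le_extremalNumber (pathGraph_free_iff.2 hG) (by simp))
  suffices SimpleGraph.extremalNumber n (SimpleGraph.pathGraph (2 * l + 1)) ≤
    cliquesPairs (2 * l) n / 2 by omega
  nth_rw 1 [← Fintype.card_fin n]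
  rw [SimpleGraph.extremalNumber_le_iff]
  intro G' _ h
  have := pairs_univ_le_cliquesPairs hl (Fintype.card_fin n) h
  rw [← two_mul_card_edgeFinset] at this
  omega

lemma free_and_pairs_of_iso {W U : Type*} [Fintype W] {H : SimpleGraph U} {G' : SimpleGraph W}
    (e : G ≃g G') {k : ℕ} (h : H.Free G' ∧ pairs G' univ = k) :
    H.Free G ∧ pairs G univ = k :=
  ⟨(SimpleGraph.free_congr SimpleGraph.Iso.refl e).2 h.1, (pairs_iso e).symm.trans h.2⟩

lemma cliqueWithMatching_free (hl : 2 ≤ l) (n : ℕ) :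
    (twoPaths l).Free (cliqueWithMatching n l) ∧
      pairs (cliqueWithMatching n l) univ = cliqueMatchingPairs l n := by
  have h := isCliqueMatching_cliqueWithMatching n l
  refine ⟨twoPaths_free_iff.2 (h.noTwoPaths (by omega) (by simp)), ?_⟩
  rw [h.pairs_univ, cliqueMatchingPairs]
  simp

lemma joinWithEdge_free (hn : 2 * l + 4 ≤ n) :
    (twoPaths l).Free (joinWithEdge n l) ∧
      pairs (joinWithEdge n l) univ = joinEdgePairs l n := by
  have h := isJoinEdge_joinWithEdge n l
  refine ⟨twoPaths_free_iff.2 (by simpa using h.noTwoPaths), ?_⟩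
  rw [h.pairs_univ]
  congr 1
  · simp
  · simp; omega

/-- A graph without `P_{2l+1} ∪ P_3` has at most `maxBracket n l` edges, and the graphs attaining
the bound are known. -/
theorem pairs_univ_le_maxBracket (hl : 2 ≤ l) (hn : 2 * l + 4 ≤ n) (hV : Fintype.card V = n)
    (h : (twoPaths l).Free G) :
    pairs G univ < 2 * maxBracket n l ∨ pairs G univ = 2 * maxBracket n l ∧
      (bracket₃ n (2 * l + 1) (2 * l + 1) = maxBracket n l ∧
          (SimpleGraph.pathGraph (2 * l + 1)).Free G ∨
        bracket₃ n (2 * l + 4) 3 = maxBracket n l ∧ Nonempty (G ≃g cliqueWithMatching n l) ∨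
        bracket₂ n (2 * l + 2) + 1 = maxBracket n l ∧ Nonempty (G ≃g joinWithEdge n l)) := by
  have hmax := two_mul_maxBracket hl hn
  have e1 := two_mul_bracket₃_self hl hn
  have e2 := two_mul_bracket₃_three hn
  have e3 := two_mul_bracket₂_add_one hn
  by_cases hp : (SimpleGraph.pathGraph (2 * l + 1)).Free G
  · have := pairs_univ_le_cliquesPairs hl hV hp
    rcases lt_or_ge (pairs G univ) (2 * maxBracket n l) with h1 | h1
    · exact Or.inl h1
    · have h2 : pairs G univ = 2 * maxBracket n l := by omega
      have h3 : bracket₃ n (2 * l + 1) (2 * l + 1) = maxBracket n l := by omega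
      exact Or.inr ⟨h2, Or.inl ⟨h3, hp⟩⟩
  · rw [pathGraph_free_iff, not_not] at hp
    have key := pairs_univ_le_max hl (twoPaths_free_iff.1 h) hp (hV ▸ hn)
    rw [hV] at key
    rcases key with h1 | ⟨h1, C, hC, hG⟩ | ⟨h1, A, x, y, hA, hG⟩
    · left; omega
    · rcases lt_or_ge (pairs G univ) (2 * maxBracket n l) with h2 | h2
      · exact Or.inl h2
      · have h3 : pairs G univ = 2 * maxBracket n l := by omega
        have h4 : bracket₃ n (2 * l + 4) 3 = maxBracket n l := by omega
        exact Or.inr ⟨h3, Or.inr (Or.inl ⟨h4, hV ▸ hG.nonempty_iso hC⟩)⟩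
    · rcases lt_or_ge (pairs G univ) (2 * maxBracket n l) with h2 | h2
      · exact Or.inl h2
      · have h3 : pairs G univ = 2 * maxBracket n l := by omega
        have h4 : bracket₂ n (2 * l + 2) + 1 = maxBracket n l := by omega
        exact Or.inr ⟨h3, Or.inr (Or.inr ⟨h4, hV ▸ hG.nonempty_iso hA⟩)⟩

theorem extremalNumber_twoPaths (hl : 2 ≤ l) (hn : 2 * l + 4 ≤ n) :
    SimpleGraph.extremalNumber n (twoPaths l) = maxBracket n l := by
  refine le_antisymm ?_ ?_
  · nth_rw 1 [← Fintype.card_fin n]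
    rw [SimpleGraph.extremalNumber_le_iff]
    intro G _ h
    have := pairs_univ_le_maxBracket hl hn (by simp) h
    rw [← two_mul_card_edgeFinset] at this
    omega
  -- Each term of the maximum is attained: by disjoint cliques `K_{2l}` with a remainder clique, by
  -- a clique with a matching, and by the join with one extra edge.
  · have hmax := two_mul_maxBracket hl hn
    have h1 : cliquesPairs (2 * l) n ≤ 2 * SimpleGraph.extremalNumber n (twoPaths l) := by
      obtain ⟨G, hG, hp⟩ := exists_not_hasPath_pairs (m := 2 * l) (by omega) n
      rw [← hp]
      exact pairs_univ_le_extremalNumber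
        (twoPaths_free_of_pathGraph_free (pathGraph_free_iff.2 hG)) (by simp)
    have h2 : cliqueMatchingPairs l n ≤ 2 * SimpleGraph.extremalNumber n (twoPaths l) := by
      obtain ⟨hf, hp⟩ := cliqueWithMatching_free hl n
      rw [← hp]
      exact pairs_univ_le_extremalNumber hf (by simp; omega)
    have h3 : joinEdgePairs l n ≤ 2 * SimpleGraph.extremalNumber n (twoPaths l) := by
      obtain ⟨hf, hp⟩ := joinWithEdge_free hn
      rw [← hp]
      exact pairs_univ_le_extremalNumber hf (by simp; omega)
    omega

end Extremal

end DisjointPaths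

theorem theorem1p8 (l n : ℕ) (hl : 2 ≤ l) (hn : 2 * l + 4 ≤ n) :
    SimpleGraph.extremalNumber n (DisjointPaths.twoPaths l) = DisjointPaths.maxBracket n l ∧
    ∀ {V : Type*} [Fintype V] (G : SimpleGraph V) [DecidableRel G.Adj], Fintype.card V = n →
      (G.IsExtremal (DisjointPaths.twoPaths l).Free ↔
        (DisjointPaths.bracket₃ n (2 * l + 1) (2 * l + 1) = DisjointPaths.maxBracket n l ∧
          G.IsExtremal (SimpleGraph.pathGraph (2 * l + 1)).Free) ∨
        (DisjointPaths.bracket₃ n (2 * l + 4) 3 = DisjointPaths.maxBracket n l ∧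
          Nonempty (G ≃g DisjointPaths.cliqueWithMatching n l)) ∨
        (DisjointPaths.bracket₂ n (2 * l + 2) + 1 = DisjointPaths.maxBracket n l ∧
          Nonempty (G ≃g DisjointPaths.joinWithEdge n l))) := by
  open DisjointPaths in
  refine ⟨extremalNumber_twoPaths hl hn, fun {V} _ G _ hV => ?_⟩
  rw [isExtremal_free_iff_pairs hV, isExtremal_free_iff_pairs hV, extremalNumber_twoPaths hl hn,
    extremalNumber_pathGraph hl, ← two_mul_bracket₃_self hl hn]
  constructor
  · rintro ⟨hf, hp⟩
    obtain h | ⟨-, ⟨h, hf'⟩ | h | h⟩ := pairs_univ_le_maxBracket hl hn hV hf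
    · omega
    · exact Or.inl ⟨h, hf', by rw [hp, h]⟩
    · exact Or.inr (Or.inl h)
    · exact Or.inr (Or.inr h)
  · rintro (⟨h, hf, hp⟩ | ⟨h, ⟨e⟩⟩ | ⟨h, ⟨e⟩⟩)
    · exact ⟨twoPaths_free_of_pathGraph_free hf, by rw [hp, h]⟩
    · rw [← h, two_mul_bracket₃_three hn]
      exact free_and_pairs_of_iso e (cliqueWithMatching_free hl n)
    · rw [← h, two_mul_bracket₂_add_one hn]
      exact free_and_pairs_of_iso e (joinWithEdge_free hn)
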